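/- **Setting.** A MaxQP instance is a real $n\times n$ matrix $A=(a_{ij})$ with nonnegative diagonal entries. For every instance $A$ let $U(A)=(\vec u_1,\dots,\vec u_n)$ be an optimal solution of the SDP relaxation: maximize $\sum_{i,j}a_{ij}\langle \vec u_i,\vec u_j\rangle$ subject to $\vec u_i\in S^{n-1}$ (optimal solutions are not unique; $U$ is any fixed measurable choice, namely that of the SDP solver in use). For $s>0$ let $\phi_s(y)=-1$ if $y<-s$, $\phi_s(y)=y/s$ if $-s\le y\le s$, and $\phi_s(y)=1$ if $y>s$. Let $$\mathrm{slin}_s(A,\vec Z)=\sum_{i,j}a_{ij}\,\phi_s(\langle\vec u_i,\vec Z\rangle)\,\phi_s(\langle\vec u_j,\vec Z\rangle),\qquad \mathrm{slin}^*_s(A)=\mathbb E_{\vec Z\sim\mathcal Z}[\mathrm{slin}_s(A,\vec Z)],$$ where $\mathcal Z$ is the standard Gaussian distribution on $\mathbb R^n$; this is the expected value of the fractional assignment that RPR$^2$ returns with the rounding function $\phi_s$. **Algorithm.** On a sample $\mathcal S=\{(A^{(1)},\vec Z^{(1)}),\dots,(A^{(m)},\vec Z^{(m)})\}$: (1) solve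 for the SDP embeddings $\vec u^{(i)}_1,\dots,\vec u^{(i)}_n$ of the $A^{(i)}$; (2) let $T=\{s_1<\dots<s_{|T|}\}$ be the set of all $s>0$ of the form $|\langle\vec Z^{(i)},\vec u^{(i)}_j\rangle|$; (3) for $1\le i<|T|$ let $\hat s_i$ be a maximizer over $[s_i,s_{i+1}]$ of $\frac1m\sum_{l}\mathrm{slin}_s(A^{(l)},\vec Z^{(l)})$; (4) return an $\hat s\in\{\hat s_1,\dots,\hat s_{|T|-1}\}$ with the largest value of this average. Ties may be broken arbitrarily. If $|T|=1$, return $s_1$; if $T=\emptyset$, return any $s>0$. **Theorem.** There is a universal constant $c>0$ such that the following holds. (a) *Learning.* Let $n\ge1$, let $\mathcal D$ be a probability distribution over $n\times n$ MaxQP instances, and let $H$ be such that for $\mathcal D$-almost every $A$, $|\mathrm{slin}_s(A,\vec Z)|\le H$ for all $s>0$ and $\vec Z\in\mathbb R^n$. Let $\epsilon>0$, $\delta\in(0,1]$ and $m\ge c\,(H/\epsilon)^2\left(\log\max(n,2)+\log\frac1\delta\right)$. Then, with probability at least $1-\delta$ over $\mathcal S\sim(\mathcal D\times\mathcal Z)^m$,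 every output $\hat s$ of the algorithm on $\mathcal S$ satisfies $$\mathbb E_{A\sim\mathcal D}[-\mathrm{slin}^*_{\hat s}(A)]-\inf_{s>0}\mathbb E_{A\sim\mathcal D}[-\mathrm{slin}^*_s(A)]<\epsilon,$$ that is, the algorithm $(\epsilon,\delta)$-learns the class of $s$-linear rounding functions with respect to the cost function $-\mathrm{slin}^*_s$. (b) *Computational efficiency.* The algorithm can be implemented by one program of a real random access machine (exact field operations and comparisons of real numbers; natural-number registers with addition and subtraction for indices and loops) with a subroutine that solves the SDP, one call of which is counted as one step. On every sample of $m$ pairs with $n\times n$ instances, and for every SDP solver $U$, the program returns an output of the algorithm after a number of steps that is polynomial in $m$ and $n$ and at most $m$ calls of the SDP solver. In particular, on samples of size $m=\lceil c\,(H/\epsilon)^2(\log\max(n,2)+\log\frac1\delta)\rceil$ with $H\ge 0$, $\epsilon>0$ and $\delta\in(0,1]$, its number of steps is polynomial in $n$, $H/\epsilon$ and $1/\delta$. -/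

import Mathlib

open MeasureTheory ProbabilityTheory

namespace MaxQP

noncomputable section

/-! ## The problem, its SDP relaxation, and `s`-linear rounding -/

/-- Vectors of `ℝⁿ` with the Euclidean inner product. -/
abbrev Vec (n : ℕ) : Type := EuclideanSpace ℝ (Fin n)

/-- Real `n × n` matrices `(a_{ij})`, with the product (Borel) σ-algebra. -/
abbrev Mat (n : ℕ) : Type := Fin n → Fin n → ℝ

/-- A MaxQP instance: a real matrix with nonnegative diagonal entries. -/
def IsInstance {n : ℕ} (A : Mat n) : Prop := ∀ i, 0 ≤ A i i

/-- `u₁, …, uₙ` is an optimal solution of the SDP relaxation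
`maximize ∑ a_{ij} ⟨u_i, u_j⟩` over vectors of the unit sphere `S^{n-1}`. -/
def IsSDPEmbedding {n : ℕ} (A : Mat n) (u : Fin n → Vec n) : Prop :=
  (∀ i, ‖u i‖ = 1) ∧
    ∀ v : Fin n → Vec n, (∀ i, ‖v i‖ = 1) →
      ∑ i, ∑ j, A i j * inner ℝ (v i) (v j) ≤ ∑ i, ∑ j, A i j * inner ℝ (u i) (u j)

/-- A choice, for every MaxQP instance, of an optimal embedding (the optimum is not unique). -/
def IsSDPSolver {n : ℕ} (U : Mat n → Fin n → Vec n) : Prop :=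
  ∀ A, IsInstance A → IsSDPEmbedding A (U A)

/-- The `s`-linear rounding function `φ_s`. -/
def phi (s y : ℝ) : ℝ := if y < -s then -1 else if y ≤ s then y / s else 1

/-- `slin_s(A, Z) = ∑_{i,j} a_{ij} φ_s(⟨u_i, Z⟩) φ_s(⟨u_j, Z⟩)`: the value of the fractional
assignment obtained from the SDP embedding `u = U A` of `A`. -/
def slin {n : ℕ} (U : Mat n → Fin n → Vec n) (s : ℝ) (A : Mat n) (Z : Vec n) : ℝ :=
  ∑ i, ∑ j, A i j * (phi s (inner ℝ (U A i) Z) * phi s (inner ℝ (U A j) Z))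

/-- `slin*_s(A) = 𝔼_Z[slin_s(A, Z)]` for a standard `n`-dimensional Gaussian `Z`. -/
def slinStar {n : ℕ} (U : Mat n → Fin n → Vec n) (s : ℝ) (A : Mat n) : ℝ :=
  ∫ Z, slin U s A Z ∂(stdGaussian (Vec n))

/-- The expected cost `𝔼_{A ∼ D}[-slin*_s(A)]` of the parameter `s`. -/
def expCost {n : ℕ} (U : Mat n → Fin n → Vec n) (D : Measure (Mat n)) (s : ℝ) : ℝ :=
  ∫ A, -slinStar U s A ∂D

/-! ## Empirical maximization over the breakpoints `|⟨u_i, Z⟩|` -/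

/-- A sample of `m` pairs `(A, Z)`. -/
abbrev Sample (m n : ℕ) : Type := Fin m → Mat n × Vec n

/-- `(1/m) ∑_i slin_s(A⁽ⁱ⁾, Z⁽ⁱ⁾)`. -/
def empirical {m n : ℕ} (U : Mat n → Fin n → Vec n) (S : Sample m n) (s : ℝ) : ℝ :=
  (1 / (m : ℝ)) * ∑ i, slin U s (S i).1 (S i).2

/-- The set `T` of all `s > 0` of the form `|⟨Z⁽ⁱ⁾, u_j⁽ⁱ⁾⟩|`. -/
def thresholds {m n : ℕ} (U : Mat n → Fin n → Vec n) (S : Sample m n) : Set ℝ :=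
  {s | 0 < s ∧ ∃ (i : Fin m) (j : Fin n), |inner ℝ (U (S i).1 j) (S i).2| = s}

/-- `a < b` are consecutive elements of `T`. -/
def Consecutive (T : Set ℝ) (a b : ℝ) : Prop :=
  a ∈ T ∧ b ∈ T ∧ a < b ∧ ∀ t ∈ T, ¬ (a < t ∧ t < b)

/-- `sHat` is a possible output of the empirical maximization algorithm on the sample `S`:
compute the embeddings and the thresholds `T = {s₁ < ⋯ < s_|T|}`; for each pair of consecutive
thresholds take a maximizer `cand s_i s_{i+1}` of the empirical average on `[s_i, s_{i+1}]`;
return a candidate with the largest empirical average. Ties may be broken in any way. If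
`T = {s₁}` there is no such pair and `s₁` is returned; if `T` is empty, any `s > 0` may be. -/
def IsERMOutput {m n : ℕ} (U : Mat n → Fin n → Vec n) (S : Sample m n) (sHat : ℝ) : Prop :=
  let T := thresholds U S
  let h := empirical U S
  (T = ∅ ∧ 0 < sHat) ∨ T = {sHat} ∨
    ∃ cand : ℝ → ℝ → ℝ,
      (∀ a b, Consecutive T a b →
        cand a b ∈ Set.Icc a b ∧ ∀ s ∈ Set.Icc a b, h s ≤ h (cand a b)) ∧
      (∃ a b, Consecutive T a b ∧ sHat = cand a b) ∧
      ∀ a b, Consecutive T a b → h (cand a b) ≤ h sHat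

/-- The sample size `c (H/ε)² (log n + log (1/δ))`, where `n = 1` is treated like `n = 2`. -/
def sampleSize (c H ε δ : ℝ) (n : ℕ) : ℝ :=
  c * (H / ε) ^ 2 * (Real.log (max n 2 : ℕ) + Real.log (1 / δ))

/-! ## A real random access machine with an SDP solver as a subroutine

Programs are finite texts, independent of the input. A machine has natural-number registers, which
are used for indices and loop bounds only and admit addition and subtraction, and arrays of exact
real numbers with three indices, on which the four field operations and comparisons are available.
Every elementary instruction, test and loop iteration costs one step. A call of the SDP solver is a
single instruction; such calls are also counted separately. -/

/-- The state of the machine. `reals a i j k` is the entry `(i, j, k)` of the array `a`. -/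
structure State where
  nats : ℕ → ℕ
  reals : ℕ → ℕ → ℕ → ℕ → ℝ
  steps : ℕ
  calls : ℕ

/-- A reference to an array entry whose three indices are the contents of the natural-number
registers `i`, `j`, `k`. -/
structure Ref where
  array : ℕ
  i : ℕ
  j : ℕ
  k : ℕ

/-- The field operations (with `x / 0 = 0`). -/
inductive Op where
  | add | sub | mul | div

/-- The meaning of a field operation. -/
def Op.eval : Op → ℝ → ℝ → ℝ
  | .add, x, y => x + y
  | .sub, x, y => x - y
  | .mul, x, y => x * y
  | .div, x, y => x / y

/-- Programs of the machine. -/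
inductive Prog where
  /-- do nothing -/
  | skip
  /-- `x := c` -/
  | natConst (x c : ℕ)
  /-- `x := y + z` -/
  | natAdd (x y z : ℕ)
  /-- `x := max (y - z) 0` -/
  | natSub (x y z : ℕ)
  /-- `r := c` -/
  | realConst (r : Ref) (c : ℤ)
  /-- `r := r₁ op r₂` -/
  | arith (op : Op) (r r₁ r₂ : Ref)
  /-- With `d`, `i` the contents of the registers `x`, `y`: apply the SDP solver to the `d × d`
  matrix `src(i, ·, ·)` and store the `l`-th vector of the embedding in `dst(i, l, ·)`. -/
  | sdp (x y src dst : ℕ)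
  /-- `p` and then `q` -/
  | seq (p q : Prog)
  /-- if `x < y` then `p` else `q`, for natural-number registers -/
  | ifNat (x y : ℕ) (p q : Prog)
  /-- if `r₁ < r₂` then `p` else `q`, for real numbers -/
  | ifReal (r₁ r₂ : Ref) (p q : Prog)
  /-- for `x = 0, …, N - 1` do `p`, where `N` is the content of `y` when the loop starts -/
  | loop (x y : ℕ) (p : Prog)

namespace State

/-- Charge one step. -/
def tick (σ : State) : State := { σ with steps := σ.steps + 1 }

/-- Write a natural-number register. -/
def setNat (σ : State) (x v : ℕ) : State :=
  { σ with nats := fun x' => if x' = x then v else σ.nats x' }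

/-- Read an array entry. -/
def get (σ : State) (r : Ref) : ℝ := σ.reals r.array (σ.nats r.i) (σ.nats r.j) (σ.nats r.k)

/-- Write an array entry. -/
def set (σ : State) (r : Ref) (v : ℝ) : State :=
  { σ with reals := fun a i j k =>
      if a = r.array ∧ i = σ.nats r.i ∧ j = σ.nats r.j ∧ k = σ.nats r.k then v
      else σ.reals a i j k }

/-- Call the SDP solver on the `d × d` matrix `src(i, ·, ·)`, and store the result in `dst`. -/
def callSDP (U : (d : ℕ) → Mat d → Fin d → Vec d) (σ : State) (d i src dst : ℕ) : State :=
  { σ with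
    calls := σ.calls + 1
    reals := fun a i' j k =>
      if h : a = dst ∧ i' = i ∧ j < d ∧ k < d then
        U d (fun p q => σ.reals src i p q) ⟨j, h.2.2.1⟩ ⟨k, h.2.2.2⟩
      else σ.reals a i' j k }

end State

/-- Execution of a program with the SDP solver `U`, including the count of steps and calls. -/
def Prog.exec (U : (d : ℕ) → Mat d → Fin d → Vec d) : Prog → State → State
  | .skip, σ => σ.tick
  | .natConst x c, σ => (σ.setNat x c).tick
  | .natAdd x y z, σ => (σ.setNat x (σ.nats y + σ.nats z)).tick
  | .natSub x y z, σ => (σ.setNat x (σ.nats y - σ.nats z)).tick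
  | .realConst r c, σ => (σ.set r c).tick
  | .arith op r r₁ r₂, σ => (σ.set r (op.eval (σ.get r₁) (σ.get r₂))).tick
  | .sdp x y src dst, σ => (σ.callSDP U (σ.nats x) (σ.nats y) src dst).tick
  | .seq p q, σ => q.exec U (p.exec U σ)
  | .ifNat x y p q, σ =>
      if σ.nats x < σ.nats y then p.exec U σ.tick else q.exec U σ.tick
  | .ifReal r₁ r₂ p q, σ =>
      if σ.get r₁ < σ.get r₂ then p.exec U σ.tick else q.exec U σ.tick
  | .loop x y p, σ =>
      (List.range (σ.nats y)).foldl (fun τ t => p.exec U (τ.setNat x t).tick) σ.tick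

/-- The initial state: registers `0` and `1` hold `n` and `m`, array `0` holds the matrices
(`reals 0 i j k` is the entry `(j, k)` of `A⁽ⁱ⁾`), array `1` holds the vectors (`reals 1 i j 0` is
the `j`-th coordinate of `Z⁽ⁱ⁾`), and everything else is `0`. -/
def initState {m n : ℕ} (S : Sample m n) : State where
  nats := fun x => if x = 0 then n else if x = 1 then m else 0
  reals := fun a i j k =>
    if h : i < m ∧ j < n ∧ k < n then
      if a = 0 then (S ⟨i, h.1⟩).1 ⟨j, h.2.1⟩ ⟨k, h.2.2⟩
      else if a = 1 ∧ k = 0 then (S ⟨i, h.1⟩).2 ⟨j, h.2.1⟩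
      else 0
    else 0
  steps := 0
  calls := 0

/-- The final state of the program `p` on the sample `S`. -/
def Prog.run (p : Prog) (U : (d : ℕ) → Mat d → Fin d → Vec d) {m n : ℕ} (S : Sample m n) : State :=
  p.exec U (initState S)

/-- The output of a program: the entry `(0, 0, 0)` of array `2` in the final state. -/
def State.output (σ : State) : ℝ := σ.reals 2 0 0 0

end

end MaxQP

/-!
**The output is a global maximizer.** For fixed data, the empirical average of `slin_s` is, as a
function of `s`, a quadratic polynomial in `1 / s` between two consecutive breakpoints, the
elements of `T` (`roundSum_eq_quadratic`). To the left of the smallest breakpoint it is constant.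
To the right of the largest one it equals `c / s²`, where `c` is a mean of the numbers
`∑ a_{ij} ⟨u_i, Z⟩ ⟨u_j, Z⟩`; these are nonnegative because the embeddings are optimal and the
diagonals are nonnegative (`IsSDPEmbedding.quadForm_nonneg`), so the average does not increase there. Hence
every output of the algorithm maximizes the empirical average over all `s > 0`
(`IsERMOutput.pos_and_forall_le`). Conversely, a global maximizer that is a breakpoint, or
strictly better than all breakpoints, is an output (`isERMOutput_of_forall_le`).

**Learning.** It remains to show that, with probability at least `1 - δ`, the empirical averages
are within `ε / 4` of their means for all `s` at once. By Markov's inequality for quadratic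
polynomials, `slin_s(A, Z)` has variation at most `8 H` between breakpoints, of which there are at
most `n`, so its total variation in `s` is at most `8 H (n + 1)`, and its increments are
dominated by those of a bounded monotone function (`exists_dominating_slin`). A union bound over a
net of parameters at the scale `ε` would add a multiple of `log (H / ε)` to the two logarithms in
the sample size. Instead, the deviation is symmetrized with a second sample, and
chaining is applied to the random signs: the sum of the dominating functions embeds the parameters in an interval of length
`O(m H n)`, and the square of the Euclidean distance of the vectors of sample values at two
parameters is at most `O(H)` times their distance in this interval
(`card_exists_lt_abs_signSum_le`, `measure_exists_deviation_le`). The rational parameters suffice,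
by continuity in `s`, which makes all events measurable.

**Efficiency.** The program `ermProg` calls the SDP solver once for every matrix, computes the
projections, and examines every breakpoint and, for every breakpoint, the vertex of the parabola
that describes the empirical average to the right of it. Each value is computed by summing over
all matrix entries. The best of these parameters is a global maximizer, since a quadratic
polynomial on an interval is dominated by its values at the endpoints and at an interior vertex;
breakpoints are preferred in ties. All loops run over `m` or `n` values, so that the number of
steps is at most `size * (m + n + 1) ^ depth` (`Prog.exec_steps_le`).
-/

namespace MaxQP

noncomputable section

/-! ### `s`-linear rounding between two breakpoints -/

/-- The part of `y` that is rounded linearly at the cutoff `c`: `y` if `|y| ≤ c`, and `0`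
otherwise. -/
def lo (c y : ℝ) : ℝ := if c < y then 0 else if y < -c then 0 else y

/-- The part of `y` that is rounded to a sign at the cutoff `c`: the sign of `y` if `c < |y|`, and
`0` otherwise. -/
def hi (c y : ℝ) : ℝ := if c < y then 1 else if y < -c then -1 else 0

lemma phi_eq_lo_hi {c s y : ℝ} (hc : 0 < c) (hcs : c ≤ s) (h : |y| ≤ c ∨ s ≤ |y|) :
    phi s y = lo c y / s + hi c y := by
  have hs : 0 < s := hc.trans_le hcs
  unfold phi lo hi
  rcases h with h | h
  · have := abs_le.1 h
    simp [not_lt.2 this.2, not_lt.2 this.1, show ¬ y < -s by linarith, show y ≤ s by linarith]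
  · rcases le_abs'.1 h with h | h
    · rcases lt_or_ge y (-c) with h' | h'
      · rcases eq_or_lt_of_le h with rfl | h2
        · simp [h', show ¬ c < -s by linarith, show -s ≤ s by linarith, hs.ne']
        · simp [h', h2, show ¬ c < y by linarith]
      · have h3 : y = -s := by linarith
        subst h3
        have : c = s := by linarith
        subst this
        simp [show ¬ c < -c by linarith, show -c ≤ c by linarith]
    · rcases lt_or_ge c y with h' | h'
      · rcases eq_or_lt_of_le h with rfl | h2
        · simp [h', hs.ne', show ¬ s < -s by linarith]
        · simp [h', show ¬ y < -s by linarith, show ¬ y ≤ s by linarith]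
      · have : c = s := by linarith
        subst this
        simp [show ¬ y < -c by linarith, not_lt.2 h', h']

lemma phi_eq_clamp {s : ℝ} (hs : 0 < s) (y : ℝ) : phi s y = max (-1) (min 1 (y / s)) := by
  unfold phi
  split_ifs with h1 h2
  · rw [max_eq_left]
    refine (min_le_right _ _).trans ?_
    rw [div_le_iff₀ hs]; linarith
  · rw [min_eq_right, max_eq_right]
    · rw [le_div_iff₀ hs]; linarith
    · rw [div_le_iff₀ hs]; linarith
  · rw [min_eq_left, max_eq_right (by norm_num)]
    rw [le_div_iff₀ hs]; linarith

lemma continuousOn_phi (y : ℝ) : ContinuousOn (fun s => phi s y) (Set.Ioi 0) := by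
  have : ContinuousOn (fun s : ℝ => max (-1) (min 1 (y / s))) (Set.Ioi 0) := by
    have h : ContinuousOn (fun s : ℝ => y / s) (Set.Ioi 0) :=
      continuousOn_const.div continuousOn_id fun s hs => (Set.mem_Ioi.1 hs).ne'
    exact (continuous_const.max (continuous_const.min continuous_id)).comp_continuousOn h
  exact this.congr fun s hs => phi_eq_clamp hs y

/-- The weighted sum `∑ a_e φ_s(y_e) φ_s(z_e)`; both `slin` and the empirical average have this
form. -/
def roundSum {ι : Type*} [Fintype ι] (a y z : ι → ℝ) (s : ℝ) : ℝ :=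
  ∑ e, a e * (phi s (y e) * phi s (z e))

section RoundSum

variable {ι : Type*} [Fintype ι] (a y z : ι → ℝ)

lemma continuousOn_roundSum : ContinuousOn (roundSum a y z) (Set.Ioi 0) :=
  continuousOn_finsetSum _ fun e _ =>
    continuousOn_const.mul ((continuousOn_phi (y e)).mul (continuousOn_phi (z e)))

/-- The coefficient of `1 / s²` in `roundSum` to the right of the cutoff `c`. -/
def quadCoeff (c : ℝ) : ℝ := ∑ e, a e * (lo c (y e) * lo c (z e))

/-- The coefficient of `1 / s` in `roundSum` to the right of the cutoff `c`. -/
def linCoeff (c : ℝ) : ℝ := ∑ e, a e * (lo c (y e) * hi c (z e) + hi c (y e) * lo c (z e))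

/-- The constant coefficient of `roundSum` to the right of the cutoff `c`. -/
def constCoeff (c : ℝ) : ℝ := ∑ e, a e * (hi c (y e) * hi c (z e))

/-- Between two consecutive breakpoints, `roundSum` is a quadratic polynomial in `1 / s`. -/
lemma roundSum_eq_quadratic {c s : ℝ} (hc : 0 < c) (hcs : c ≤ s)
    (hy : ∀ e, |y e| ≤ c ∨ s ≤ |y e|) (hz : ∀ e, |z e| ≤ c ∨ s ≤ |z e|) :
    roundSum a y z s =
      quadCoeff a y z c * (1 / s) ^ 2 + linCoeff a y z c * (1 / s) + constCoeff a y z c := by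
  simp only [roundSum, quadCoeff, linCoeff, constCoeff, Finset.sum_mul, ← Finset.sum_add_distrib]
  refine Finset.sum_congr rfl fun e _ => ?_
  rw [phi_eq_lo_hi hc hcs (hy e), phi_eq_lo_hi hc hcs (hz e)]
  ring

lemma roundSum_self {c : ℝ} (hc : 0 < c) :
    roundSum a y z c =
      quadCoeff a y z c * (1 / c) ^ 2 + linCoeff a y z c * (1 / c) + constCoeff a y z c :=
  roundSum_eq_quadratic a y z hc le_rfl (fun _ => le_total _ _) (fun _ => le_total _ _)

/-- Below all breakpoints, `φ_s` is the sign function on the data. -/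
lemma roundSum_eq_of_le {s t : ℝ} (hs : 0 < s) (hst : s ≤ t)
    (hy : ∀ e, y e = 0 ∨ t ≤ |y e|) (hz : ∀ e, z e = 0 ∨ t ≤ |z e|) :
    roundSum a y z s = roundSum a y z t := by
  have key : ∀ x : ℝ, x = 0 ∨ t ≤ |x| → phi s x = phi t x := by
    rintro x (rfl | hx)
    · rw [phi_eq_clamp hs, phi_eq_clamp (hs.trans_le hst)]; simp
    · rw [phi_eq_clamp hs, phi_eq_clamp (hs.trans_le hst)]
      have ht := hs.trans_le hst
      rcases le_abs'.1 hx with h | h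
      · have h1 : x / t ≤ -1 := by rw [div_le_iff₀ ht]; linarith
        have h2 : x / s ≤ -1 := by rw [div_le_iff₀ hs]; linarith
        rw [max_eq_left ((min_le_right _ _).trans h1), max_eq_left ((min_le_right _ _).trans h2)]
      · have h1 : 1 ≤ x / t := by rw [le_div_iff₀ ht]; linarith
        have h2 : 1 ≤ x / s := by rw [le_div_iff₀ hs]; linarith
        rw [min_eq_left h1, min_eq_left h2]
  simp only [roundSum, key _ (hy _), key _ (hz _)]

/-- Above all breakpoints, every term is linear in both factors. -/
lemma roundSum_eq_of_forall_le {s : ℝ}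
    (hy : ∀ e, |y e| ≤ s) (hz : ∀ e, |z e| ≤ s) :
    roundSum a y z s = (∑ e, a e * (y e * z e)) * (1 / s) ^ 2 := by
  have key : ∀ x : ℝ, |x| ≤ s → phi s x = x / s := by
    intro x hx
    have := abs_le.1 hx
    simp [phi, not_lt.2 this.1, this.2]
  simp only [roundSum, key _ (hy _), key _ (hz _), Finset.sum_mul]
  refine Finset.sum_congr rfl fun e _ => ?_
  ring

end RoundSum

/-- A quadratic polynomial on an interval is dominated by its values at the endpoints, and at the
vertex if that lies inside. -/
lemma quadratic_le_of_endpoints_of_vertex {α β γ w₁ w₂ w M : ℝ} (h₁ : w₁ ≤ w) (h₂ : w ≤ w₂)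
    (hM₁ : α * w₁ ^ 2 + β * w₁ + γ ≤ M) (hM₂ : α * w₂ ^ 2 + β * w₂ + γ ≤ M)
    (hv : ∀ v, w₁ < v → v < w₂ → α ≠ 0 → 2 * α * v + β = 0 → α * v ^ 2 + β * v + γ ≤ M) :
    α * w ^ 2 + β * w + γ ≤ M := by
  rcases le_or_gt 0 α with hα | hα
  · by_contra! hcon
    have e1 : 0 < (w - w₁) * (α * (w + w₁) + β) := by nlinarith
    have e2 : 0 < (w - w₂) * (α * (w + w₂) + β) := by nlinarith
    have f1 : 0 < α * (w + w₁) + β := by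
      by_contra! h
      nlinarith [mul_nonneg (sub_nonneg.2 h₁) (neg_nonneg.2 h)]
    have f2 : α * (w + w₂) + β < 0 := by
      by_contra! h
      nlinarith [mul_nonneg (sub_nonneg.2 h₂) h]
    nlinarith
  · set v := -β / (2 * α) with hvdef
    have hv0 : 2 * α * v + β = 0 := by rw [hvdef]; field_simp [hα.ne]; ring
    have hβ : β = -(2 * α * v) := by linarith
    rcases le_or_gt v w₁ with h | h
    · nlinarith [mul_nonneg (neg_nonneg.2 hα.le)
        (mul_nonneg (sub_nonneg.2 h₁) (by linarith : 0 ≤ w + w₁ - 2 * v))]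
    rcases le_or_gt w₂ v with h' | h'
    · nlinarith [mul_nonneg (neg_nonneg.2 hα.le)
        (mul_nonneg (sub_nonneg.2 h₂) (by linarith : 0 ≤ 2 * v - w - w₂))]
    · have := hv v h h' hα.ne hv0
      nlinarith [mul_nonneg (neg_nonneg.2 hα.le) (sq_nonneg (w - v))]

/-! ### Optimal embeddings make the quadratic form of the data nonnegative -/

/-- At an optimal embedding, `∑ a_{ij} ⟨u_i, Z⟩ ⟨u_j, Z⟩ ≥ 0`: for each `i`, reflecting the single
vector `u_i` in the hyperplane orthogonal to `Z` cannot increase the objective, and the sum of these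
inequalities over `i` bounds the off-diagonal part of the form from below by `0`. -/
lemma IsSDPEmbedding.quadForm_nonneg {n : ℕ} {A : Mat n} {u : Fin n → Vec n} (hA : IsInstance A)
    (hu : IsSDPEmbedding A u) (Z : Vec n) :
    0 ≤ ∑ i, ∑ j, A i j * (inner ℝ (u i) Z * inner ℝ (u j) Z) := by
  rcases eq_or_ne Z 0 with rfl | hZ
  · simp
  set x : Fin n → ℝ := fun i => inner ℝ (u i) Z with hx
  have hZ2 : 0 < ‖Z‖ ^ 2 := by positivity
  set r : Vec n → Vec n := fun w => w - (2 * inner ℝ w Z / ‖Z‖ ^ 2) • Z with hr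
  have hrr : ∀ w, ‖r w‖ = ‖w‖ := by
    intro w
    have : ‖r w‖ ^ 2 = ‖w‖ ^ 2 := by
      rw [hr]
      simp only
      rw [norm_sub_sq_real, inner_smul_right, norm_smul, mul_pow, Real.norm_eq_abs, sq_abs]
      field_simp
      ring
    exact (sq_eq_sq₀ (norm_nonneg _) (norm_nonneg _)).1 this
  have hin : ∀ w w', inner ℝ (r w) w' =
      inner ℝ w w' - 2 * (inner ℝ w Z * inner ℝ w' Z) / ‖Z‖ ^ 2 := by
    intro w w'
    rw [hr]; simp only
    rw [inner_sub_left, inner_smul_left, real_inner_comm w' Z]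
    simp
    ring
  have hin2 : ∀ w w', inner ℝ w' (r w) =
      inner ℝ w' w - 2 * (inner ℝ w' Z * inner ℝ w Z) / ‖Z‖ ^ 2 := by
    intro w w'
    rw [real_inner_comm, hin, real_inner_comm w' w]
    ring
  have step : ∀ l : Fin n, ∑ i, ∑ j, A i j * (x i * x j) *
      ((if i = l then 1 else 0) + (if j = l then 1 else 0)
        - 2 * ((if i = l then 1 else 0) * (if j = l then 1 else 0))) ≥ 0 := by
    intro l
    have h := hu.2 (fun i => if i = l then r (u i) else u i) (by
      intro i
      split_ifs
      · rw [hrr, hu.1]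
      · exact hu.1 i)
    rw [← sub_nonneg, ← Finset.sum_sub_distrib] at h
    have e : ∀ i, (∑ j, A i j * inner ℝ (u i) (u j) - ∑ j, A i j * inner ℝ
        (if i = l then r (u i) else u i) (if j = l then r (u j) else u j)) =
        ∑ j, (2 / ‖Z‖ ^ 2) * (A i j * (x i * x j) *
      ((if i = l then 1 else 0) + (if j = l then 1 else 0)
        - 2 * ((if i = l then 1 else 0) * (if j = l then 1 else 0)))) := by
      intro i
      rw [← Finset.sum_sub_distrib]
      refine Finset.sum_congr rfl fun j _ => ?_
      by_cases hi : i = l <;> by_cases hj : j = l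
      · obtain rfl : i = j := hi.trans hj.symm
        have : inner ℝ (r (u i)) (r (u i)) = (inner ℝ (u i) (u i) : ℝ) := by
          rw [real_inner_self_eq_norm_sq, real_inner_self_eq_norm_sq, hrr]
        simp only [if_pos hi]
        rw [this]
        norm_num
      · simp only [if_pos hi, if_neg hj, hin, hx]; ring
      · simp only [if_neg hi, if_pos hj, hin2, hx]; ring
      · simp [if_neg hi, if_neg hj]
    simp only [e, ← Finset.mul_sum] at h
    exact nonneg_of_mul_nonneg_right h (by positivity)
  have tot : 0 ≤ ∑ l, ∑ i, ∑ j, A i j * (x i * x j) *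
      ((if i = l then 1 else 0) + (if j = l then 1 else 0)
        - 2 * ((if i = l then 1 else 0) * (if j = l then (1 : ℝ) else 0))) :=
    Finset.sum_nonneg fun l _ => step l
  rw [Finset.sum_comm] at tot
  have e2 : ∀ i, ∑ l, ∑ j, A i j * (x i * x j) *
      ((if i = l then 1 else 0) + (if j = l then 1 else 0)
        - 2 * ((if i = l then 1 else 0) * (if j = l then (1 : ℝ) else 0))) =
      2 * ∑ j, A i j * (x i * x j) - 2 * (A i i * (x i * x i)) := by
    intro i
    rw [Finset.sum_comm]
    have : ∀ j, ∑ l, A i j * (x i * x j) *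
      ((if i = l then 1 else 0) + (if j = l then 1 else 0)
        - 2 * ((if i = l then 1 else 0) * (if j = l then (1 : ℝ) else 0))) =
        2 * (A i j * (x i * x j)) - 2 * (if i = j then A i j * (x i * x j) else 0) := by
      intro j
      rw [← Finset.mul_sum, Finset.sum_sub_distrib, Finset.sum_add_distrib, ← Finset.mul_sum]
      by_cases hij : i = j
      · subst hij
        rw [if_pos rfl]; simp; norm_num
      · simp only [if_neg hij]; simp; rw [if_neg hij]; ring
    simp only [this, Finset.sum_sub_distrib, ← Finset.mul_sum, Finset.sum_ite_eq,
      Finset.mem_univ, if_true]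
  simp only [e2, Finset.sum_sub_distrib, ← Finset.mul_sum] at tot
  have hd : 0 ≤ ∑ i, A i i * (x i * x i) :=
    Finset.sum_nonneg fun i _ => mul_nonneg (hA i) (mul_self_nonneg _)
  linarith

/-! ### Outputs of the algorithm are the global maximizers of the empirical average -/

lemma exists_consecutive {T : Set ℝ} (hT : T.Finite) {a b s : ℝ} (ha : a ∈ T) (hb : b ∈ T)
    (hab : a < b) (has : a ≤ s) (hsb : s ≤ b) :
    ∃ c d, Consecutive T c d ∧ s ∈ Set.Icc c d := by
  rcases hsb.lt_or_eq with hlt | rfl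
  · obtain ⟨c, hc, hc'⟩ := Set.exists_max_image {t ∈ T | t ≤ s} id (hT.subset fun t ht => ht.1)
      ⟨a, ha, has⟩
    obtain ⟨d, hd, hd'⟩ := Set.exists_min_image {t ∈ T | s < t} id (hT.subset fun t ht => ht.1)
      ⟨b, hb, hlt⟩
    refine ⟨c, d, ⟨hc.1, hd.1, hc.2.trans_lt hd.2, fun t ht hcd => ?_⟩, hc.2, hd.2.le⟩
    rcases le_or_gt t s with h | h
    · exact (hc' t ⟨ht, h⟩).not_gt hcd.1
    · exact (hd' t ⟨ht, h⟩).not_gt hcd.2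
  · obtain ⟨c, hc, hc'⟩ := Set.exists_max_image {t ∈ T | t < s} id (hT.subset fun t ht => ht.1)
      ⟨a, ha, hab⟩
    exact ⟨c, s, ⟨hc.1, hb, hc.2, fun t ht hcd => (hc' t ⟨ht, hcd.2⟩).not_gt hcd.1⟩,
      hc.2.le, le_rfl⟩

/-- The behaviour of an empirical average `h` outside the range of its breakpoints `T`: it is
constant to the left of the smallest one, and does not increase to the right of the largest one. -/
structure HasBreakpoints (T : Set ℝ) (h : ℝ → ℝ) : Prop where
  finite : T.Finite
  pos : ∀ t ∈ T, 0 < t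
  eq_of_le : ∀ s t, t ∈ T → 0 < s → s ≤ t → (∀ r ∈ T, t ≤ r) → h s = h t
  le_of_ge : ∀ s t, t ∈ T → t ≤ s → (∀ r ∈ T, r ≤ t) → h s ≤ h t
  eq_of_empty : T = ∅ → ∀ s t, 0 < s → 0 < t → h s = h t

namespace HasBreakpoints

variable {T : Set ℝ} {h : ℝ → ℝ} (H : HasBreakpoints T h)
include H

lemma exists_least (hne : T.Nonempty) : ∃ t ∈ T, ∀ r ∈ T, t ≤ r :=
  Set.exists_min_image T id H.finite hne

lemma exists_greatest (hne : T.Nonempty) : ∃ t ∈ T, ∀ r ∈ T, r ≤ t :=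
  Set.exists_max_image T id H.finite hne

/-- It suffices to compare with the values between the smallest and the largest breakpoint. -/
lemma forall_le {M : ℝ} (hne : T.Nonempty)
    (hM : ∀ a ∈ T, ∀ b ∈ T, ∀ s ∈ Set.Icc a b, h s ≤ M) {s : ℝ} (hs : 0 < s) : h s ≤ M := by
  obtain ⟨a, ha, ha'⟩ := H.exists_least hne
  obtain ⟨b, hb, hb'⟩ := H.exists_greatest hne
  rcases le_or_gt s a with h1 | h1
  · rw [H.eq_of_le s a ha hs h1 ha']
    exact hM a ha a ha a ⟨le_rfl, le_rfl⟩
  rcases le_or_gt b s with h2 | h2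
  · exact (H.le_of_ge s b hb h2 hb').trans (hM b hb b hb b ⟨le_rfl, le_rfl⟩)
  · exact hM a ha b hb s ⟨h1.le, h2.le⟩

/-- A maximizer strictly better than every breakpoint lies strictly between two of them. -/
lemma exists_lt_of_forall_lt {b : ℝ} (hb : 0 < b) (hne : T.Nonempty) (hlt : ∀ t ∈ T, h t < h b) :
    ∃ a ∈ T, ∃ c ∈ T, a < b ∧ b < c := by
  obtain ⟨a, ha, ha'⟩ := H.exists_least hne
  obtain ⟨c, hc, hc'⟩ := H.exists_greatest hne
  refine ⟨a, ha, c, hc, ?_, ?_⟩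
  · by_contra! hcon
    exact (hlt a ha).ne' (H.eq_of_le b a ha hb hcon ha')
  · by_contra! hcon
    exact (hlt c hc).not_ge (H.le_of_ge b c hc hcon hc')

end HasBreakpoints

section Sample

variable {m n : ℕ} (U : Mat n → Fin n → Vec n) (S : Sample m n)

/-- The projections `⟨Z⁽ⁱ⁾, u_j⁽ⁱ⁾⟩` of a sample. -/
def proj (i : Fin m) (j : Fin n) : ℝ := inner ℝ (U (S i).1 j) (S i).2

/-- The sum `∑ slin_s(A⁽ⁱ⁾, Z⁽ⁱ⁾)` over the sample. -/
def total : ℝ → ℝ :=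
  roundSum (fun e : Fin m × Fin n × Fin n => (S e.1).1 e.2.1 e.2.2)
    (fun e => proj U S e.1 e.2.1) (fun e => proj U S e.1 e.2.2)

lemma slin_eq_roundSum (s : ℝ) (A : Mat n) (Z : Vec n) :
    slin U s A Z = roundSum (fun e : Fin n × Fin n => A e.1 e.2)
      (fun e => inner ℝ (U A e.1) Z) (fun e => inner ℝ (U A e.2) Z) s := by
  simp only [slin, roundSum, Fintype.sum_prod_type]

lemma total_eq_sum (s : ℝ) : total U S s = ∑ i, slin U s (S i).1 (S i).2 := by
  simp only [total, slin, roundSum, proj, Fintype.sum_prod_type]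

lemma empirical_eq_total (s : ℝ) : empirical U S s = (1 / (m : ℝ)) * total U S s := by
  rw [total_eq_sum, empirical]

lemma thresholds_finite : (thresholds U S).Finite := by
  refine (Set.finite_range fun e : Fin m × Fin n => |proj U S e.1 e.2|).subset ?_
  rintro s ⟨_, i, j, h⟩
  exact ⟨(i, j), h⟩

lemma abs_proj_mem_thresholds {i : Fin m} {j : Fin n} (h : 0 < |proj U S i j|) :
    |proj U S i j| ∈ thresholds U S := ⟨h, i, j, rfl⟩

lemma proj_eq_zero_or_mem (i : Fin m) (j : Fin n) :
    proj U S i j = 0 ∨ |proj U S i j| ∈ thresholds U S := by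
  by_cases h : proj U S i j = 0
  · exact Or.inl h
  · exact Or.inr (abs_proj_mem_thresholds U S (abs_pos.2 h))

/-- The empirical sum is constant to the left of all breakpoints, and `c / s²` with `c ≥ 0` to their
right; nonnegativity of `c` is where the optimality of the embeddings and the signs of the diagonal
entries are used. -/
lemma hasBreakpoints_total (hU : ∀ i, IsSDPEmbedding (S i).1 (U (S i).1))
    (hS : ∀ i, IsInstance (S i).1) : HasBreakpoints (thresholds U S) (total U S) where
  finite := thresholds_finite U S
  pos := fun t ht => ht.1
  eq_of_le := by
    intro s t _ hs hst hle
    have key : ∀ i j, proj U S i j = 0 ∨ t ≤ |proj U S i j| := fun i j =>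
      (proj_eq_zero_or_mem U S i j).imp_right fun h => hle _ h
    exact roundSum_eq_of_le _ _ _ hs hst (fun e => key _ _) (fun e => key _ _)
  le_of_ge := by
    intro s t ht hts hle
    have h0 : 0 < t := ht.1
    have key : ∀ i j, |proj U S i j| ≤ t := fun i j => by
      rcases proj_eq_zero_or_mem U S i j with h | h
      · rw [h, abs_zero]; exact h0.le
      · exact hle _ h
    have hnn : 0 ≤ ∑ e : Fin m × Fin n × Fin n,
        (S e.1).1 e.2.1 e.2.2 * (proj U S e.1 e.2.1 * proj U S e.1 e.2.2) := by
      rw [Fintype.sum_prod_type]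
      refine Finset.sum_nonneg fun i _ => ?_
      have h := (hU i).quadForm_nonneg (hS i) (S i).2
      simpa only [proj, Fintype.sum_prod_type] using h
    rw [total, roundSum_eq_of_forall_le _ _ _ (fun e => (key _ _).trans hts)
        (fun e => (key _ _).trans hts),
      roundSum_eq_of_forall_le _ _ _ (fun e => key _ _) (fun e => key _ _)]
    have : 1 / s ≤ 1 / t := one_div_le_one_div_of_le h0 hts
    have : 0 ≤ 1 / s := by have := h0.trans_le hts; positivity
    gcongr
  eq_of_empty := by
    intro hT s t hs ht
    have key : ∀ i j, proj U S i j = 0 := fun i j =>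
      (proj_eq_zero_or_mem U S i j).resolve_right (by simp [hT])
    rcases le_total s t with h | h
    · exact roundSum_eq_of_le _ _ _ hs h (fun e => Or.inl (key _ _)) (fun e => Or.inl (key _ _))
    · exact (roundSum_eq_of_le _ _ _ ht h (fun e => Or.inl (key _ _))
        (fun e => Or.inl (key _ _))).symm

lemma hasBreakpoints_empirical (hU : ∀ i, IsSDPEmbedding (S i).1 (U (S i).1))
    (hS : ∀ i, IsInstance (S i).1) : HasBreakpoints (thresholds U S) (empirical U S) := by
  have H := hasBreakpoints_total U S hU hS
  have hm : 0 ≤ 1 / (m : ℝ) := by positivity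
  refine ⟨H.finite, H.pos, fun s t h1 h2 h3 h4 => ?_, fun s t h1 h2 h3 => ?_, fun h s t h1 h2 => ?_⟩
  · rw [empirical_eq_total, empirical_eq_total, H.eq_of_le s t h1 h2 h3 h4]
  · rw [empirical_eq_total, empirical_eq_total]
    exact mul_le_mul_of_nonneg_left (H.le_of_ge s t h1 h2 h3) hm
  · rw [empirical_eq_total, empirical_eq_total, H.eq_of_empty h s t h1 h2]

lemma continuousOn_empirical : ContinuousOn (empirical U S) (Set.Ioi 0) := by
  have : empirical U S = fun s => (1 / (m : ℝ)) * total U S s := funext (empirical_eq_total U S)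
  rw [this]
  exact continuousOn_const.mul (continuousOn_roundSum _ _ _)

variable {U S}

lemma IsERMOutput.pos_and_forall_le (hU : ∀ i, IsSDPEmbedding (S i).1 (U (S i).1))
    (hS : ∀ i, IsInstance (S i).1) {b : ℝ} (hb : IsERMOutput U S b) :
    0 < b ∧ ∀ s, 0 < s → empirical U S s ≤ empirical U S b := by
  have H := hasBreakpoints_empirical U S hU hS
  rcases hb with ⟨hT, hb⟩ | hT | ⟨cand, hc, ⟨a₀, b₀, hab, rfl⟩, hmax⟩
  · exact ⟨hb, fun s hs => (H.eq_of_empty hT s b hs hb).le⟩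
  · have hbT : b ∈ thresholds U S := by rw [hT]; rfl
    refine ⟨H.pos b hbT, fun s hs => H.forall_le ⟨b, hbT⟩ ?_ hs⟩
    intro x hx y hy s hs
    rw [hT] at hx hy
    obtain rfl : x = b := hx
    obtain rfl : y = x := hy
    rw [le_antisymm hs.2 hs.1]
  · have hpos : 0 < cand a₀ b₀ := (H.pos _ hab.1).trans_le (hc _ _ hab).1.1
    refine ⟨hpos, fun s hs => H.forall_le ⟨a₀, hab.1⟩ ?_ hs⟩
    intro x hx y hy s hs
    rcases (hs.1.trans hs.2).lt_or_eq with hxy | rfl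
    · obtain ⟨c, d, hcd, hs'⟩ := exists_consecutive H.finite hx hy hxy hs.1 hs.2
      exact ((hc c d hcd).2 s hs').trans (hmax c d hcd)
    · -- `s` is a breakpoint, and belongs to some interval of the nondegenerate pair `a₀ < b₀`
      obtain rfl : s = x := le_antisymm hs.2 hs.1
      obtain ⟨c, d, hcd, hs'⟩ : ∃ c d, Consecutive (thresholds U S) c d ∧ s ∈ Set.Icc c d := by
        rcases lt_or_ge s b₀ with h | h
        · exact exists_consecutive H.finite hx hab.2.1 h le_rfl h.le
        · exact exists_consecutive H.finite hab.1 hx (hab.2.2.1.trans_le h)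
            (hab.2.2.1.le.trans h) le_rfl
      exact ((hc c d hcd).2 s hs').trans (hmax c d hcd)

/-- A global maximizer is an output of the algorithm if it is a breakpoint, or strictly better than
all breakpoints. -/
lemma isERMOutput_of_forall_le (hU : ∀ i, IsSDPEmbedding (S i).1 (U (S i).1))
    (hS : ∀ i, IsInstance (S i).1) {b : ℝ} (hb : 0 < b)
    (hT : b ∈ thresholds U S ∨ ∀ t ∈ thresholds U S, empirical U S t < empirical U S b)
    (hmax : ∀ s, 0 < s → empirical U S s ≤ empirical U S b) : IsERMOutput U S b := by
  have H := hasBreakpoints_empirical U S hU hS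
  rcases (thresholds U S).eq_empty_or_nonempty with hE | hne
  · exact Or.inl ⟨hE, hb⟩
  by_cases hsing : thresholds U S = {b}
  · exact Or.inr (Or.inl hsing)
  obtain ⟨a, ha, c, hc, hac, hab, hbc⟩ : ∃ a ∈ thresholds U S, ∃ c ∈ thresholds U S,
      a < c ∧ a ≤ b ∧ b ≤ c := by
    rcases hT with hbT | hlt
    · obtain ⟨r, hr, hrb⟩ : ∃ r ∈ thresholds U S, r ≠ b := by
        by_contra! hcon
        exact hsing (Set.eq_singleton_iff_unique_mem.2 ⟨hbT, hcon⟩)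
      rcases hrb.lt_or_gt with h | h
      · exact ⟨r, hr, b, hbT, h, h.le, le_rfl⟩
      · exact ⟨b, hbT, r, hr, h, le_rfl, h.le⟩
    · obtain ⟨a, ha, c, hc, h1, h2⟩ := H.exists_lt_of_forall_lt hb hne hlt
      exact ⟨a, ha, c, hc, h1.trans h2, h1.le, h2.le⟩
  obtain ⟨a₀, b₀, h₀, hb₀⟩ := exists_consecutive H.finite ha hc hac hab hbc
  have hex : ∀ x y, ∃ w, Consecutive (thresholds U S) x y →
      w ∈ Set.Icc x y ∧ ∀ s ∈ Set.Icc x y, empirical U S s ≤ empirical U S w := by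
    intro x y
    by_cases hxy : Consecutive (thresholds U S) x y
    · obtain ⟨w, hw, hw'⟩ := (isCompact_Icc (a := x) (b := y)).exists_isMaxOn
        ⟨x, le_rfl, hxy.2.2.1.le⟩ ((continuousOn_empirical U S).mono fun s hs =>
          (H.pos x hxy.1).trans_le hs.1)
      exact ⟨w, fun _ => ⟨hw, fun s hs => hw' hs⟩⟩
    · exact ⟨0, fun h => (hxy h).elim⟩
  choose w hw using hex
  classical
  refine Or.inr (Or.inr ⟨fun x y => if b ∈ Set.Icc x y then b else w x y, ?_, ⟨a₀, b₀, h₀, ?_⟩, ?_⟩)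
  · intro x y hxy
    simp only
    split_ifs with hbxy
    · exact ⟨hbxy, fun s hs => hmax s ((H.pos x hxy.1).trans_le hs.1)⟩
    · exact hw x y hxy
  · simp only [if_pos hb₀]
  · intro x y hxy
    simp only
    split_ifs with hbxy
    · exact le_rfl
    · exact hmax _ ((H.pos x hxy.1).trans_le (hw x y hxy).1.1)

end Sample

/-! ### Bounded variation in the parameter -/

/-- **Markov's inequality** for quadratic polynomials on an interval. -/
lemma abs_quadratic_sub_le {α β γ w₁ w₂ u v H : ℝ} (h : w₁ < w₂)
    (hH : ∀ w ∈ Set.Icc w₁ w₂, |α * w ^ 2 + β * w + γ| ≤ H)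
    (hu : u ∈ Set.Icc w₁ w₂) (hv : v ∈ Set.Icc w₁ w₂) :
    |(α * u ^ 2 + β * u + γ) - (α * v ^ 2 + β * v + γ)| ≤ 8 * H / (w₂ - w₁) * |u - v| := by
  have hL : 0 < w₂ - w₁ := by linarith
  have h1 := abs_le.1 (hH w₁ ⟨le_rfl, h.le⟩)
  have h2 := abs_le.1 (hH w₂ ⟨h.le, le_rfl⟩)
  have h3 := abs_le.1 (hH ((w₁ + w₂) / 2) ⟨by linarith, by linarith⟩)
  -- the derivative at the endpoints is a combination of the values at three points
  have d1 : |2 * α * w₁ + β| ≤ 8 * H / (w₂ - w₁) := by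
    rw [le_div_iff₀ hL, ← abs_of_pos hL, ← abs_mul, abs_le]
    constructor <;> nlinarith
  have d2 : |2 * α * w₂ + β| ≤ 8 * H / (w₂ - w₁) := by
    rw [le_div_iff₀ hL, ← abs_of_pos hL, ← abs_mul, abs_le]
    constructor <;> nlinarith
  have d : |α * (u + v) + β| ≤ 8 * H / (w₂ - w₁) := by
    have e1 := abs_le.1 d1
    have e2 := abs_le.1 d2
    rw [abs_le]
    obtain ⟨hu1, hu2⟩ := hu
    obtain ⟨hv1, hv2⟩ := hv
    rcases le_total 0 α with ha | ha
    · constructor <;> nlinarith [mul_nonneg ha (sub_nonneg.2 hu1), mul_nonneg ha (sub_nonneg.2 hu2),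
        mul_nonneg ha (sub_nonneg.2 hv1), mul_nonneg ha (sub_nonneg.2 hv2)]
    · constructor <;> nlinarith [mul_nonneg (neg_nonneg.2 ha) (sub_nonneg.2 hu1),
        mul_nonneg (neg_nonneg.2 ha) (sub_nonneg.2 hu2),
        mul_nonneg (neg_nonneg.2 ha) (sub_nonneg.2 hv1),
        mul_nonneg (neg_nonneg.2 ha) (sub_nonneg.2 hv2)]
  calc |(α * u ^ 2 + β * u + γ) - (α * v ^ 2 + β * v + γ)| = |α * (u + v) + β| * |u - v| := by
        rw [← abs_mul]; congr 1; ring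
    _ ≤ _ := mul_le_mul_of_nonneg_right d (abs_nonneg _)

lemma eVariationOn_le_of_quadratic {f : ℝ → ℝ} {α β γ a b H : ℝ} (ha : 0 < a) (hab : a ≤ b)
    (hf : ∀ s ∈ Set.Icc a b, f s = α * (1 / s) ^ 2 + β * (1 / s) + γ)
    (hH : ∀ s ∈ Set.Icc a b, |f s| ≤ H) :
    eVariationOn f (Set.Icc a b) ≤ ENNReal.ofReal (8 * H) := by
  rcases hab.eq_or_lt with rfl | hab
  · rw [eVariationOn.subsingleton _ (by simp)]
    exact zero_le
  have hb : 0 < b := ha.trans hab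
  have hlt : 1 / b < 1 / a := one_div_lt_one_div_of_lt ha hab
  have hH0 : 0 ≤ H := (abs_nonneg _).trans (hH a ⟨le_rfl, hab.le⟩)
  have hL : 0 < 1 / a - 1 / b := by linarith
  have hq : ∀ w ∈ Set.Icc (1 / b) (1 / a), |α * w ^ 2 + β * w + γ| ≤ H := by
    intro w hw
    have hw0 : 0 < w := lt_of_lt_of_le (by positivity) hw.1
    have hmem : 1 / w ∈ Set.Icc a b := by
      constructor
      · rw [le_one_div ha hw0]; exact hw.2
      · rw [one_div_le hw0 hb]; exact hw.1
    have := hH _ hmem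
    rwa [hf _ hmem, one_div_one_div] at this
  have hmono : MonotoneOn (fun s : ℝ => -(1 / s)) (Set.Icc a b) := by
    intro s hs t _ hst
    exact neg_le_neg (one_div_le_one_div_of_le (ha.trans_le hs.1) hst)
  have hlip : LipschitzOnWith (Real.toNNReal (8 * H / (1 / a - 1 / b)))
      (fun w : ℝ => α * (-w) ^ 2 + β * (-w) + γ) (Set.Icc (-(1 / a)) (-(1 / b))) := by
    refine LipschitzOnWith.of_dist_le_mul fun u hu v hv => ?_
    rw [Real.dist_eq, Real.dist_eq, Real.coe_toNNReal _ (by positivity)]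
    have := abs_quadratic_sub_le hlt hq (u := -u) (v := -v)
      ⟨by linarith [hu.2], by linarith [hu.1]⟩ ⟨by linarith [hv.2], by linarith [hv.1]⟩
    rwa [show -u - -v = -(u - v) by ring, abs_neg] at this
  have hmaps : Set.MapsTo (fun s : ℝ => -(1 / s)) (Set.Icc a b) (Set.Icc (-(1 / a)) (-(1 / b))) :=
    fun s hs => ⟨hmono ⟨le_rfl, hab.le⟩ hs hs.1, hmono hs ⟨hab.le, le_rfl⟩ hs.2⟩
  have hvar := (hmono.eVariationOn_eq (a := a) (b := b) ⟨le_rfl, hab.le⟩ ⟨hab.le, le_rfl⟩).le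
  rw [Set.inter_self] at hvar
  calc eVariationOn f (Set.Icc a b)
      = eVariationOn ((fun w : ℝ => α * (-w) ^ 2 + β * (-w) + γ) ∘ fun s : ℝ => -(1 / s))
          (Set.Icc a b) := eVariationOn.congr fun s hs => by
        simp only [Function.comp, neg_neg]; exact hf s hs
    _ ≤ _ := hlip.comp_eVariationOn_le hmaps
    _ ≤ ENNReal.ofReal (8 * H / (1 / a - 1 / b)) * ENNReal.ofReal (-(1 / b) - -(1 / a)) := by
        gcongr
        exact le_rfl
    _ = ENNReal.ofReal (8 * H) := by
        rw [← ENNReal.ofReal_mul (by positivity)]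
        congr 1
        rw [show -(1 / b) - -(1 / a) = 1 / a - 1 / b by ring, div_mul_cancel₀ _ hL.ne']

/-- Variation adds up over the intervals between the points of `B`. -/
lemma eVariationOn_Icc_le_of_pieces {f : ℝ → ℝ} (B : Finset ℝ) {M : ENNReal} {I : Set ℝ}
    (hI : I.OrdConnected)
    (hpiece : ∀ a ∈ I, ∀ b ∈ I, a ≤ b → (∀ t ∈ B, ¬ (a < t ∧ t < b)) →
      eVariationOn f (Set.Icc a b) ≤ M) :
    ∀ k : ℕ, ∀ a ∈ I, ∀ b ∈ I, a ≤ b → (B.filter fun t => a < t ∧ t < b).card ≤ k →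
      eVariationOn f (Set.Icc a b) ≤ (k + 1) * M := by
  intro k
  induction k with
  | zero =>
    intro a ha b hb hab hcard
    have h0 := Finset.card_eq_zero.1 (Nat.le_zero.1 hcard)
    rw [Finset.filter_eq_empty_iff] at h0
    simpa using hpiece a ha b hb hab fun t ht => h0 ht
  | succ k ih =>
    intro a ha b hb hab hcard
    by_cases hne : (B.filter fun t => a < t ∧ t < b).Nonempty
    · -- split at the smallest breakpoint
      set t := (B.filter fun t => a < t ∧ t < b).min' hne with ht
      have htm := Finset.min'_mem _ hne
      rw [← ht] at htm
      obtain ⟨htB, hat, htb⟩ := Finset.mem_filter.1 htm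
      have htI : t ∈ I := hI.out ha hb (Set.mem_Icc.2 ⟨hat.le, htb.le⟩)
      have h1 : eVariationOn f (Set.Icc a t) ≤ M := by
        refine hpiece a ha t htI hat.le fun r hr hart => ?_
        have hrm : r ∈ B.filter fun t => a < t ∧ t < b :=
          Finset.mem_filter.2 ⟨hr, hart.1, hart.2.trans htb⟩
        exact (Finset.min'_le _ r hrm).not_gt hart.2
      have h2 : eVariationOn f (Set.Icc t b) ≤ (k + 1) * M := by
        refine ih t htI b hb htb.le
          (Nat.lt_succ_iff.1 (lt_of_lt_of_le (Finset.card_lt_card ?_) hcard))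
        rw [Finset.ssubset_iff_of_subset]
        · refine ⟨t, htm, ?_⟩
          simp
        · intro r hr
          rw [Finset.mem_filter] at hr ⊢
          exact ⟨hr.1, hat.trans hr.2.1, hr.2.2⟩
      have h3 := eVariationOn.Icc_add_Icc f (s := Set.univ) hat.le htb.le (Set.mem_univ _)
      simp only [Set.univ_inter] at h3
      rw [← h3, Nat.cast_succ]
      calc _ ≤ M + (k + 1) * M := add_le_add h1 h2
        _ = _ := by ring
    · rw [Finset.not_nonempty_iff_eq_empty] at hne
      refine (ih a ha b hb hab (by rw [hne]; simp)).trans ?_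
      gcongr
      simp

/-- A bounded `roundSum` has bounded variation, at most `8 H` on each interval between
breakpoints. -/
lemma eVariationOn_roundSum_le {ι : Type*} [Fintype ι] (a y z : ι → ℝ) (B : Finset ℝ) {H : ℝ}
    (hy : ∀ e, |y e| ∈ B) (hz : ∀ e, |z e| ∈ B) (hH : ∀ s, 0 < s → |roundSum a y z s| ≤ H) :
    eVariationOn (roundSum a y z) (Set.Ioi 0) ≤ ENNReal.ofReal (8 * H * (B.card + 1)) := by
  have hH0 : 0 ≤ H := (abs_nonneg _).trans (hH 1 one_pos)
  rw [eVariationOn.eq_biSup_inter_Icc]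
  refine iSup₂_le fun p hp => ?_
  obtain ⟨h1, h2, h12⟩ := hp
  have := eVariationOn_Icc_le_of_pieces (f := roundSum a y z) B (M := ENNReal.ofReal (8 * H))
    (Set.ordConnected_Ioi (a := (0 : ℝ))) (fun c hc d _ hcd hno => by
      have key : ∀ s ∈ Set.Icc c d, ∀ x, x ∈ B → x ≤ c ∨ s ≤ x := by
        intro s hs x hx
        rcases le_or_gt x c with h | h
        · exact Or.inl h
        · right
          by_contra! hcon
          exact hno x hx ⟨h, hcon.trans_le hs.2⟩
      exact eVariationOn_le_of_quadratic hc hcd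
        (fun s hs => roundSum_eq_quadratic a y z hc hs.1 (fun e => key s hs _ (hy e))
          (fun e => key s hs _ (hz e))) (fun s hs => hH s (lt_of_lt_of_le hc hs.1)))
    B.card p.1 h1 p.2 h2 h12 (Finset.card_filter_le _ _)
  refine (eVariationOn.mono _ Set.inter_subset_right).trans (this.trans (le_of_eq ?_))
  rw [mul_comm, ENNReal.ofReal_mul (q := (B.card : ℝ) + 1) (by positivity),
    ENNReal.ofReal_add (by positivity) zero_le_one]
  simp

/-- The increments of a function of bounded variation are dominated by those of its cumulative
variation. -/
lemma exists_dominating_of_eVariationOn_le {f : ℝ → ℝ} {I : Set ℝ} {V : ℝ} (hV : 0 ≤ V)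
    (hf : eVariationOn f I ≤ ENNReal.ofReal V) :
    ∃ G : ℝ → ℝ, Monotone G ∧ (∀ s, 0 ≤ G s ∧ G s ≤ V) ∧
      ∀ s ∈ I, ∀ t ∈ I, |f s - f t| ≤ |G s - G t| := by
  have hfin : ∀ s, eVariationOn f (I ∩ Set.Iic s) ≤ ENNReal.ofReal V := fun s =>
    (eVariationOn.mono _ Set.inter_subset_left).trans hf
  refine ⟨fun s => (eVariationOn f (I ∩ Set.Iic s)).toReal, fun s t hst =>
    ENNReal.toReal_mono (ne_top_of_le_ne_top ENNReal.ofReal_ne_top (hfin t)) (eVariationOn.mono _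
      (Set.inter_subset_inter_right _ (Set.Iic_subset_Iic.2 hst))),
    fun s => ⟨ENNReal.toReal_nonneg, ENNReal.toReal_le_of_le_ofReal hV (hfin s)⟩, ?_⟩
  have key : ∀ s ∈ I, ∀ t ∈ I, s ≤ t → |f s - f t| ≤
      (eVariationOn f (I ∩ Set.Iic t)).toReal - (eVariationOn f (I ∩ Set.Iic s)).toReal := by
    intro s hs t ht hst
    have h1 : eVariationOn f (I ∩ Set.Iic s) + eVariationOn f {s, t} ≤
        eVariationOn f (I ∩ Set.Iic t) := by
      refine (eVariationOn.add_le_union f ?_).trans (eVariationOn.mono _ ?_)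
      · rintro x hx y (rfl | rfl)
        · exact hx.2
        · exact le_trans hx.2 hst
      · rintro x (hx | rfl | rfl)
        · exact ⟨hx.1, le_trans hx.2 hst⟩
        · exact ⟨hs, hst⟩
        · exact ⟨ht, Set.self_mem_Iic⟩
    rw [eVariationOn.pair] at h1
    have h2 := ENNReal.toReal_mono (ne_top_of_le_ne_top ENNReal.ofReal_ne_top (hfin t)) h1
    rw [ENNReal.toReal_add (ne_top_of_le_ne_top ENNReal.ofReal_ne_top (hfin s)) (edist_ne_top _ _),
      edist_dist, ENNReal.toReal_ofReal dist_nonneg, Real.dist_eq] at h2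
    linarith
  intro s hs t ht
  rcases le_total s t with h | h
  · rw [abs_sub_comm (_ : ℝ) (ENNReal.toReal _)]
    exact (key s hs t ht h).trans (le_abs_self _)
  · rw [abs_sub_comm (f s)]
    exact (key t ht s hs h).trans (le_abs_self _)

/-- The values of a bounded `slin` at different parameters are controlled by a monotone function of
total increase `O(H n)`. -/
lemma exists_dominating_slin {n : ℕ} (U : Mat n → Fin n → Vec n) (A : Mat n) (Z : Vec n) {H : ℝ}
    (hH : ∀ s, 0 < s → |slin U s A Z| ≤ H) :
    ∃ G : ℝ → ℝ, Monotone G ∧ (∀ s, 0 ≤ G s ∧ G s ≤ 8 * H * (n + 1)) ∧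
      ∀ s, 0 < s → ∀ t, 0 < t → |slin U s A Z - slin U t A Z| ≤ |G s - G t| := by
  classical
  have hH0 : 0 ≤ H := (abs_nonneg _).trans (hH 1 one_pos)
  set y : Fin n → ℝ := fun i => inner ℝ (U A i) Z
  set B : Finset ℝ := Finset.univ.image fun i => |y i|
  have hB : B.card ≤ n := by
    simpa using Finset.card_image_le (s := Finset.univ) (f := fun i => |y i|)
  have hmem : ∀ i, |y i| ∈ B := fun i => Finset.mem_image_of_mem _ (Finset.mem_univ i)
  simp only [slin_eq_roundSum] at hH ⊢
  have h1 := eVariationOn_roundSum_le (fun e : Fin n × Fin n => A e.1 e.2) (fun e => y e.1)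
    (fun e => y e.2) B (fun e => hmem e.1) (fun e => hmem e.2) hH
  have h2 : ENNReal.ofReal (8 * H * (B.card + 1)) ≤ ENNReal.ofReal (8 * H * (n + 1)) := by
    refine ENNReal.ofReal_le_ofReal ?_
    have : (B.card : ℝ) ≤ n := by exact_mod_cast hB
    gcongr
  obtain ⟨G, hmono, hG, hG'⟩ := exists_dominating_of_eVariationOn_le (by positivity) (h1.trans h2)
  exact ⟨G, hmono, hG, fun s hs t ht => hG' s hs t ht⟩

/-! ### Chaining for random signs -/

/-- The sign encoded by a Boolean. -/
def sgn (b : Bool) : ℝ := if b then 1 else -1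

/-- The signed sum `∑ σ_i v_i`. -/
def signSum {m : ℕ} (σ : Fin m → Bool) (v : Fin m → ℝ) : ℝ := ∑ i, sgn (σ i) * v i

lemma sgn_sq (b : Bool) : sgn b ^ 2 = 1 := by cases b <;> simp [sgn]

lemma signSum_sub {m : ℕ} (σ : Fin m → Bool) (v w : Fin m → ℝ) :
    signSum σ v - signSum σ w = signSum σ fun i => v i - w i := by
  simp only [signSum, ← Finset.sum_sub_distrib, mul_sub]

lemma signSum_neg {m : ℕ} (σ : Fin m → Bool) (v : Fin m → ℝ) :
    signSum σ (fun i => -v i) = -signSum σ v := by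
  simp [signSum]

lemma signSum_sq_le {m : ℕ} (σ : Fin m → Bool) (v : Fin m → ℝ) :
    signSum σ v ^ 2 ≤ m * ∑ i, v i ^ 2 := by
  have h := sq_sum_le_card_mul_sum_sq (s := Finset.univ) (f := fun i => sgn (σ i) * v i)
  simpa [mul_pow, sgn_sq, signSum] using h

lemma sum_exp_signSum_le {m : ℕ} (v : Fin m → ℝ) (t : ℝ) :
    ∑ σ : Fin m → Bool, Real.exp (t * signSum σ v) ≤
      2 ^ m * Real.exp (t ^ 2 * (∑ i, v i ^ 2) / 2) := by
  have h1 : ∀ σ : Fin m → Bool, Real.exp (t * signSum σ v) =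
      ∏ i, Real.exp (sgn (σ i) * (t * v i)) := by
    intro σ
    rw [← Real.exp_sum, signSum, Finset.mul_sum]
    congr 1
    refine Finset.sum_congr rfl fun i _ => by ring
  have h2 : ∑ σ : Fin m → Bool, ∏ i, Real.exp (sgn (σ i) * (t * v i)) =
      ∏ i, ∑ b : Bool, Real.exp (sgn b * (t * v i)) := by
    rw [Finset.prod_univ_sum, Fintype.piFinset_univ]
  simp only [h1, h2]
  calc ∏ i, ∑ b : Bool, Real.exp (sgn b * (t * v i))
      ≤ ∏ i : Fin m, (2 * Real.exp ((t * v i) ^ 2 / 2)) := by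
        refine Finset.prod_le_prod (fun i _ => by positivity) fun i _ => ?_
        have := Real.cosh_le_exp_half_sq (t * v i)
        rw [Real.cosh_eq] at this
        simp only [Fintype.sum_bool, sgn, if_true, Bool.false_eq_true, if_false, one_mul, neg_mul]
        linarith
    _ = 2 ^ m * Real.exp (t ^ 2 * (∑ i, v i ^ 2) / 2) := by
        rw [Finset.prod_mul_distrib, ← Real.exp_sum]
        simp only [Finset.prod_const, Finset.card_univ, Fintype.card_fin]
        congr 2
        rw [← Finset.sum_div, Finset.mul_sum]
        simp only [mul_pow]

lemma card_lt_signSum_le {m : ℕ} {v : Fin m → ℝ} {R a : ℝ} (hR : 0 < R) (ha : 0 ≤ a)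
    (hv : ∑ i, v i ^ 2 ≤ R) :
    ((Finset.univ.filter fun σ : Fin m → Bool => a < signSum σ v).card : ℝ) ≤
      2 ^ m * Real.exp (-(a ^ 2 / (2 * R))) := by
  set t := a / R with ht
  have ht0 : 0 ≤ t := by positivity
  have h1 : ((Finset.univ.filter fun σ : Fin m → Bool => a < signSum σ v).card : ℝ) *
      Real.exp (t * a) ≤ ∑ σ : Fin m → Bool, Real.exp (t * signSum σ v) := by
    rw [← nsmul_eq_mul]
    refine (Finset.card_nsmul_le_sum _ _ _ fun σ hσ => ?_).trans
      (Finset.sum_le_sum_of_subset_of_nonneg (Finset.filter_subset _ _) fun _ _ _ => by positivity)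
    exact Real.exp_le_exp.2 (mul_le_mul_of_nonneg_left (Finset.mem_filter.1 hσ).2.le ht0)
  have h2 := h1.trans (sum_exp_signSum_le v t)
  have h3 : 2 ^ m * Real.exp (t ^ 2 * (∑ i, v i ^ 2) / 2) ≤
      2 ^ m * Real.exp (-(a ^ 2 / (2 * R))) * Real.exp (t * a) := by
    rw [mul_assoc, ← Real.exp_add]
    gcongr
    have : t ^ 2 * (∑ i, v i ^ 2) ≤ t ^ 2 * R := by gcongr
    have e : t ^ 2 * R / 2 = -(a ^ 2 / (2 * R)) + t * a := by
      rw [ht]; field_simp; ring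
    linarith
  exact le_of_mul_le_mul_right (h2.trans h3) (Real.exp_pos _)

/-- **Hoeffding's inequality** for uniformly random signs, in counting form. -/
lemma card_lt_abs_signSum_le {m : ℕ} {v : Fin m → ℝ} {R a : ℝ} (hR : 0 < R) (ha : 0 ≤ a)
    (hv : ∑ i, v i ^ 2 ≤ R) :
    ((Finset.univ.filter fun σ : Fin m → Bool => a < |signSum σ v|).card : ℝ) ≤
      2 ^ m * (2 * Real.exp (-(a ^ 2 / (2 * R)))) := by
  have h1 := card_lt_signSum_le hR ha hv
  have h2 := card_lt_signSum_le (v := fun i => -v i) hR ha (by simpa using hv)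
  have h3 : (Finset.univ.filter fun σ : Fin m → Bool => a < |signSum σ v|) ⊆
      (Finset.univ.filter fun σ : Fin m → Bool => a < signSum σ v) ∪
      (Finset.univ.filter fun σ : Fin m → Bool => a < signSum σ fun i => -v i) := by
    intro σ hσ
    simp only [Finset.mem_union, Finset.mem_filter, Finset.mem_univ, true_and, signSum_neg] at hσ ⊢
    exact lt_abs.1 hσ
  have h4 : ((Finset.univ.filter fun σ : Fin m → Bool => a < |signSum σ v|).card : ℝ) ≤ _ :=
    Nat.cast_le.2 ((Finset.card_le_card h3).trans (Finset.card_union_le _ _))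
  push_cast at h4
  linarith

section Chaining

variable {ι : Type*} (g : ι → ℝ)

/-- The index of the cell of length `4⁻ᵏ` that contains `g s`. -/
def cell (k : ℕ) (s : ι) : ℕ := ⌊4 ^ k * g s⌋₊

lemma abs_sub_le_of_cell_eq {g : ι → ℝ} {k : ℕ} {s t : ι} (hs : 0 ≤ g s) (ht : 0 ≤ g t)
    (h : cell g k s = cell g k t) : |g s - g t| ≤ 1 / 4 ^ k := by
  have p : (0 : ℝ) < 4 ^ k := by positivity
  have h1 := Nat.floor_le (show 0 ≤ 4 ^ k * g s by positivity)
  have h2 := Nat.lt_floor_add_one (4 ^ k * g s)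
  have h3 := Nat.floor_le (show 0 ≤ 4 ^ k * g t by positivity)
  have h4 := Nat.lt_floor_add_one (4 ^ k * g t)
  simp only [cell] at h
  rw [h] at h1 h2
  rw [le_div_iff₀ p, ← abs_of_pos p, ← abs_mul, abs_le]
  constructor <;> nlinarith

lemma cell_le {g : ι → ℝ} {K : ℕ} {k : ℕ} {s : ι} (hs : g s ≤ K) : cell g k s ≤ 4 ^ k * K := by
  refine Nat.floor_le_of_le ?_
  push_cast
  gcongr

variable [Nonempty ι]

open Classical in
/-- A representative of a cell (arbitrary if the cell is empty). -/
def cellRep (k c : ℕ) : ι := if h : ∃ s, cell g k s = c then h.choose else Classical.arbitrary ι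

lemma cell_cellRep (k : ℕ) (s : ι) : cell g k (cellRep g k (cell g k s)) = cell g k s := by
  have h : ∃ t, cell g k t = cell g k s := ⟨s, rfl⟩
  rw [cellRep, dif_pos h]
  exact h.choose_spec

/-- The numerical sum behind the union bound over all links of the chain. -/
lemma chaining_tail_le {K n : ℕ} {E δ : ℝ} (hK : 1 ≤ K) (hE : 0 ≤ E)
    (hδ : 24 * K * Real.exp (-E) ≤ δ) (hδ1 : δ ≤ 1) :
    ((K : ℝ) + 1) * (2 * Real.exp (-E)) +
      ∑ k ∈ Finset.range n, ((4 : ℝ) ^ (k + 1) * K + 1) * (2 * Real.exp (-(E * (9 / 4) ^ k)))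
      ≤ δ := by
  set x := Real.exp (-E) with hx
  have hx0 : 0 < x := Real.exp_pos _
  have hK1 : (1 : ℝ) ≤ K := by exact_mod_cast hK
  have hx1 : 4 * x ≤ 1 / 2 := by nlinarith
  have hterm : ∀ k ∈ Finset.range n, ((4 : ℝ) ^ (k + 1) * K + 1) *
      (2 * Real.exp (-(E * (9 / 4) ^ k))) ≤ 10 * K * x * (1 / 2) ^ k := by
    intro k _
    have hb : (1 : ℝ) + k ≤ (9 / 4) ^ k := by
      have := one_add_mul_le_pow (a := (5 / 4 : ℝ)) (by norm_num) k
      norm_num at this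
      have hk : (0 : ℝ) ≤ k := by positivity
      linarith
    have he : Real.exp (-(E * (9 / 4) ^ k)) ≤ x * x ^ k := by
      rw [hx, ← Real.exp_nat_mul, ← Real.exp_add]
      refine Real.exp_le_exp.2 ?_
      nlinarith [mul_le_mul_of_nonneg_left hb hE]
    have h4 : (1 : ℝ) ≤ 4 ^ k := one_le_pow₀ (by norm_num)
    have hc : (4 : ℝ) ^ (k + 1) * K + 1 ≤ 5 * 4 ^ k * K := by
      rw [pow_succ]
      nlinarith
    calc ((4 : ℝ) ^ (k + 1) * K + 1) * (2 * Real.exp (-(E * (9 / 4) ^ k)))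
        ≤ (5 * 4 ^ k * K) * (2 * (x * x ^ k)) := by gcongr
      _ = 10 * K * x * (4 * x) ^ k := by rw [mul_pow]; ring
      _ ≤ 10 * K * x * (1 / 2) ^ k := by gcongr
  have hgeom : ∑ k ∈ Finset.range n, (1 / 2 : ℝ) ^ k ≤ 2 := by
    rw [geom_sum_eq (by norm_num)]
    have : (0 : ℝ) ≤ (1 / 2) ^ n := by positivity
    rw [div_le_iff_of_neg (by norm_num)]
    linarith
  have hs : ∑ k ∈ Finset.range n, ((4 : ℝ) ^ (k + 1) * K + 1) *
      (2 * Real.exp (-(E * (9 / 4) ^ k))) ≤ 20 * K * x := by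
    refine (Finset.sum_le_sum hterm).trans ?_
    rw [← Finset.mul_sum]
    have : 0 ≤ 10 * K * x := by positivity
    nlinarith
  nlinarith

/-- **Chaining.** If the vectors `h s` are indexed by points `g s` of an interval of length `K` with
`‖h s - h t‖² ≤ R |g s - g t|` and `‖h s‖² ≤ R`, then for most sign vectors `σ` all sums
`∑ σ_i h_s(i)` are `O(√(R (log K + log (1/δ))))`. The scale `k` has `4ᵏ K` cells and links of
length `√R / 2ᵏ`; it is allowed a deviation proportional to `(3/4)ᵏ`, which is summable and still
leaves room for the union bound over the cells. -/
theorem card_exists_lt_abs_signSum_le {m : ℕ} (h : ι → Fin m → ℝ) {K : ℕ} {R E δ : ℝ} (hK : 1 ≤ K)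
    (hR : 0 < R) (hE : 0 < E) (hδ : 24 * K * Real.exp (-E) ≤ δ) (hδ1 : δ ≤ 1)
    (hg : ∀ s, 0 ≤ g s ∧ g s ≤ K)
    (hd : ∀ s t, ∑ i, (h s i - h t i) ^ 2 ≤ R * |g s - g t|)
    (hn : ∀ s, ∑ i, h s i ^ 2 ≤ R) (bad : Finset (Fin m → Bool))
    (hbad : ∀ σ ∈ bad, ∃ s, 6 * Real.sqrt (2 * R * E) < |signSum σ (h s)|) :
    (bad.card : ℝ) ≤ 2 ^ m * δ := by
  set A := Real.sqrt (2 * R * E) with hA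
  have hA2 : A ^ 2 = 2 * R * E := Real.sq_sqrt (by positivity)
  have hA0 : 0 < A := Real.sqrt_pos.2 (by positivity)
  -- a scale at which the rest of the chain is negligible for all signs
  obtain ⟨n, hn'⟩ : ∃ n : ℕ, (1 / 4 : ℝ) ^ n < 2 * E / (m + 1) :=
    exists_pow_lt_of_lt_one (by positivity) (by norm_num)
  set pr : ℕ → ι → ι := fun k s => cellRep g k (cell g k s) with hpr
  have hdist : ∀ k s, ∑ i, (h s i - h (pr k s) i) ^ 2 ≤ R * (1 / 4) ^ k := by
    intro k s
    refine (hd s (pr k s)).trans ?_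
    have := abs_sub_le_of_cell_eq (hg s).1 (hg (pr k s)).1 (cell_cellRep g k s).symm
    rw [one_div_pow]
    gcongr
  set bad₀ : ℕ → Finset (Fin m → Bool) := fun c =>
    Finset.univ.filter fun σ => A < |signSum σ (h (cellRep g 0 c))| with hbad₀
  set bad₁ : ℕ → ℕ → Finset (Fin m → Bool) := fun k c =>
    Finset.univ.filter fun σ => A * (3 / 4) ^ k <
      |signSum σ fun i => h (cellRep g (k + 1) c) i - h (pr k (cellRep g (k + 1) c)) i| with hbad₁
  have hsub : bad ⊆ ((Finset.range (K + 1)).biUnion bad₀) ∪ ((Finset.range n).biUnion fun k =>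
      (Finset.range (4 ^ (k + 1) * K + 1)).biUnion (bad₁ k)) := by
    intro σ hσ
    by_contra hcon
    simp only [Finset.mem_union, Finset.mem_biUnion, Finset.mem_range, not_or, not_exists, not_and,
      hbad₀, hbad₁, Finset.mem_filter, Finset.mem_univ, true_and, not_lt, Order.lt_add_one_iff]
      at hcon
    obtain ⟨h0, h1⟩ := hcon
    have chain : ∀ j ≤ n, ∀ s, |signSum σ (h (pr j s))| ≤
        A + A * ∑ k ∈ Finset.range j, (3 / 4 : ℝ) ^ k := by
      intro j
      induction j with
      | zero =>
        intro _ s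
        simpa using h0 (cell g 0 s) (by simpa using cell_le (k := 0) (hg s).2)
      | succ j ih =>
        intro hj s
        have e1 := h1 j (by omega) (cell g (j + 1) s) (cell_le (hg s).2)
        have e2 := ih (by omega) (pr (j + 1) s)
        rw [← signSum_sub] at e1
        rw [Finset.sum_range_succ, mul_add]
        have e3 := abs_sub_abs_le_abs_sub (signSum σ (h (pr (j + 1) s)))
          (signSum σ (h (pr j (pr (j + 1) s))))
        change |signSum σ (h (pr (j + 1) s)) - signSum σ (h (pr j (pr (j + 1) s)))| ≤ _ at e1
        linarith
    have hgeom : ∑ k ∈ Finset.range n, (3 / 4 : ℝ) ^ k ≤ 4 := by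
      rw [geom_sum_eq (by norm_num), div_le_iff_of_neg (by norm_num)]
      have : (0 : ℝ) ≤ (3 / 4) ^ n := by positivity
      linarith
    obtain ⟨s, hs⟩ := hbad σ hσ
    have c1 := chain n le_rfl s
    have c2 : |signSum σ (h s) - signSum σ (h (pr n s))| ≤ A := by
      rw [signSum_sub]
      refine abs_le_of_sq_le_sq ?_ hA0.le
      refine (signSum_sq_le _ _).trans ?_
      calc (m : ℝ) * ∑ i, (h s i - h (pr n s) i) ^ 2 ≤ m * (R * (1 / 4) ^ n) := by
            gcongr; exact hdist n s
        _ ≤ m * (R * (2 * E / (m + 1))) := by gcongr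
        _ = 2 * R * E * (m / (m + 1)) := by ring
        _ ≤ 2 * R * E * 1 := by
            gcongr
            rw [div_le_one (by positivity)]; linarith
        _ = A ^ 2 := by rw [hA2, mul_one]
    have c3 := abs_sub_abs_le_abs_sub (signSum σ (h s)) (signSum σ (h (pr n s)))
    nlinarith
  have hcard₀ : ∀ c, ((bad₀ c).card : ℝ) ≤ 2 ^ m * (2 * Real.exp (-E)) := by
    intro c
    have := card_lt_abs_signSum_le hR hA0.le (hn (cellRep g 0 c))
    rwa [hA2, show 2 * R * E / (2 * R) = E by field_simp] at this
  have hcard₁ : ∀ k c, ((bad₁ k c).card : ℝ) ≤ 2 ^ m * (2 * Real.exp (-(E * (9 / 4) ^ k))) := by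
    intro k c
    have hRk : 0 < R * (1 / 4) ^ k := by positivity
    have := card_lt_abs_signSum_le hRk (show 0 ≤ A * (3 / 4) ^ k by positivity)
      (hdist k (cellRep g (k + 1) c))
    rwa [mul_pow, hA2, show 2 * R * E * ((3 / 4 : ℝ) ^ k) ^ 2 / (2 * (R * (1 / 4) ^ k)) =
      E * (9 / 4) ^ k by
        rw [← pow_mul, mul_comm k 2, pow_mul, mul_comm (2 * R), mul_assoc, mul_div_assoc,
          mul_assoc 2 R, ← mul_assoc 2, ← mul_assoc 2, mul_div_mul_left _ _ (by positivity),
          ← div_pow]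
        norm_num] at this
  calc (bad.card : ℝ) ≤ ((∑ c ∈ Finset.range (K + 1), (bad₀ c).card +
        ∑ k ∈ Finset.range n, ∑ c ∈ Finset.range (4 ^ (k + 1) * K + 1), (bad₁ k c).card : ℕ) : ℝ) := by
        refine Nat.cast_le.2 ((Finset.card_le_card hsub).trans ((Finset.card_union_le _ _).trans ?_))
        refine add_le_add Finset.card_biUnion_le (Finset.card_biUnion_le.trans ?_)
        exact Finset.sum_le_sum fun k _ => Finset.card_biUnion_le
    _ ≤ ∑ c ∈ Finset.range (K + 1), 2 ^ m * (2 * Real.exp (-E)) +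
        ∑ k ∈ Finset.range n, ∑ c ∈ Finset.range (4 ^ (k + 1) * K + 1),
          2 ^ m * (2 * Real.exp (-(E * (9 / 4) ^ k))) := by
        push_cast
        exact add_le_add (Finset.sum_le_sum fun c _ => hcard₀ c)
          (Finset.sum_le_sum fun k _ => Finset.sum_le_sum fun c _ => hcard₁ k c)
    _ = 2 ^ m * (((K : ℝ) + 1) * (2 * Real.exp (-E)) + ∑ k ∈ Finset.range n,
          ((4 : ℝ) ^ (k + 1) * K + 1) * (2 * Real.exp (-(E * (9 / 4) ^ k)))) := by
        simp only [Finset.sum_const, Finset.card_range, nsmul_eq_mul]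
        rw [mul_add, Finset.mul_sum]
        push_cast
        congr 1
        · ring
        · exact Finset.sum_congr rfl fun k _ => by ring
    _ ≤ 2 ^ m * δ := by
        gcongr
        exact chaining_tail_le hK hE.le hδ hδ1

end Chaining

/-! ### Uniform convergence by symmetrization -/

section UniformConvergence

variable {X : Type*} [MeasurableSpace X] (μ : Measure X) [IsProbabilityMeasure μ]

/-- Chebyshev's inequality for the sum of `m` independent copies of a bounded function. -/
lemma measure_pi_le_abs_sum_sub_le {f : X → ℝ} (hf : Measurable f) {H η : ℝ}
    (hb : ∀ x, |f x| ≤ H) {m : ℕ} (hm : 0 < m) (hη : 0 < η)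
    (hmη : 8 * H ^ 2 ≤ m * η ^ 2) :
    (Measure.pi fun _ : Fin m => μ) {x | m * η / 2 ≤ |∑ i, f (x i) - m * ∫ y, f y ∂μ|} ≤
      ENNReal.ofReal (1 / 2) := by
  have hmem : MemLp f 2 μ := MemLp.of_bound hf.aestronglyMeasurable H (ae_of_all _ hb)
  have hvar := variance_sum_pi (μ := fun _ : Fin m => μ) (X := fun _ => f) fun _ => hmem
  have hint : ∀ i : Fin m, Integrable (fun x : Fin m → X => f (x i)) (Measure.pi fun _ => μ) :=
    fun i => ((measurePreserving_eval (fun _ : Fin m => μ) i).integrable_comp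
      hf.aestronglyMeasurable).2 (hmem.integrable one_le_two)
  have hmean : (Measure.pi fun _ : Fin m => μ)[∑ i, fun x : Fin m → X => f (x i)] =
      m * ∫ y, f y ∂μ := by
    simp only [Finset.sum_apply]
    rw [integral_finsetSum _ fun i _ => hint i]
    simp only [integral_comp_eval (μ := fun _ : Fin m => μ) hf.aestronglyMeasurable]
    simp
  have hmemS : MemLp (∑ i, fun x : Fin m → X => f (x i)) 2 (Measure.pi fun _ : Fin m => μ) :=
    memLp_finsetSum' _ fun i _ => hmem.comp_measurePreserving (measurePreserving_eval _ i)
  have hc : 0 < m * η / 2 := by positivity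
  have hcheb := meas_ge_le_variance_div_sq hmemS hc
  rw [hmean, hvar] at hcheb
  simp only [Finset.sum_apply] at hcheb
  refine hcheb.trans (ENNReal.ofReal_le_ofReal ?_)
  have hv : Var[f; μ] ≤ H ^ 2 := by
    refine (variance_le_expectation_sq hf.aestronglyMeasurable).trans ?_
    calc ∫ x, f x ^ 2 ∂μ ≤ ∫ _, H ^ 2 ∂μ := by
          refine integral_mono hmem.integrable_sq (integrable_const _) fun x => ?_
          exact sq_le_sq' (by linarith [(abs_le.1 (hb x)).1]) (abs_le.1 (hb x)).2
      _ = H ^ 2 := by simp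
  simp only [Finset.sum_const, Finset.card_univ, Fintype.card_fin, nsmul_eq_mul]
  rw [div_le_iff₀ (by positivity)]
  have hm' : (0 : ℝ) < m := by exact_mod_cast hm
  nlinarith [mul_le_mul_of_nonneg_left hv hm'.le, mul_le_mul_of_nonneg_left hmη hm'.le]

/-- Exchanging the two components of the pairs `w_i` at the indices where the sign is negative. -/
def signSwap {m : ℕ} (σ : Fin m → Bool) (w : Fin m → X × X) : Fin m → X × X :=
  fun i => if σ i then w i else (w i).swap

lemma measurePreserving_signSwap {m : ℕ} (σ : Fin m → Bool) :
    MeasurePreserving (signSwap (X := X) σ) (Measure.pi fun _ => μ.prod μ)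
      (Measure.pi fun _ => μ.prod μ) := by
  refine measurePreserving_pi (fun _ => μ.prod μ) (fun _ => μ.prod μ)
    (f := fun i p => if σ i then p else p.swap) fun i => ?_
  cases σ i
  · simpa using Measure.measurePreserving_swap
  · simp only [if_true]
    exact MeasurePreserving.id _

/-- An event for `m` independent pairs has probability at most `δ` if for every outcome at most a
fraction `δ` of the ways to swap within pairs leads into it. -/
lemma measure_pi_prod_le_of_card_signSwap_le {m : ℕ} {J : Set (Fin m → X × X)}
    (hJ : MeasurableSet J) {δ : ℝ}
    (hcard : ∀ w, ∀ B : Finset (Fin m → Bool), (∀ σ ∈ B, signSwap σ w ∈ J) →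
      (B.card : ℝ) ≤ 2 ^ m * δ) :
    (Measure.pi fun _ : Fin m => μ.prod μ) J ≤ ENNReal.ofReal δ := by
  classical
  set P := Measure.pi fun _ : Fin m => μ.prod μ with hP
  have hsum : (2 ^ m : ENNReal) * P J =
      ∫⁻ w, ∑ σ : Fin m → Bool, (signSwap σ ⁻¹' J).indicator 1 w ∂P := by
    rw [lintegral_finsetSum' _ fun σ _ => (measurable_one.indicator
      ((measurePreserving_signSwap μ σ).measurable hJ)).aemeasurable]
    have : ∀ σ : Fin m → Bool, ∫⁻ w, (signSwap σ ⁻¹' J).indicator 1 w ∂P = P J := by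
      intro σ
      rw [lintegral_indicator_one ((measurePreserving_signSwap μ σ).measurable hJ)]
      exact (measurePreserving_signSwap μ σ).measure_preimage hJ.nullMeasurableSet
    simp [this]
  have hle : ∫⁻ w, ∑ σ : Fin m → Bool, (signSwap σ ⁻¹' J).indicator 1 w ∂P ≤
      (2 ^ m : ENNReal) * ENNReal.ofReal δ := by
    calc _ ≤ ∫⁻ _, (2 ^ m : ENNReal) * ENNReal.ofReal δ ∂P := by
          refine lintegral_mono fun w => ?_
          have h1 : ∑ σ : Fin m → Bool,
              (signSwap σ ⁻¹' J).indicator (1 : (Fin m → X × X) → ENNReal) w =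
              ((Finset.univ.filter fun σ : Fin m → Bool => signSwap σ w ∈ J).card : ENNReal) := by
            simp [Set.indicator_apply]
          simp only [h1]
          have h2 := hcard w (Finset.univ.filter fun σ : Fin m → Bool => signSwap σ w ∈ J)
            fun σ hσ => (Finset.mem_filter.1 hσ).2
          rw [← ENNReal.ofReal_natCast,
            show (2 ^ m : ENNReal) = ENNReal.ofReal (2 ^ m) by
              rw [ENNReal.ofReal_pow (by norm_num)]; simp,
            ← ENNReal.ofReal_mul (by positivity)]
          exact ENNReal.ofReal_le_ofReal h2
      _ = _ := by simp
  rw [← hsum] at hle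
  exact (ENNReal.mul_le_mul_iff_right (by simp) (by finiteness)).1 hle

variable {ι : Type*} [Countable ι] {f : ι → X → ℝ}
  (hf : ∀ s, Measurable (f s)) {H : ℝ} (hb : ∀ s x, |f s x| ≤ H)

include hf hb

/-- A sample deviating from the mean yields, with an independent second sample, two samples
deviating from each other. -/
lemma measure_deviation_le_two_mul {m : ℕ} (hm : 0 < m) {η : ℝ} (hη : 0 < η)
    (hmη : 8 * H ^ 2 ≤ m * η ^ 2) :
    (Measure.pi fun _ : Fin m => μ) {x | ∃ s, m * η < |∑ i, f s (x i) - m * ∫ y, f s y ∂μ|} ≤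
      2 * (Measure.pi fun _ : Fin m => μ.prod μ)
        {w | ∃ s, m * η / 2 < |∑ i, (f s (w i).1 - f s (w i).2)|} := by
  set ν := Measure.pi fun _ : Fin m => μ with hν
  set B : Set (Fin m → X) := {x | ∃ s, m * η < |∑ i, f s (x i) - m * ∫ y, f s y ∂μ|} with hB
  set J : Set ((Fin m → X) × (Fin m → X)) :=
    {p | ∃ s, m * η / 2 < |∑ i, (f s (p.1 i) - f s (p.2 i))|} with hJ
  have hBm : MeasurableSet B := by
    rw [hB, Set.ofPred_exists]
    refine MeasurableSet.iUnion fun s => measurableSet_lt measurable_const ?_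
    have := hf s
    fun_prop
  have hJm : MeasurableSet J := by
    rw [hJ, Set.ofPred_exists]
    refine MeasurableSet.iUnion fun s => measurableSet_lt measurable_const ?_
    have := hf s
    fun_prop
  have hpre : (Measure.pi fun _ : Fin m => μ.prod μ)
      {w | ∃ s, m * η / 2 < |∑ i, (f s (w i).1 - f s (w i).2)|} = (ν.prod ν) J := by
    rw [← (measurePreserving_arrowProdEquivProdArrow X X (Fin m) (fun _ => μ)
      (fun _ => μ)).measure_preimage hJm.nullMeasurableSet]
    rfl
  rw [hpre, Measure.prod_apply hJm]
  have hx : ∀ x ∈ B, ENNReal.ofReal (1 / 2) ≤ ν (Prod.mk x ⁻¹' J) := by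
    rintro x ⟨s, hs⟩
    have hsub : (Prod.mk x ⁻¹' J)ᶜ ⊆ {y | m * η / 2 ≤ |∑ i, f s (y i) - m * ∫ y, f s y ∂μ|} := by
      intro y hy
      by_contra hcon
      refine hy ⟨s, ?_⟩
      rw [Set.mem_ofPred_eq, not_le] at hcon
      simp only [Finset.sum_sub_distrib]
      have h3 := abs_sub_le (∑ i, f s (x i)) (∑ i, f s (y i)) (m * ∫ y, f s y ∂μ)
      linarith
    have h1 := (measure_mono hsub).trans
      (measure_pi_le_abs_sum_sub_le μ (hf s) (hb s) hm hη hmη)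
    have hmeas : MeasurableSet (Prod.mk x ⁻¹' J) := measurable_prodMk_left hJm
    rw [prob_compl_eq_one_sub hmeas, tsub_le_iff_right] at h1
    have h2 : (1 : ENNReal) = ENNReal.ofReal (1 / 2) + ENNReal.ofReal (1 / 2) := by
      rw [← ENNReal.ofReal_add (by norm_num) (by norm_num)]; norm_num
    rw [h2] at h1
    exact (ENNReal.add_le_add_iff_left ENNReal.ofReal_ne_top).1 h1
  have hhalf : ENNReal.ofReal (1 / 2) * ν B ≤ ∫⁻ x, ν (Prod.mk x ⁻¹' J) ∂ν :=
    calc ENNReal.ofReal (1 / 2) * ν B = ∫⁻ _ in B, ENNReal.ofReal (1 / 2) ∂ν := by simp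
      _ ≤ ∫⁻ x in B, ν (Prod.mk x ⁻¹' J) ∂ν := setLIntegral_mono' hBm hx
      _ ≤ _ := setLIntegral_le_lintegral _ _
  calc ν B = 2 * (ENNReal.ofReal (1 / 2) * ν B) := by
        rw [← mul_assoc, show (2 : ENNReal) = ENNReal.ofReal 2 by simp,
          ← ENNReal.ofReal_mul (by norm_num)]
        norm_num
    _ ≤ _ := by gcongr

/-- **Uniform convergence** for a one-parameter family of functions, bounded by `H` and of variation
at most `V H` in the parameter, from `O((H/η)² (log V + log (1/δ)))` samples. -/
theorem measure_exists_deviation_le [LinearOrder ι] [Nonempty ι] (hH : 0 < H) {V : ℕ} (hV : 1 ≤ V)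
    (G : X → ι → ℝ)
    (hGm : ∀ x, Monotone (G x)) (hG : ∀ x s, 0 ≤ G x s ∧ G x s ≤ V * H)
    (hfG : ∀ x s t, |f s x - f t x| ≤ |G x s - G x t|)
    {m : ℕ} (hm : 0 < m) {η E δ : ℝ} (hη : 0 < η) (hE : 0 < E) (hmη : 8 * H ^ 2 ≤ m * η ^ 2)
    (hδ : 48 * V * Real.exp (-E) ≤ δ) (hδ1 : δ ≤ 1) (hmE : 1152 * H ^ 2 * E ≤ m * η ^ 2) :
    (Measure.pi fun _ : Fin m => μ) {x | ∃ s, m * η < |∑ i, f s (x i) - m * ∫ y, f s y ∂μ|} ≤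
      2 * ENNReal.ofReal δ := by
  refine (measure_deviation_le_two_mul μ hf hb hm hη hmη).trans ?_
  gcongr
  refine measure_pi_prod_le_of_card_signSwap_le μ ?_ fun w B hB => ?_
  · rw [Set.ofPred_exists]
    refine MeasurableSet.iUnion fun s => measurableSet_lt measurable_const ?_
    have := hf s
    fun_prop
  have hm' : (0 : ℝ) < m := by exact_mod_cast hm
  refine card_exists_lt_abs_signSum_le
    (fun s => (∑ i, (G (w i).1 s + G (w i).2 s)) / (m * H))
    (fun s i => f s (w i).1 - f s (w i).2) (K := 2 * V) (R := 4 * m * H ^ 2) (E := E)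
    (by omega) (by positivity) hE (by push_cast; linarith) hδ1 ?_ ?_ ?_ B ?_
  · intro s
    constructor
    · exact div_nonneg (Finset.sum_nonneg fun i _ => add_nonneg (hG _ s).1 (hG _ s).1) (by positivity)
    · rw [div_le_iff₀ (by positivity)]
      calc ∑ i, (G (w i).1 s + G (w i).2 s) ≤ ∑ _i : Fin m, (V * H + V * H) :=
            Finset.sum_le_sum fun i _ => add_le_add (hG _ s).2 (hG _ s).2
        _ = ((2 * V : ℕ) : ℝ) * (m * H) := by simp; ring
  · intro s t
    -- monotonicity turns the sum of the increments into the increment of the sum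
    have habs : ∑ i, (|G (w i).1 s - G (w i).1 t| + |G (w i).2 s - G (w i).2 t|) =
        |∑ i, (G (w i).1 s + G (w i).2 s) - ∑ i, (G (w i).1 t + G (w i).2 t)| := by
      rw [← Finset.sum_sub_distrib]
      rcases le_total s t with h | h
      · have e : ∀ x, G x s - G x t ≤ 0 := fun x => sub_nonpos.2 (hGm x h)
        rw [abs_of_nonpos (Finset.sum_nonpos fun i _ => by linarith [e (w i).1, e (w i).2]),
          ← Finset.sum_neg_distrib]
        refine Finset.sum_congr rfl fun i _ => ?_
        rw [abs_of_nonpos (e _), abs_of_nonpos (e _)]; ring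
      · have e : ∀ x, 0 ≤ G x s - G x t := fun x => sub_nonneg.2 (hGm x h)
        rw [abs_of_nonneg (Finset.sum_nonneg fun i _ => by linarith [e (w i).1, e (w i).2])]
        refine Finset.sum_congr rfl fun i _ => ?_
        rw [abs_of_nonneg (e _), abs_of_nonneg (e _)]; ring
    calc ∑ i, (f s (w i).1 - f s (w i).2 - (f t (w i).1 - f t (w i).2)) ^ 2
        ≤ ∑ i, 4 * H * (|G (w i).1 s - G (w i).1 t| + |G (w i).2 s - G (w i).2 t|) := by
          refine Finset.sum_le_sum fun i _ => ?_
          set a := f s (w i).1 - f s (w i).2 - (f t (w i).1 - f t (w i).2) with ha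
          have h1 : |a| ≤ 4 * H := by
            rw [abs_le]
            have b1 := abs_le.1 (hb s (w i).1)
            have b2 := abs_le.1 (hb s (w i).2)
            have b3 := abs_le.1 (hb t (w i).1)
            have b4 := abs_le.1 (hb t (w i).2)
            constructor <;> linarith
          have h2 : |a| ≤ |G (w i).1 s - G (w i).1 t| + |G (w i).2 s - G (w i).2 t| := by
            rw [show a = (f s (w i).1 - f t (w i).1) - (f s (w i).2 - f t (w i).2) by rw [ha]; ring]
            exact (abs_sub _ _).trans (add_le_add (hfG _ s t) (hfG _ s t))
          rw [← sq_abs, sq]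
          gcongr
      _ = 4 * m * H ^ 2 * |(∑ i, (G (w i).1 s + G (w i).2 s)) / (m * H) -
            (∑ i, (G (w i).1 t + G (w i).2 t)) / (m * H)| := by
          rw [← Finset.mul_sum, habs, ← sub_div, abs_div, abs_of_pos (show 0 < m * H by positivity)]
          field_simp
  · intro s
    calc ∑ i, (f s (w i).1 - f s (w i).2) ^ 2 ≤ ∑ _i : Fin m, (2 * H) ^ 2 := by
          refine Finset.sum_le_sum fun i _ => ?_
          have b1 := abs_le.1 (hb s (w i).1)
          have b2 := abs_le.1 (hb s (w i).2)
          exact sq_le_sq' (by linarith) (by linarith)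
      _ = 4 * m * H ^ 2 := by simp; ring
  · intro σ hσ
    obtain ⟨s, hs⟩ := hB σ hσ
    refine ⟨s, lt_of_le_of_lt ?_ (lt_of_lt_of_eq hs ?_)⟩
    · have : Real.sqrt (2 * (4 * m * H ^ 2) * E) ≤ m * η / 12 := by
        rw [Real.sqrt_le_left (by positivity)]
        nlinarith [mul_le_mul_of_nonneg_left hmE hm'.le]
      linarith
    · congr 1
      refine Finset.sum_congr rfl fun i _ => ?_
      cases h : σ i <;> simp [signSwap, sgn, h]

end UniformConvergence

/-! ### The learning guarantee -/

lemma measurable_phi (s : ℝ) : Measurable (phi s) :=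
  Measurable.ite measurableSet_Iio measurable_const
    (Measurable.ite measurableSet_Iic (measurable_id.div_const s) measurable_const)

lemma measurable_slin {n : ℕ} {U : Mat n → Fin n → Vec n} (hU : Measurable U) (s : ℝ) :
    Measurable fun x : Mat n × Vec n => slin U s x.1 x.2 := by
  unfold slin
  have hu : ∀ i, Measurable fun x : Mat n × Vec n => phi s (inner ℝ (U x.1 i) x.2) := fun i =>
    (measurable_phi s).comp
      (((measurable_pi_apply i).comp (hU.comp measurable_fst)).inner measurable_snd)
  refine Finset.measurable_sum _ fun i _ => Finset.measurable_sum _ fun j _ => ?_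
  have h := hu i
  have h' := hu j
  fun_prop

/-- A continuous function on `(0, ∞)` is bounded by its bound on the positive rationals. -/
lemma forall_pos_le_of_forall_rat {g : ℝ → ℝ} (hg : ContinuousOn g (Set.Ioi 0)) {M : ℝ}
    (hM : ∀ q : ℚ, 0 < q → g q ≤ M) {s : ℝ} (hs : 0 < s) : g s ≤ M := by
  have hcl : s ∈ closure (Set.Ioi (0 : ℝ) ∩ Set.range ((↑) : ℚ → ℝ)) :=
    Rat.denseRange_cast.open_subset_closure_inter isOpen_Ioi hs
  have : g s ∈ closure (Set.Iic M) := by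
    refine ((hg s hs).mono Set.inter_subset_left).mem_closure hcl ?_
    rintro _ ⟨h0, q, rfl⟩
    exact Set.mem_Iic.2 (hM q (by exact_mod_cast Set.mem_Ioi.1 h0))
  rwa [isClosed_Iic.closure_eq] at this

section Learning

variable {n : ℕ} {U : Mat n → Fin n → Vec n} {D : Measure (Mat n)} [IsProbabilityMeasure D]
  {H : ℝ}

/-- The function `slin_s` on the instances of a set `X₀` of full measure, extended by zero. -/
def slinOn (U : Mat n → Fin n → Vec n) (X₀ : Set (Mat n)) (s : ℝ) (x : Mat n × Vec n) : ℝ :=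
  (Prod.fst ⁻¹' X₀).indicator (fun x => slin U s x.1 x.2) x

lemma slinOn_of_mem {X₀ : Set (Mat n)} {s : ℝ} {x : Mat n × Vec n} (hx : x.1 ∈ X₀) :
    slinOn U X₀ s x = slin U s x.1 x.2 := Set.indicator_of_mem (s := Prod.fst ⁻¹' X₀) hx _

lemma slinOn_of_notMem {X₀ : Set (Mat n)} {s : ℝ} {x : Mat n × Vec n} (hx : x.1 ∉ X₀) :
    slinOn U X₀ s x = 0 := Set.indicator_of_notMem (s := Prod.fst ⁻¹' X₀) hx _

lemma measurable_slinOn (hU : Measurable U) {X₀ : Set (Mat n)} (hX : MeasurableSet X₀) (s : ℝ) :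
    Measurable (slinOn U X₀ s) :=
  (measurable_slin hU s).indicator (measurable_fst hX)

lemma abs_slinOn_le {X₀ : Set (Mat n)} (hH0 : 0 ≤ H)
    (hX : ∀ A ∈ X₀, ∀ (Z : Vec n) (s : ℝ), 0 < s → |slin U s A Z| ≤ H) {s : ℝ} (hs : 0 < s)
    (x : Mat n × Vec n) : |slinOn U X₀ s x| ≤ H := by
  by_cases hx : x.1 ∈ X₀
  · rw [slinOn_of_mem hx]; exact hX _ hx _ _ hs
  · rw [slinOn_of_notMem hx, abs_zero]; exact hH0

/-- By Fubini, the expected cost is an expectation over pairs `(A, Z)`. -/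
lemma expCost_eq_integral (hU : Measurable U) {X₀ : Set (Mat n)} (hXm : MeasurableSet X₀)
    (hX₀ : ∀ᵐ A ∂D, A ∈ X₀) (hH0 : 0 ≤ H)
    (hX : ∀ A ∈ X₀, ∀ (Z : Vec n) (s : ℝ), 0 < s → |slin U s A Z| ≤ H) {s : ℝ} (hs : 0 < s) :
    expCost U D s = -∫ x, slinOn U X₀ s x ∂(D.prod (stdGaussian (Vec n))) := by
  have hint : Integrable (slinOn U X₀ s) (D.prod (stdGaussian (Vec n))) :=
    Integrable.of_bound (measurable_slinOn hU hXm s).aestronglyMeasurable H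
      (ae_of_all _ fun x => abs_slinOn_le hH0 hX hs x)
  rw [integral_prod _ hint, expCost, integral_neg]
  congr 1
  refine integral_congr_ae ?_
  filter_upwards [hX₀] with A hA
  simp only [slinStar]
  refine integral_congr_ae (ae_of_all _ fun Z => ?_)
  exact (slinOn_of_mem (x := (A, Z)) hA).symm

lemma continuousOn_slinOn (X₀ : Set (Mat n)) (x : Mat n × Vec n) :
    ContinuousOn (fun s => slinOn U X₀ s x) (Set.Ioi 0) := by
  by_cases hx : x.1 ∈ X₀
  · simp only [slinOn_of_mem hx, slin_eq_roundSum]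
    exact continuousOn_roundSum _ _ _
  · simp only [slinOn_of_notMem hx]
    exact continuousOn_const

lemma continuousOn_integral_slinOn (hU : Measurable U) {X₀ : Set (Mat n)}
    (hXm : MeasurableSet X₀) (hH0 : 0 ≤ H)
    (hX : ∀ A ∈ X₀, ∀ (Z : Vec n) (s : ℝ), 0 < s → |slin U s A Z| ≤ H) :
    ContinuousOn (fun s => ∫ x, slinOn U X₀ s x ∂(D.prod (stdGaussian (Vec n)))) (Set.Ioi 0) :=
  continuousOn_of_dominated (bound := fun _ => H)
    (fun _ _ => (measurable_slinOn hU hXm _).aestronglyMeasurable)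
    (fun _ hs => ae_of_all _ fun x => abs_slinOn_le hH0 hX hs x) (integrable_const _)
    (ae_of_all _ fun x => continuousOn_slinOn X₀ x)

/-- With probability at least `1 - δ`, the empirical sums of all `slin_s` are close to their means:
uniform convergence applied to the rational parameters, and continuity in `s`. -/
lemma measure_not_forall_deviation_le (hU : Measurable U) {X₀ : Set (Mat n)}
    (hXm : MeasurableSet X₀) (hH0 : 0 < H)
    (hX : ∀ A ∈ X₀, ∀ (Z : Vec n) (s : ℝ), 0 < s → |slin U s A Z| ≤ H)
    {m : ℕ} (hm : 0 < m) {η E δ : ℝ} (hη : 0 < η) (hE : 1 ≤ E)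
    (hδ : 384 * ((n : ℝ) + 1) * Real.exp (-E) ≤ δ) (hδ1 : δ ≤ 1)
    (hmE : 1152 * H ^ 2 * E ≤ m * η ^ 2) :
    (Measure.pi fun _ : Fin m => D.prod (stdGaussian (Vec n)))
      {S | ¬ ∀ s, 0 < s → |∑ i, slinOn U X₀ s (S i) -
        m * ∫ x, slinOn U X₀ s x ∂(D.prod (stdGaussian (Vec n)))| ≤ m * η} ≤
      2 * ENNReal.ofReal δ := by
  have hdom : ∀ x : Mat n × Vec n, ∃ G : ℝ → ℝ, Monotone G ∧
      (∀ s, 0 ≤ G s ∧ G s ≤ 8 * H * (n + 1)) ∧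
      ∀ s, 0 < s → ∀ t, 0 < t → |slinOn U X₀ s x - slinOn U X₀ t x| ≤ |G s - G t| := by
    intro x
    by_cases hx : x.1 ∈ X₀
    · simp only [slinOn_of_mem hx]
      exact exists_dominating_slin U x.1 x.2 (hX _ hx _)
    · refine ⟨0, monotone_const, fun s => ⟨le_rfl, ?_⟩, fun s _ t _ => ?_⟩
      · simp only [Pi.zero_apply]; positivity
      · simp [slinOn_of_notMem hx]
  choose G hGm hGb hG using hdom
  have : Nonempty {q : ℚ // 0 < q} := ⟨⟨1, one_pos⟩⟩
  have hpos : ∀ q : {q : ℚ // 0 < q}, (0 : ℝ) < (q : ℚ) := fun q => by exact_mod_cast q.2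
  have key := measure_exists_deviation_le (D.prod (stdGaussian (Vec n)))
    (f := fun (q : {q : ℚ // 0 < q}) x => slinOn U X₀ (q : ℚ) x)
    (fun q => measurable_slinOn hU hXm _) (fun q x => abs_slinOn_le hH0.le hX (hpos q) x) hH0
    (V := 8 * (n + 1)) (by omega) (fun x q => G x (q : ℚ))
    (fun x q r hqr => hGm x (by exact_mod_cast hqr))
    (fun x q => ⟨(hGb x _).1, (hGb x _).2.trans (le_of_eq (by push_cast; ring))⟩)
    (fun x q r => hG x _ (hpos q) _ (hpos r)) hm hη (by linarith)
    (by nlinarith [mul_le_mul_of_nonneg_left hE (sq_nonneg H)])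
    (by push_cast; linarith) hδ1 hmE
  refine (measure_mono fun S hS => ?_).trans key
  rw [Set.mem_ofPred_eq] at hS ⊢
  contrapose! hS
  intro s hs
  refine forall_pos_le_of_forall_rat (g := fun s => |∑ i, slinOn U X₀ s (S i) -
        m * ∫ x, slinOn U X₀ s x ∂(D.prod (stdGaussian (Vec n)))|) ?_ (fun q hq => hS ⟨q, hq⟩) hs
  exact ((continuousOn_finsetSum _ fun i _ => continuousOn_slinOn X₀ (S i)).sub
    (continuousOn_const.mul (continuousOn_integral_slinOn hU hXm hH0.le hX))).abs

lemma ae_pi_fst_mem {X₀ : Set (Mat n)} (hX₀ : ∀ᵐ A ∂D, A ∈ X₀) (m : ℕ) :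
    ∀ᵐ S ∂(Measure.pi fun _ : Fin m => D.prod (stdGaussian (Vec n))), ∀ i, (S i).1 ∈ X₀ := by
  rw [ae_all_iff]
  intro i
  have h1 : ∀ᵐ x ∂(D.prod (stdGaussian (Vec n))), x.1 ∈ X₀ :=
    Measure.quasiMeasurePreserving_fst.ae hX₀
  exact (measurePreserving_eval (fun _ : Fin m => D.prod (stdGaussian (Vec n))) i
    ).quasiMeasurePreserving.ae h1

/-- The choice of the constants: with `E = log (768 (n + 1) / δ)` the union bound costs `δ / 2`, and
`E = O(log max(n, 2) + log (1/δ))`. -/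
lemma exists_log_bound (n : ℕ) {δ : ℝ} (hδ0 : 0 < δ) (hδ1 : δ ≤ 1) :
    ∃ E : ℝ, 1 ≤ E ∧ 384 * ((n : ℝ) + 1) * Real.exp (-E) ≤ δ / 2 ∧
      E ≤ 12 * (Real.log (max n 2 : ℕ) + Real.log (1 / δ)) := by
  have hx : (0 : ℝ) < 768 * (n + 1) := by positivity
  refine ⟨Real.log (768 * (n + 1) * (1 / δ)), ?_, ?_, ?_⟩
  · rw [Real.le_log_iff_exp_le (by positivity)]
    have h1 : (1 : ℝ) ≤ 1 / δ := by rw [le_div_iff₀ hδ0]; linarith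
    have h2 : (0 : ℝ) ≤ n := by positivity
    have h3 := Real.exp_one_lt_d9
    nlinarith
  · rw [Real.exp_neg, Real.exp_log (by positivity)]
    apply le_of_eq
    field_simp
    norm_num
  · have hN2 : (2 : ℝ) ≤ (max n 2 : ℕ) := by exact_mod_cast le_max_right n 2
    have hNn : (n : ℝ) ≤ (max n 2 : ℕ) := by exact_mod_cast le_max_left n 2
    set N : ℝ := ((max n 2 : ℕ) : ℝ)
    rw [Real.log_mul hx.ne' (by positivity)]
    have h1 : Real.log (768 * (n + 1)) ≤ 12 * Real.log N := by
      rw [show (12 : ℝ) * Real.log N = Real.log (N ^ 12) by rw [Real.log_pow]; norm_num]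
      refine Real.log_le_log hx ?_
      calc 768 * ((n : ℝ) + 1) ≤ 2 ^ 11 * N := by linarith
        _ ≤ N ^ 11 * N := by gcongr
        _ = N ^ 12 := by ring
    have h2 : 0 ≤ Real.log (1 / δ) := Real.log_nonneg (by rw [le_div_iff₀ hδ0]; linarith)
    linarith

/-- The learning guarantee: an output of the algorithm maximizes the empirical average over all
`s > 0`, and with probability at least `1 - δ` this average is within `ε / 4` of its mean for all `s`
at once. -/
theorem measure_not_learned_le (hU : IsSDPSolver U) (hUm : Measurable U) {ε δ : ℝ} {m : ℕ}
    (hD : ∀ᵐ A ∂D, IsInstance A)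
    (hH : ∀ᵐ A ∂D, ∀ (Z : Vec n) (s : ℝ), 0 < s → |slin U s A Z| ≤ H)
    (hε : 0 < ε) (hδ0 : 0 < δ) (hδ1 : δ ≤ 1) (hm : sampleSize 221184 H ε δ n ≤ m) :
    (Measure.pi fun _ : Fin m => D.prod (stdGaussian (Vec n)))
      {S : Sample m n | ¬ ∀ sHat : ℝ, IsERMOutput U S sHat →
        expCost U D sHat - (⨅ s : {s : ℝ // 0 < s}, expCost U D s) < ε} ≤ ENNReal.ofReal δ := by
  obtain ⟨X₀, hXsub, hXm, hX0⟩ := (hD.and hH).exists_measurable_mem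
  have hinst : ∀ A ∈ X₀, IsInstance A := fun A hA => (hX0 A hA).1
  have hX : ∀ A ∈ X₀, ∀ (Z : Vec n) (s : ℝ), 0 < s → |slin U s A Z| ≤ H :=
    fun A hA => (hX0 A hA).2
  have hX₀ : ∀ᵐ A ∂D, A ∈ X₀ := hXsub
  have hH0 : 0 ≤ H := by
    obtain ⟨A, hA⟩ := hX₀.exists
    exact (abs_nonneg _).trans (hX A hA 0 1 one_pos)
  set F : ℝ → ℝ := fun s => ∫ x, slinOn U X₀ s x ∂(D.prod (stdGaussian (Vec n))) with hF
  have hcost : ∀ s, 0 < s → expCost U D s = -F s := fun s hs =>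
    expCost_eq_integral hUm hXm hX₀ hH0 hX hs
  have : Nonempty {s : ℝ // 0 < s} := ⟨⟨1, one_pos⟩⟩
  -- it suffices to be within `ε / 2` of every parameter
  have hsuff : ∀ b, 0 < b → (∀ s, 0 < s → F s ≤ F b + ε / 2) →
      expCost U D b - (⨅ s : {s : ℝ // 0 < s}, expCost U D s) < ε := by
    intro b hb h
    have : expCost U D b - ε / 2 ≤ ⨅ s : {s : ℝ // 0 < s}, expCost U D s := by
      refine le_ciInf fun s => ?_
      rw [hcost b hb, hcost s s.2]
      linarith [h s s.2]
    linarith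
  have hae := ae_pi_fst_mem hX₀ m
  have hERM : ∀ S : Sample m n, (∀ i, (S i).1 ∈ X₀) → ∀ b, IsERMOutput U S b →
      0 < b ∧ ∀ s, 0 < s → empirical U S s ≤ empirical U S b := fun S hS b hb =>
    hb.pos_and_forall_le (fun i => hU _ (hinst _ (hS i))) fun i => hinst _ (hS i)
  rcases hH0.eq_or_lt with rfl | hH0
  · -- a bound `H = 0` makes all costs vanish, and any `m`, even `0`, is allowed
    have hF0 : ∀ s, 0 < s → F s = 0 := fun s hs => by
      have : ∀ x, slinOn U X₀ s x = 0 := fun x =>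
        abs_eq_zero.1 (le_antisymm (abs_slinOn_le le_rfl hX hs x) (abs_nonneg _))
      simp [hF, this]
    refine (le_of_eq (measure_mono_null (fun S hS => ?_) (ae_iff.1 hae))).trans zero_le
    rw [Set.mem_ofPred_eq] at hS ⊢
    contrapose! hS
    intro b hb
    obtain ⟨hb0, -⟩ := hERM S hS b hb
    refine hsuff b hb0 fun s hs => ?_
    rw [hF0 s hs, hF0 b hb0]; linarith
  · obtain ⟨E, hE1, hEδ, hEle⟩ := exists_log_bound n hδ0 hδ1
    have hsize : 221184 * H ^ 2 * (Real.log (max n 2 : ℕ) + Real.log (1 / δ)) ≤ m * ε ^ 2 := by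
      have h := mul_le_mul_of_nonneg_right hm (sq_nonneg ε)
      rw [sampleSize, div_pow] at h
      refine le_of_eq_of_le ?_ h
      field_simp
    have hmE : 1152 * H ^ 2 * E ≤ m * (ε / 4) ^ 2 := by
      nlinarith [mul_le_mul_of_nonneg_left hEle (sq_nonneg H)]
    have hm0 : 0 < m := by
      rcases Nat.eq_zero_or_pos m with rfl | h
      · have : 0 < 1152 * H ^ 2 * E := by positivity
        simp only [Nat.cast_zero, zero_mul] at hmE
        linarith
      · exact h
    have hm0' : (0 : ℝ) < m := by exact_mod_cast hm0
    have hdev := measure_not_forall_deviation_le (D := D) hUm hXm hH0 hX hm0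
      (show 0 < ε / 4 by positivity) hE1 hEδ (by linarith) hmE
    have h2 : 2 * ENNReal.ofReal (δ / 2) = ENNReal.ofReal δ := by
      rw [show (2 : ENNReal) = ENNReal.ofReal 2 by simp, ← ENNReal.ofReal_mul (by norm_num)]
      congr 1; ring
    rw [h2] at hdev
    have hunion := (measure_union_le _ _).trans (add_le_add hdev (ae_iff.1 hae).le)
    rw [add_zero] at hunion
    refine le_trans (measure_mono fun S hbad => ?_) hunion
    by_contra hgood
    rw [Set.mem_union, Set.mem_ofPred_eq, Set.mem_ofPred_eq, not_or, not_not, not_not] at hgood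
    obtain ⟨hgood, hS⟩ := hgood
    refine hbad fun b hb => ?_
    obtain ⟨hb0, hmax⟩ := hERM S hS b hb
    refine hsuff b hb0 fun s hs => ?_
    have hsum : ∀ t, ∑ i, slinOn U X₀ t (S i) = m * empirical U S t := by
      intro t
      rw [empirical, ← mul_assoc, mul_one_div_cancel hm0'.ne', one_mul]
      exact Finset.sum_congr rfl fun i _ => slinOn_of_mem (hS i)
    have e1 := abs_le.1 (hgood s hs)
    have e2 := abs_le.1 (hgood b hb0)
    rw [hsum] at e1 e2
    have e3 : m * empirical U S s ≤ m * empirical U S b :=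
      mul_le_mul_of_nonneg_left (hmax s hs) hm0'.le
    have e4 : m * F s ≤ m * (F b + ε / 2) := by
      simp only [hF]
      linarith [e1.1, e2.2]
    exact le_of_mul_le_mul_left e4 hm0'

end Learning

/-! ### Reasoning about programs: frame, loops, and cost -/

/-- `p.WritesNat z`: the register `z` is the target of some instruction of `p`. -/
def Prog.WritesNat (z : ℕ) : Prog → Prop
  | .natConst x _ => z = x
  | .natAdd x _ _ => z = x
  | .natSub x _ _ => z = x
  | .seq p q => p.WritesNat z ∨ q.WritesNat z
  | .ifNat _ _ p q => p.WritesNat z ∨ q.WritesNat z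
  | .ifReal _ _ p q => p.WritesNat z ∨ q.WritesNat z
  | .loop x _ p => z = x ∨ p.WritesNat z
  | _ => False

/-- `p.WritesReal a`: the array `a` is the target of some instruction of `p`. -/
def Prog.WritesReal (a : ℕ) : Prog → Prop
  | .realConst r _ => a = r.array
  | .arith _ r _ _ => a = r.array
  | .sdp _ _ _ dst => a = dst
  | .seq p q => p.WritesReal a ∨ q.WritesReal a
  | .ifNat _ _ p q => p.WritesReal a ∨ q.WritesReal a
  | .ifReal _ _ p q => p.WritesReal a ∨ q.WritesReal a
  | .loop _ _ p => p.WritesReal a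
  | _ => False

namespace State

@[simp] lemma tick_nats (σ : State) : σ.tick.nats = σ.nats := rfl
@[simp] lemma tick_reals (σ : State) : σ.tick.reals = σ.reals := rfl
@[simp] lemma tick_steps (σ : State) : σ.tick.steps = σ.steps + 1 := rfl
@[simp] lemma tick_calls (σ : State) : σ.tick.calls = σ.calls := rfl
@[simp] lemma setNat_nats (σ : State) (x v z : ℕ) :
    (σ.setNat x v).nats z = if z = x then v else σ.nats z := rfl
@[simp] lemma setNat_reals (σ : State) (x v : ℕ) : (σ.setNat x v).reals = σ.reals := rfl
@[simp] lemma setNat_steps (σ : State) (x v : ℕ) : (σ.setNat x v).steps = σ.steps := rfl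
@[simp] lemma setNat_calls (σ : State) (x v : ℕ) : (σ.setNat x v).calls = σ.calls := rfl
@[simp] lemma set_nats (σ : State) (r : Ref) (v : ℝ) : (σ.set r v).nats = σ.nats := rfl
@[simp] lemma set_steps (σ : State) (r : Ref) (v : ℝ) : (σ.set r v).steps = σ.steps := rfl
@[simp] lemma set_calls (σ : State) (r : Ref) (v : ℝ) : (σ.set r v).calls = σ.calls := rfl

lemma set_reals (σ : State) (r : Ref) (v : ℝ) (a i j k : ℕ) : (σ.set r v).reals a i j k =
    if a = r.array ∧ i = σ.nats r.i ∧ j = σ.nats r.j ∧ k = σ.nats r.k then v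
    else σ.reals a i j k := rfl

lemma set_reals_of_ne (σ : State) (r : Ref) (v : ℝ) {a : ℕ} (h : a ≠ r.array) :
    (σ.set r v).reals a = σ.reals a := by
  funext i j k
  simp [set_reals, h]

@[simp] lemma callSDP_nats (U : (d : ℕ) → Mat d → Fin d → Vec d) (σ : State) (d i s t : ℕ) :
    (σ.callSDP U d i s t).nats = σ.nats := rfl
@[simp] lemma callSDP_steps (U : (d : ℕ) → Mat d → Fin d → Vec d) (σ : State) (d i s t : ℕ) :
    (σ.callSDP U d i s t).steps = σ.steps := rfl
@[simp] lemma callSDP_calls (U : (d : ℕ) → Mat d → Fin d → Vec d) (σ : State) (d i s t : ℕ) :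
    (σ.callSDP U d i s t).calls = σ.calls + 1 := rfl

lemma callSDP_reals_of_ne (U : (d : ℕ) → Mat d → Fin d → Vec d) (σ : State) (d i s t : ℕ) {a : ℕ}
    (h : a ≠ t) : (σ.callSDP U d i s t).reals a = σ.reals a := by
  funext i' j k
  simp [callSDP, h]

end State

section Semantics

variable (U : (d : ℕ) → Mat d → Fin d → Vec d)

/-- Induction over the iterations of a loop. -/
lemma Prog.exec_loop_induct {x y : ℕ} {p : Prog} {σ : State} (I : ℕ → State → Prop)
    (h0 : I 0 σ.tick)
    (hstep : ∀ t < σ.nats y, ∀ τ, I t τ → I (t + 1) (p.exec U (τ.setNat x t).tick)) :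
    I (σ.nats y) ((Prog.loop x y p).exec U σ) := by
  have key : ∀ N ≤ σ.nats y,
      I N ((List.range N).foldl (fun τ t => p.exec U (τ.setNat x t).tick) σ.tick) := by
    intro N
    induction N with
    | zero => intro _; simpa using h0
    | succ N ih =>
      intro hN
      rw [List.range_succ, List.foldl_append]
      exact hstep N hN _ (ih (Nat.le_of_succ_le hN))
  exact key _ le_rfl

lemma Prog.exec_nats_of_not_writes {z : ℕ} (p : Prog) (σ : State) (h : ¬ p.WritesNat z) :
    (p.exec U σ).nats z = σ.nats z := by
  induction p generalizing σ with
  | skip => rfl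
  | natConst x c => simp only [WritesNat] at h; simp [exec, h]
  | natAdd x y w => simp only [WritesNat] at h; simp [exec, h]
  | natSub x y w => simp only [WritesNat] at h; simp [exec, h]
  | realConst r c => simp [exec]
  | arith op r r₁ r₂ => simp [exec]
  | sdp x y s d => simp [exec]
  | seq p q ihp ihq =>
    simp only [WritesNat, not_or] at h
    rw [exec, ihq _ h.2, ihp _ h.1]
  | ifNat x y p q ihp ihq =>
    simp only [WritesNat, not_or] at h
    rw [exec]
    split_ifs
    · exact ihp _ h.1
    · exact ihq _ h.2
  | ifReal x y p q ihp ihq =>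
    simp only [WritesNat, not_or] at h
    rw [exec]
    split_ifs
    · exact ihp _ h.1
    · exact ihq _ h.2
  | loop x y p ih =>
    simp only [WritesNat, not_or] at h
    refine exec_loop_induct U (fun _ τ => τ.nats z = σ.nats z) rfl fun t _ τ hτ => ?_
    rw [ih _ h.2]
    simpa [h.1] using hτ

lemma Prog.exec_reals_of_not_writes {a : ℕ} (p : Prog) (σ : State) (h : ¬ p.WritesReal a) :
    (p.exec U σ).reals a = σ.reals a := by
  induction p generalizing σ with
  | skip => rfl
  | natConst x c => rfl
  | natAdd x y w => rfl
  | natSub x y w => rfl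
  | realConst r c => exact State.set_reals_of_ne _ _ _ h
  | arith op r r₁ r₂ => exact State.set_reals_of_ne _ _ _ h
  | sdp x y s d => exact State.callSDP_reals_of_ne U _ _ _ _ _ h
  | seq p q ihp ihq =>
    simp only [WritesReal, not_or] at h
    rw [exec, ihq _ h.2, ihp _ h.1]
  | ifNat x y p q ihp ihq =>
    simp only [WritesReal, not_or] at h
    rw [exec]
    split_ifs
    · exact ihp _ h.1
    · exact ihq _ h.2
  | ifReal x y p q ihp ihq =>
    simp only [WritesReal, not_or] at h
    rw [exec]
    split_ifs
    · exact ihp _ h.1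
    · exact ihq _ h.2
  | loop x y p ih =>
    refine exec_loop_induct U (fun _ τ => τ.reals a = σ.reals a) rfl fun t _ τ hτ => ?_
    rw [ih _ h]
    exact hτ

/-- A loop whose body adds `f t` to an accumulator computes a sum. -/
lemma Prog.exec_loop_sum {M : Type*} [AddCommMonoid M] {x y : ℕ} {p : Prog} {σ : State}
    (acc : State → M) (Q : State → Prop) (f : ℕ → M) (hacc0 : acc σ.tick = acc σ) (hQ0 : Q σ.tick)
    (hQ : ∀ t < σ.nats y, ∀ τ, Q τ → Q (p.exec U (τ.setNat x t).tick))
    (hacc : ∀ t < σ.nats y, ∀ τ, Q τ → acc (p.exec U (τ.setNat x t).tick) = acc τ + f t) :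
    Q ((Prog.loop x y p).exec U σ) ∧
      acc ((Prog.loop x y p).exec U σ) = acc σ + ∑ t ∈ Finset.range (σ.nats y), f t := by
  refine Prog.exec_loop_induct U
    (fun t τ => Q τ ∧ acc τ = acc σ + ∑ t ∈ Finset.range t, f t) ⟨hQ0, by simpa using hacc0⟩ ?_
  rintro t ht τ ⟨hτ, hτ'⟩
  refine ⟨hQ t ht τ hτ, ?_⟩
  rw [hacc t ht τ hτ, hτ', Finset.sum_range_succ, add_assoc]

/-- The length of the text of a program; a loop head counts twice, for the initial step and for the
step that every iteration costs. -/
def Prog.size : Prog → ℕ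
  | .seq p q => p.size + q.size
  | .ifNat _ _ p q => p.size + q.size + 1
  | .ifReal _ _ p q => p.size + q.size + 1
  | .loop _ _ p => p.size + 2
  | _ => 1

/-- The nesting depth of loops. -/
def Prog.depth : Prog → ℕ
  | .seq p q => max p.depth q.depth
  | .ifNat _ _ p q => max p.depth q.depth
  | .ifReal _ _ p q => max p.depth q.depth
  | .loop _ _ p => p.depth + 1
  | _ => 0

/-- All loops run up to the content of one of the registers `0` and `1`. -/
def Prog.InputLoops : Prog → Prop
  | .seq p q => p.InputLoops ∧ q.InputLoops
  | .ifNat _ _ p q => p.InputLoops ∧ q.InputLoops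
  | .ifReal _ _ p q => p.InputLoops ∧ q.InputLoops
  | .loop _ y p => (y = 0 ∨ y = 1) ∧ p.InputLoops
  | _ => True

/-- An upper bound for the number of solver calls when the registers `0` and `1` hold `n`, `m`. -/
def Prog.callBound (n m : ℕ) : Prog → ℕ
  | .sdp _ _ _ _ => 1
  | .seq p q => p.callBound n m + q.callBound n m
  | .ifNat _ _ p q => p.callBound n m + q.callBound n m
  | .ifReal _ _ p q => p.callBound n m + q.callBound n m
  | .loop _ y p => (if y = 0 then n else m) * p.callBound n m
  | _ => 0

lemma size_mul_pow_add_le {a b N d e : ℕ} :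
    a * (N + 1) ^ d + b * (N + 1) ^ e ≤ (a + b) * (N + 1) ^ max d e := by
  rw [add_mul]
  gcongr
  · exact Nat.le_add_left _ _
  · exact le_max_left _ _
  · exact Nat.le_add_left _ _
  · exact le_max_right _ _

/-- A program whose loops are governed by the input sizes runs in polynomial time. -/
lemma Prog.exec_steps_le {N : ℕ} (p : Prog) (σ : State) (hp : p.InputLoops)
    (h0 : ¬ p.WritesNat 0) (h1 : ¬ p.WritesNat 1) (hn : σ.nats 0 ≤ N) (hm : σ.nats 1 ≤ N) :
    (p.exec U σ).steps ≤ σ.steps + p.size * (N + 1) ^ p.depth := by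
  induction p generalizing σ with
  | skip => simp [exec, size, depth]
  | natConst x c => simp [exec, size, depth]
  | natAdd x y w => simp [exec, size, depth]
  | natSub x y w => simp [exec, size, depth]
  | realConst r c => simp [exec, size, depth]
  | arith op r r₁ r₂ => simp [exec, size, depth]
  | sdp x y s d => simp [exec, size, depth]
  | seq p q ihp ihq =>
    simp only [WritesNat, not_or] at h0 h1
    have e1 := ihp σ hp.1 h0.1 h1.1 hn hm
    have e2 := ihq (p.exec U σ) hp.2 h0.2 h1.2 (by rwa [exec_nats_of_not_writes U p σ h0.1])
      (by rwa [exec_nats_of_not_writes U p σ h1.1])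
    have e3 := size_mul_pow_add_le (a := p.size) (b := q.size) (N := N) (d := p.depth) (e := q.depth)
    simp only [exec, size, depth]
    omega
  | ifNat x y p q ihp ihq =>
    simp only [WritesNat, not_or] at h0 h1
    have e1 := ihp σ.tick hp.1 h0.1 h1.1 hn hm
    have e2 := ihq σ.tick hp.2 h0.2 h1.2 hn hm
    have e3 := size_mul_pow_add_le (a := p.size) (b := q.size) (N := N) (d := p.depth) (e := q.depth)
    have e4 : 1 ≤ (N + 1) ^ max p.depth q.depth := Nat.one_le_pow _ _ (Nat.succ_pos _)
    simp only [exec, size, depth, State.tick_steps] at e1 e2 ⊢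
    rw [add_mul _ 1, one_mul]
    split_ifs <;> omega
  | ifReal x y p q ihp ihq =>
    simp only [WritesNat, not_or] at h0 h1
    have e1 := ihp σ.tick hp.1 h0.1 h1.1 hn hm
    have e2 := ihq σ.tick hp.2 h0.2 h1.2 hn hm
    have e3 := size_mul_pow_add_le (a := p.size) (b := q.size) (N := N) (d := p.depth) (e := q.depth)
    have e4 : 1 ≤ (N + 1) ^ max p.depth q.depth := Nat.one_le_pow _ _ (Nat.succ_pos _)
    simp only [exec, size, depth, State.tick_steps] at e1 e2 ⊢
    rw [add_mul _ 1, one_mul]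
    split_ifs <;> omega
  | loop x y p ih =>
    simp only [WritesNat, not_or] at h0 h1
    have hy : σ.nats y ≤ N := by rcases hp.1 with rfl | rfl <;> assumption
    have key := exec_loop_induct U (x := x) (y := y) (p := p) (σ := σ)
      (fun t τ => τ.nats 0 ≤ N ∧ τ.nats 1 ≤ N ∧
        τ.steps ≤ σ.steps + 1 + t * (1 + p.size * (N + 1) ^ p.depth))
      ⟨hn, hm, by simp⟩ (by
        rintro t _ τ ⟨a0, a1, a2⟩
        have b0 : (τ.setNat x t).tick.nats 0 ≤ N := by simpa [h0.1] using a0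
        have b1 : (τ.setNat x t).tick.nats 1 ≤ N := by simpa [h1.1] using a1
        refine ⟨by rwa [exec_nats_of_not_writes U p _ h0.2],
          by rwa [exec_nats_of_not_writes U p _ h1.2], ?_⟩
        have := ih (τ.setNat x t).tick hp.2 h0.2 h1.2 b0 b1
        simp only [State.tick_steps, State.setNat_steps] at this
        rw [add_mul t 1]
        omega)
    refine key.2.2.trans ?_
    simp only [size, depth]
    have e4 : 1 ≤ (N + 1) ^ p.depth := Nat.one_le_pow _ _ (Nat.succ_pos _)
    calc σ.steps + 1 + σ.nats y * (1 + p.size * (N + 1) ^ p.depth)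
        ≤ σ.steps + (1 * ((N + 1) ^ p.depth * (N + 1)) +
          N * ((N + 1) ^ p.depth + p.size * (N + 1) ^ p.depth)) := by
          rw [add_assoc]
          gcongr
          nlinarith
      _ ≤ _ := by
          rw [pow_succ]
          nlinarith

lemma Prog.exec_calls_le (p : Prog) (σ : State) (hp : p.InputLoops)
    (h0 : ¬ p.WritesNat 0) (h1 : ¬ p.WritesNat 1) :
    (p.exec U σ).calls ≤ σ.calls + p.callBound (σ.nats 0) (σ.nats 1) := by
  induction p generalizing σ with
  | skip => simp [exec]
  | natConst x c => simp [exec]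
  | natAdd x y w => simp [exec]
  | natSub x y w => simp [exec]
  | realConst r c => simp [exec]
  | arith op r r₁ r₂ => simp [exec]
  | sdp x y s d => simp [exec, callBound]
  | seq p q ihp ihq =>
    simp only [WritesNat, not_or] at h0 h1
    have e1 := ihp σ hp.1 h0.1 h1.1
    have e2 := ihq (p.exec U σ) hp.2 h0.2 h1.2
    rw [exec_nats_of_not_writes U p σ h0.1, exec_nats_of_not_writes U p σ h1.1] at e2
    simp only [exec, callBound]
    omega
  | ifNat x y p q ihp ihq =>
    simp only [WritesNat, not_or] at h0 h1
    have e1 := ihp σ.tick hp.1 h0.1 h1.1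
    have e2 := ihq σ.tick hp.2 h0.2 h1.2
    simp only [exec, callBound, State.tick_calls, State.tick_nats] at e1 e2 ⊢
    split_ifs <;> omega
  | ifReal x y p q ihp ihq =>
    simp only [WritesNat, not_or] at h0 h1
    have e1 := ihp σ.tick hp.1 h0.1 h1.1
    have e2 := ihq σ.tick hp.2 h0.2 h1.2
    simp only [exec, callBound, State.tick_calls, State.tick_nats] at e1 e2 ⊢
    split_ifs <;> omega
  | loop x y p ih =>
    simp only [WritesNat, not_or] at h0 h1
    have hy : σ.nats y = if y = 0 then σ.nats 0 else σ.nats 1 := by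
      rcases hp.1 with rfl | rfl <;> rfl
    have key := exec_loop_induct U (x := x) (y := y) (p := p) (σ := σ)
      (fun t τ => τ.nats 0 = σ.nats 0 ∧ τ.nats 1 = σ.nats 1 ∧
        τ.calls ≤ σ.calls + t * p.callBound (σ.nats 0) (σ.nats 1))
      ⟨rfl, rfl, by simp⟩ (by
        rintro t _ τ ⟨a0, a1, a2⟩
        have b0 : (τ.setNat x t).tick.nats 0 = σ.nats 0 := by simpa [h0.1] using a0
        have b1 : (τ.setNat x t).tick.nats 1 = σ.nats 1 := by simpa [h1.1] using a1
        refine ⟨by rwa [exec_nats_of_not_writes U p _ h0.2],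
          by rwa [exec_nats_of_not_writes U p _ h1.2], ?_⟩
        have := ih (τ.setNat x t).tick hp.2 h0.2 h1.2
        rw [b0, b1] at this
        simp only [State.tick_calls, State.setNat_calls] at this
        rw [add_mul t 1]
        omega)
    rw [callBound, ← hy]
    exact key.2.2

end Semantics

/-! ### The program -/

/-- The entry `(0, 0, 0)` of the array `a`, used as a real variable: register `2` is never assigned,
so that it holds `0`. -/
def sc (a : ℕ) : Ref := ⟨a, 2, 2, 2⟩

/-- Split the projection `src` at the cutoff in array `5` into its linear part (array `p`) and its
sign part (array `q`). -/
def splitProg (src : Ref) (p q : ℕ) : Prog :=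
  .ifReal (sc 5) src (.seq (.realConst (sc p) 0) (.realConst (sc q) 1))
    (.seq (.arith .sub (sc 13) (sc 20) (sc 5))
      (.ifReal src (sc 13) (.seq (.realConst (sc p) 0) (.realConst (sc q) (-1)))
        (.seq (.arith .add (sc p) src (sc 20)) (.realConst (sc q) 0))))

/-- Add `a_{jk} x y` to the variable `acc`, where the registers `6`, `7`, `8` address `a_{jk}`. -/
def macProg (acc x y : ℕ) : Prog :=
  .seq (.arith .mul (sc 14) ⟨0, 6, 7, 8⟩ (sc x))
    (.seq (.arith .mul (sc 14) (sc 14) (sc y)) (.arith .add (sc acc) (sc acc) (sc 14)))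

/-- Add the contributions of one matrix entry to the three coefficients in arrays `6`, `7`, `8`. -/
def entryProg : Prog :=
  .seq (splitProg ⟨4, 6, 7, 2⟩ 9 10) (.seq (splitProg ⟨4, 6, 8, 2⟩ 11 12)
    (.seq (macProg 6 9 11) (.seq (macProg 7 9 12) (.seq (macProg 7 10 11) (macProg 8 10 12)))))

/-- Compute the three coefficients of the empirical sum at the cutoff in array `5`. -/
def coeffProg : Prog :=
  .seq (.realConst (sc 6) 0) (.seq (.realConst (sc 7) 0) (.seq (.realConst (sc 8) 0)
    (.loop 6 1 (.loop 7 0 (.loop 8 0 entryProg)))))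

/-- Compute the coefficients and, in array `17`, the empirical sum at the cutoff in array `5`. -/
def evalProg : Prog :=
  .seq coeffProg (.seq (.arith .div (sc 17) (sc 6) (sc 5)) (.seq (.arith .add (sc 17) (sc 17) (sc 7))
    (.seq (.arith .div (sc 17) (sc 17) (sc 5)) (.arith .add (sc 17) (sc 17) (sc 8)))))

/-- Make the current cutoff the best parameter found so far (array `2`, value in array `16`). -/
def keepProg : Prog :=
  .seq (.arith .add (sc 2) (sc 5) (sc 20)) (.arith .add (sc 16) (sc 17) (sc 20))

/-- Replace the cutoff by the vertex of the parabola `α / s² + β / s + γ` given by the coefficients,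
which is at `s = -2 α / β`. If `β = 0` the result is `0`, and there is no vertex at any `s > 0`. -/
def vertexProg : Prog :=
  .seq (.arith .add (sc 14) (sc 6) (sc 6)) (.seq (.arith .sub (sc 14) (sc 20) (sc 14))
    (.arith .div (sc 5) (sc 14) (sc 7)))

/-- Examine the breakpoint in array `5`, and then the vertex of the parabola to its right. -/
def examineProg : Prog :=
  .seq evalProg (.seq (.ifReal (sc 17) (sc 16) .skip keepProg)
    (.seq vertexProg (.ifReal (sc 20) (sc 5)
      (.seq evalProg (.ifReal (sc 16) (sc 17) keepProg .skip)) .skip)))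

/-- Store the absolute value of the projection addressed by the registers `3`, `4` as the cutoff. -/
def absProg : Prog :=
  .ifReal ⟨4, 3, 4, 2⟩ (sc 20) (.arith .sub (sc 5) (sc 20) ⟨4, 3, 4, 2⟩)
    (.arith .add (sc 5) ⟨4, 3, 4, 2⟩ (sc 20))

/-- Compute the embedding of the instance number `3` and its projections on the Gaussian vector. -/
def projProg : Prog :=
  .seq (.sdp 0 3 0 3) (.loop 4 0 (.seq (.realConst ⟨4, 3, 4, 2⟩ 0)
    (.loop 5 0 (.seq (.arith .mul (sc 14) ⟨3, 3, 4, 5⟩ ⟨1, 3, 5, 2⟩)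
      (.arith .add ⟨4, 3, 4, 2⟩ ⟨4, 3, 4, 2⟩ (sc 14))))))

/-- Examine all breakpoints. -/
def searchProg : Prog :=
  .loop 3 1 (.loop 4 0 (.seq absProg (.ifReal (sc 20) (sc 5) examineProg .skip)))

/-- The whole program. Array `3` holds the embeddings and array `4` the projections. Of the
variables, `2` and `16` are the best parameter found so far and its value, `5` and `17` are the current cutoff
and its value, `6`, `7`, `8` are the coefficients, `9` to `14` are auxiliary, and `20` is never
assigned, so that it is `0`. -/
def ermProg : Prog :=
  .seq (.loop 3 1 projProg)
    (.seq (.realConst (sc 5) 1) (.seq evalProg (.seq keepProg searchProg)))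

/-! ### Correctness of the subroutines -/

/-- The value of the variable in array `a`. -/
def State.sv (σ : State) (a : ℕ) : ℝ := σ.reals a 0 0 0

/-- The data that is fixed during the search: sizes, matrices and projections. -/
structure Ctx (n m : ℕ) (A Y : ℕ → ℕ → ℕ → ℝ) (σ : State) : Prop where
  nat0 : σ.nats 0 = n
  nat1 : σ.nats 1 = m
  nat2 : σ.nats 2 = 0
  real0 : σ.reals 0 = A
  real4 : σ.reals 4 = Y
  real20 : σ.sv 20 = 0

section Subroutines

variable (U : (d : ℕ) → Mat d → Fin d → Vec d) {n m : ℕ} {A Y : ℕ → ℕ → ℕ → ℝ} {σ : State}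

lemma Ctx.tick (h : Ctx n m A Y σ) : Ctx n m A Y σ.tick :=
  ⟨h.nat0, h.nat1, h.nat2, h.real0, h.real4, h.real20⟩

lemma Ctx.setNat (h : Ctx n m A Y σ) {x v : ℕ} (hx : 3 ≤ x) : Ctx n m A Y (σ.setNat x v) := by
  refine ⟨?_, ?_, ?_, h.real0, h.real4, h.real20⟩ <;> rw [State.setNat_nats, if_neg (by omega)]
  exacts [h.nat0, h.nat1, h.nat2]

lemma Ctx.exec (h : Ctx n m A Y σ) (p : Prog)
    (hp : ¬ p.WritesNat 0 ∧ ¬ p.WritesNat 1 ∧ ¬ p.WritesNat 2 ∧ ¬ p.WritesReal 0 ∧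
      ¬ p.WritesReal 4 ∧ ¬ p.WritesReal 20) : Ctx n m A Y (p.exec U σ) := by
  obtain ⟨h0, h1, h2, h3, h4, h5⟩ := hp
  refine ⟨?_, ?_, ?_, ?_, ?_, ?_⟩
  · rw [Prog.exec_nats_of_not_writes U p σ h0, h.nat0]
  · rw [Prog.exec_nats_of_not_writes U p σ h1, h.nat1]
  · rw [Prog.exec_nats_of_not_writes U p σ h2, h.nat2]
  · rw [Prog.exec_reals_of_not_writes U p σ h3, h.real0]
  · rw [Prog.exec_reals_of_not_writes U p σ h4, h.real4]
  · rw [State.sv, Prog.exec_reals_of_not_writes U p σ h5, ← State.sv, h.real20]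

lemma Ctx.get_sc (h : Ctx n m A Y σ) (a : ℕ) : σ.get (sc a) = σ.sv a := by
  simp [State.get, sc, h.nat2, State.sv]

lemma Ctx.sv_set (h : Ctx n m A Y σ) (a b : ℕ) (v : ℝ) :
    (σ.set (sc a) v).sv b = if b = a then v else σ.sv b := by
  simp [State.sv, State.set_reals, sc, h.nat2]

lemma Ctx.set (h : Ctx n m A Y σ) {a : ℕ} (ha : a ≠ 0 ∧ a ≠ 4 ∧ a ≠ 20) (v : ℝ) :
    Ctx n m A Y (σ.set (sc a) v) := by
  refine ⟨h.nat0, h.nat1, h.nat2, ?_, ?_, ?_⟩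
  · rw [State.set_reals_of_ne _ _ _ (by simpa [sc] using ha.1.symm), h.real0]
  · rw [State.set_reals_of_ne _ _ _ (by simpa [sc] using ha.2.1.symm), h.real4]
  · rw [h.sv_set, if_neg ha.2.2.symm, h.real20]

lemma State.sv_exec_of_not_writes {a : ℕ} {p : Prog} (h : ¬ p.WritesReal a) :
    (p.exec U σ).sv a = σ.sv a := by
  rw [State.sv, Prog.exec_reals_of_not_writes U p σ h, State.sv]

@[simp] lemma State.sv_tick (a : ℕ) : σ.tick.sv a = σ.sv a := rfl
@[simp] lemma State.sv_setNat (a x v : ℕ) : (σ.setNat x v).sv a = σ.sv a := rfl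

lemma Ctx.get_real4 (h : Ctx n m A Y σ) (x y : ℕ) :
    σ.get ⟨4, x, y, 2⟩ = Y (σ.nats x) (σ.nats y) 0 := by
  simp [State.get, h.real4, h.nat2]

lemma Ctx.get_real0 (h : Ctx n m A Y σ) (x y z : ℕ) :
    σ.get ⟨0, x, y, z⟩ = A (σ.nats x) (σ.nats y) (σ.nats z) := by
  simp [State.get, h.real0]

/-- Verification rule for an assignment followed by a program. -/
lemma Ctx.arith_then (h : Ctx n m A Y σ) (op : Op) {a : ℕ} (ha : a ≠ 0 ∧ a ≠ 4 ∧ a ≠ 20)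
    (r₁ r₂ : Ref) {q : Prog} {P : State → Prop}
    (k : ∀ τ, Ctx n m A Y τ → τ.nats = σ.nats →
      (∀ b, τ.sv b = if b = a then op.eval (σ.get r₁) (σ.get r₂) else σ.sv b) → P (q.exec U τ)) :
    P ((Prog.seq (.arith op (sc a) r₁ r₂) q).exec U σ) :=
  k _ (h.set ha _).tick rfl fun b => h.sv_set a b _

/-- Verification rule for a final assignment. -/
lemma Ctx.arith_last (h : Ctx n m A Y σ) (op : Op) {a : ℕ} (ha : a ≠ 0 ∧ a ≠ 4 ∧ a ≠ 20)
    (r₁ r₂ : Ref) {P : State → Prop}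
    (k : ∀ τ, Ctx n m A Y τ → τ.nats = σ.nats →
      (∀ b, τ.sv b = if b = a then op.eval (σ.get r₁) (σ.get r₂) else σ.sv b) → P τ) :
    P ((Prog.arith op (sc a) r₁ r₂).exec U σ) :=
  k _ (h.set ha _).tick rfl fun b => h.sv_set a b _

/-- Verification rule for a constant assignment followed by a program. -/
lemma Ctx.realConst_then (h : Ctx n m A Y σ) {a : ℕ} (ha : a ≠ 0 ∧ a ≠ 4 ∧ a ≠ 20)
    (c : ℤ) {q : Prog} {P : State → Prop}
    (k : ∀ τ, Ctx n m A Y τ → τ.nats = σ.nats →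
      (∀ b, τ.sv b = if b = a then (c : ℝ) else σ.sv b) → P (q.exec U τ)) :
    P ((Prog.seq (.realConst (sc a) c) q).exec U σ) :=
  k _ (h.set ha _).tick rfl fun b => h.sv_set a b _

/-- Verification rule for a final constant assignment. -/
lemma Ctx.realConst_last (h : Ctx n m A Y σ) {a : ℕ} (ha : a ≠ 0 ∧ a ≠ 4 ∧ a ≠ 20)
    (c : ℤ) {P : State → Prop}
    (k : ∀ τ, Ctx n m A Y τ → τ.nats = σ.nats →
      (∀ b, τ.sv b = if b = a then (c : ℝ) else σ.sv b) → P τ) :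
    P ((Prog.realConst (sc a) c).exec U σ) :=
  k _ (h.set ha _).tick rfl fun b => h.sv_set a b _

/-- `splitProg` computes `lo` and `hi`. -/
lemma Ctx.exec_split (h : Ctx n m A Y σ) (x y : ℕ) {p q : ℕ} (hp : 9 ≤ p ∧ p < 13)
    (hq : 9 ≤ q ∧ q < 13) (hpq : q ≠ p) {P : State → Prop}
    (k : ∀ τ, Ctx n m A Y τ → τ.nats = σ.nats →
      τ.sv p = lo (σ.sv 5) (Y (σ.nats x) (σ.nats y) 0) →
      τ.sv q = hi (σ.sv 5) (Y (σ.nats x) (σ.nats y) 0) →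
      (∀ b, b ≠ p → b ≠ q → b ≠ 13 → τ.sv b = σ.sv b) → P τ) :
    P ((splitProg ⟨4, x, y, 2⟩ p q).exec U σ) := by
  have hp' : p ≠ 0 ∧ p ≠ 4 ∧ p ≠ 20 := by omega
  have hq' : q ≠ 0 ∧ q ≠ 4 ∧ q ≠ 20 := by omega
  rw [splitProg, Prog.exec, h.get_sc, h.get_real4]
  split_ifs with h1
  · refine h.tick.realConst_then U hp' 0 fun τ₁ c₁ n₁ v₁ => ?_
    refine c₁.realConst_last U hq' 1 fun τ₂ c₂ n₂ v₂ => ?_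
    refine k τ₂ c₂ (n₂.trans n₁) ?_ ?_ fun b hbp hbq _ => ?_
    · simp [v₂, v₁, hpq.symm, lo, h1]
    · simp [v₂, hi, h1]
    · simp [v₂, v₁, hbp, hbq]
  · refine h.tick.arith_then U .sub (by decide) _ _ fun τ₁ c₁ n₁ v₁ => ?_
    have e13 : τ₁.sv 13 = -σ.sv 5 := by
      simp [v₁, h.tick.get_sc, Op.eval, h.real20]
    rw [Prog.exec, c₁.get_sc, c₁.get_real4, e13, n₁, State.tick_nats]
    split_ifs with h2
    · refine c₁.tick.realConst_then U hp' 0 fun τ₂ c₂ n₂ v₂ => ?_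
      refine c₂.realConst_last U hq' (-1) fun τ₃ c₃ n₃ v₃ => ?_
      refine k τ₃ c₃ (n₃.trans (n₂.trans n₁)) ?_ ?_ fun b hbp hbq h13 => ?_
      · simp [v₃, v₂, hpq.symm, lo, h1, h2]
      · simp [v₃, hi, h1, h2]
      · simp [v₃, v₂, v₁, hbp, hbq, h13]
    · refine c₁.tick.arith_then U .add hp' _ _ fun τ₂ c₂ n₂ v₂ => ?_
      refine c₂.realConst_last U hq' 0 fun τ₃ c₃ n₃ v₃ => ?_
      refine k τ₃ c₃ (n₃.trans (n₂.trans n₁)) ?_ ?_ fun b hbp hbq h13 => ?_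
      · rw [v₃, if_neg hpq.symm, v₂, if_pos rfl, c₁.tick.get_real4, c₁.tick.get_sc, c₁.tick.real20]
        simp [lo, h1, h2, n₁, Op.eval]
      · simp [v₃, hi, h1, h2]
      · simp [v₃, v₂, v₁, hbp, hbq, h13]

lemma Ctx.exec_mac (h : Ctx n m A Y σ) {acc : ℕ} (x y : ℕ) (hacc : 5 < acc ∧ acc < 9)
    (hy : y ≠ 14) {P : State → Prop}
    (k : ∀ τ, Ctx n m A Y τ → τ.nats = σ.nats →
      τ.sv acc = σ.sv acc + A (σ.nats 6) (σ.nats 7) (σ.nats 8) * (σ.sv x * σ.sv y) →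
      (∀ b, b ≠ acc → b ≠ 14 → τ.sv b = σ.sv b) → P τ) :
    P ((macProg acc x y).exec U σ) := by
  have ha : acc ≠ 0 ∧ acc ≠ 4 ∧ acc ≠ 20 := by omega
  have ha14 : acc ≠ 14 := by omega
  refine h.arith_then U .mul (by decide) _ _ fun τ₁ c₁ n₁ v₁ => ?_
  refine c₁.arith_then U .mul (by decide) _ _ fun τ₂ c₂ n₂ v₂ => ?_
  refine c₂.arith_last U .add ha _ _ fun τ₃ c₃ n₃ v₃ => ?_
  refine k τ₃ c₃ (n₃.trans (n₂.trans n₁)) ?_ fun b hb hb14 => ?_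
  · rw [v₃, if_pos rfl, c₂.get_sc, c₂.get_sc, v₂, v₂, if_neg ha14, if_pos rfl, c₁.get_sc, c₁.get_sc,
      v₁, v₁, v₁, if_neg ha14, if_pos rfl, if_neg hy, h.get_real0, h.get_sc]
    simp [Op.eval, mul_assoc]
  · simp [v₃, v₂, v₁, hb, hb14]

/-- The contribution of the matrix entry `a_{ijk}` to the three coefficients at the cutoff `c`. -/
def contrib (A Y : ℕ → ℕ → ℕ → ℝ) (c : ℝ) (i j k : ℕ) : ℝ × ℝ × ℝ :=
  (A i j k * (lo c (Y i j 0) * lo c (Y i k 0)),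
    A i j k * (lo c (Y i j 0) * hi c (Y i k 0) + hi c (Y i j 0) * lo c (Y i k 0)),
    A i j k * (hi c (Y i j 0) * hi c (Y i k 0)))

/-- The three coefficients computed so far. -/
def State.coeffs (σ : State) : ℝ × ℝ × ℝ := (σ.sv 6, σ.sv 7, σ.sv 8)

lemma Ctx.exec_entry (h : Ctx n m A Y σ) :
    (entryProg.exec U σ).coeffs =
      σ.coeffs + contrib A Y (σ.sv 5) (σ.nats 6) (σ.nats 7) (σ.nats 8) := by
  rw [entryProg, Prog.exec]
  refine h.exec_split U 6 7 (p := 9) (q := 10) (by decide) (by decide) (by decide)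
    (P := fun τ => (Prog.exec U _ τ).coeffs = _) fun τ₁ c₁ n₁ p₁ q₁ v₁ => ?_
  rw [Prog.exec]
  refine c₁.exec_split U 6 8 (p := 11) (q := 12) (by decide) (by decide) (by decide)
    (P := fun τ => (Prog.exec U _ τ).coeffs = _) fun τ₂ c₂ n₂ p₂ q₂ v₂ => ?_
  rw [Prog.exec]
  refine c₂.exec_mac U (acc := 6) 9 11 (by decide) (by decide)
    (P := fun τ => (Prog.exec U _ τ).coeffs = _) fun τ₃ c₃ n₃ p₃ v₃ => ?_
  rw [Prog.exec]
  refine c₃.exec_mac U (acc := 7) 9 12 (by decide) (by decide)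
    (P := fun τ => (Prog.exec U _ τ).coeffs = _) fun τ₄ c₄ n₄ p₄ v₄ => ?_
  rw [Prog.exec]
  refine c₄.exec_mac U (acc := 7) 10 11 (by decide) (by decide)
    (P := fun τ => (Prog.exec U _ τ).coeffs = _) fun τ₅ c₅ n₅ p₅ v₅ => ?_
  refine c₅.exec_mac U (acc := 8) 10 12 (by decide) (by decide)
    (P := fun τ => τ.coeffs = _) fun τ₆ c₆ n₆ p₆ v₆ => ?_
  have hn : τ₂.nats = σ.nats := n₂.trans n₁
  have hn3 : τ₃.nats = σ.nats := n₃.trans hn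
  have hn4 : τ₄.nats = σ.nats := n₄.trans hn3
  have hn5 : τ₅.nats = σ.nats := n₅.trans hn4
  have e9 : τ₂.sv 9 = lo (σ.sv 5) (Y (σ.nats 6) (σ.nats 7) 0) := by
    rw [v₂ 9 (by decide) (by decide) (by decide), p₁]
  have e10 : τ₂.sv 10 = hi (σ.sv 5) (Y (σ.nats 6) (σ.nats 7) 0) := by
    rw [v₂ 10 (by decide) (by decide) (by decide), q₁]
  have e5 : τ₁.sv 5 = σ.sv 5 := v₁ 5 (by decide) (by decide) (by decide)
  rw [e5, n₁] at p₂ q₂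
  rw [hn, e9, p₂] at p₃
  rw [hn3, v₃ 9 (by decide) (by decide), v₃ 12 (by decide) (by decide), e9, q₂] at p₄
  rw [hn4, v₄ 10 (by decide) (by decide), v₄ 11 (by decide) (by decide),
    v₃ 10 (by decide) (by decide), v₃ 11 (by decide) (by decide), e10, p₂] at p₅
  rw [hn5, v₅ 10 (by decide) (by decide), v₅ 12 (by decide) (by decide),
    v₄ 10 (by decide) (by decide), v₄ 12 (by decide) (by decide),
    v₃ 10 (by decide) (by decide), v₃ 12 (by decide) (by decide), e10, q₂] at p₆
  simp only [State.coeffs, contrib, Prod.mk_add_mk, Prod.mk.injEq]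
  refine ⟨?_, ?_, ?_⟩
  · rw [v₆ 6 (by decide) (by decide), v₅ 6 (by decide) (by decide), v₄ 6 (by decide) (by decide), p₃,
      v₂ 6 (by decide) (by decide) (by decide), v₁ 6 (by decide) (by decide) (by decide)]
  · rw [v₆ 7 (by decide) (by decide), p₅, p₄, v₃ 7 (by decide) (by decide),
      v₂ 7 (by decide) (by decide) (by decide), v₁ 7 (by decide) (by decide) (by decide)]
    ring
  · rw [p₆, v₅ 8 (by decide) (by decide), v₄ 8 (by decide) (by decide), v₃ 8 (by decide) (by decide),
      v₂ 8 (by decide) (by decide) (by decide), v₁ 8 (by decide) (by decide) (by decide)]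

/-- The triple loop computes the three coefficients. -/
lemma Ctx.exec_coeffProg (h : Ctx n m A Y σ) :
    (coeffProg.exec U σ).coeffs = ∑ i ∈ Finset.range m, ∑ j ∈ Finset.range n,
      ∑ k ∈ Finset.range n, contrib A Y (σ.sv 5) i j k := by
  refine h.realConst_then U (by decide) 0 (P := fun τ => τ.coeffs = _) fun τ₁ c₁ n₁ v₁ => ?_
  refine c₁.realConst_then U (by decide) 0 (P := fun τ => τ.coeffs = _) fun τ₂ c₂ n₂ v₂ => ?_
  refine c₂.realConst_then U (by decide) 0 (P := fun τ => τ.coeffs = _) fun τ₃ c₃ n₃ v₃ => ?_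
  have z : τ₃.coeffs = 0 := by
    simp [State.coeffs, v₃, v₂, v₁]
  have z5 : τ₃.sv 5 = σ.sv 5 := by simp [v₃, v₂, v₁]
  set c := σ.sv 5
  -- the innermost loop
  have l8 : ∀ τ, Ctx n m A Y τ → τ.sv 5 = c → ((Prog.loop 8 0 entryProg).exec U τ).coeffs =
      τ.coeffs + ∑ k ∈ Finset.range n, contrib A Y c (τ.nats 6) (τ.nats 7) k := by
    intro τ hτ hc
    have := (Prog.exec_loop_sum U (x := 8) (y := 0) (p := entryProg) (σ := τ) State.coeffs
      (fun ρ => Ctx n m A Y ρ ∧ ρ.sv 5 = c ∧ ρ.nats 6 = τ.nats 6 ∧ ρ.nats 7 = τ.nats 7)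
      (fun k => contrib A Y c (τ.nats 6) (τ.nats 7) k) rfl ⟨hτ.tick, hc, rfl, rfl⟩ (by
        rintro k _ ρ ⟨h1, h2, h3, h4⟩
        refine ⟨((h1.setNat (by decide)).tick).exec U _ ?_, ?_, ?_, ?_⟩
        · simp [Prog.WritesNat, Prog.WritesReal, entryProg, splitProg, macProg, sc]
        · rw [State.sv_exec_of_not_writes]
          · simpa using h2
          · simp [Prog.WritesReal, entryProg, splitProg, macProg, sc]
        · rw [Prog.exec_nats_of_not_writes]
          · simpa using h3
          · simp [Prog.WritesNat, entryProg, splitProg, macProg]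
        · rw [Prog.exec_nats_of_not_writes]
          · simpa using h4
          · simp [Prog.WritesNat, entryProg, splitProg, macProg]) (by
        rintro k _ ρ ⟨h1, h2, h3, h4⟩
        rw [((h1.setNat (x := 8) (v := k) (by decide)).tick).exec_entry U]
        simp [h2, h3, h4]
        rfl)).2
    rwa [hτ.nat0] at this
  have l7 : ∀ τ, Ctx n m A Y τ → τ.sv 5 = c →
      ((Prog.loop 7 0 (.loop 8 0 entryProg)).exec U τ).coeffs =
      τ.coeffs + ∑ j ∈ Finset.range n, ∑ k ∈ Finset.range n, contrib A Y c (τ.nats 6) j k := by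
    intro τ hτ hc
    have := (Prog.exec_loop_sum U (x := 7) (y := 0) (p := .loop 8 0 entryProg) (σ := τ) State.coeffs
      (fun ρ => Ctx n m A Y ρ ∧ ρ.sv 5 = c ∧ ρ.nats 6 = τ.nats 6)
      (fun j => ∑ k ∈ Finset.range n, contrib A Y c (τ.nats 6) j k) rfl ⟨hτ.tick, hc, rfl⟩ (by
        rintro k _ ρ ⟨h1, h2, h3⟩
        refine ⟨((h1.setNat (by decide)).tick).exec U _ ?_, ?_, ?_⟩
        · simp [Prog.WritesNat, Prog.WritesReal, entryProg, splitProg, macProg, sc]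
        · rw [State.sv_exec_of_not_writes]
          · simpa using h2
          · simp [Prog.WritesReal, entryProg, splitProg, macProg, sc]
        · rw [Prog.exec_nats_of_not_writes]
          · simpa using h3
          · simp [Prog.WritesNat, entryProg, splitProg, macProg]) (by
        rintro k _ ρ ⟨h1, h2, h3⟩
        rw [l8 _ ((h1.setNat (x := 7) (v := k) (by decide)).tick) (by simpa using h2)]
        simp [h3]
        rfl)).2
    rwa [hτ.nat0] at this
  have := (Prog.exec_loop_sum U (x := 6) (y := 1) (p := .loop 7 0 (.loop 8 0 entryProg)) (σ := τ₃)
    State.coeffs (fun ρ => Ctx n m A Y ρ ∧ ρ.sv 5 = c)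
    (fun i => ∑ j ∈ Finset.range n, ∑ k ∈ Finset.range n, contrib A Y c i j k) rfl ⟨c₃.tick, z5⟩ (by
      rintro k _ ρ ⟨h1, h2⟩
      refine ⟨((h1.setNat (by decide)).tick).exec U _ ?_, ?_⟩
      · simp [Prog.WritesNat, Prog.WritesReal, entryProg, splitProg, macProg, sc]
      · rw [State.sv_exec_of_not_writes]
        · simpa using h2
        · simp [Prog.WritesReal, entryProg, splitProg, macProg, sc]) (by
      rintro k _ ρ ⟨h1, h2⟩
      rw [l7 _ ((h1.setNat (x := 6) (v := k) (by decide)).tick) (by simpa using h2)]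
      simp
      rfl)).2
  rwa [c₃.nat1, z, zero_add] at this

/-- The empirical sum at the cutoff `c`, as it is computed from the coefficients. -/
def valueAt (m n : ℕ) (A Y : ℕ → ℕ → ℕ → ℝ) (c : ℝ) : ℝ :=
  let S := ∑ i ∈ Finset.range m, ∑ j ∈ Finset.range n, ∑ k ∈ Finset.range n, contrib A Y c i j k
  (S.1 / c + S.2.1) / c + S.2.2

/-- The vertex of the parabola to the right of the cutoff `c`, as it is computed from the
coefficients. -/
def vertexAt (m n : ℕ) (A Y : ℕ → ℕ → ℕ → ℝ) (c : ℝ) : ℝ :=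
  let S := ∑ i ∈ Finset.range m, ∑ j ∈ Finset.range n, ∑ k ∈ Finset.range n, contrib A Y c i j k
  (0 - (S.1 + S.1)) / S.2.1

lemma Ctx.exec_eval (h : Ctx n m A Y σ) {P : State → Prop}
    (k : ∀ τ, Ctx n m A Y τ → τ.nats 3 = σ.nats 3 → τ.nats 4 = σ.nats 4 →
      τ.sv 17 = valueAt m n A Y (σ.sv 5) →
      τ.coeffs = ∑ i ∈ Finset.range m, ∑ j ∈ Finset.range n, ∑ k ∈ Finset.range n,
        contrib A Y (σ.sv 5) i j k →
      τ.sv 2 = σ.sv 2 → τ.sv 5 = σ.sv 5 → τ.sv 16 = σ.sv 16 → P τ) :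
    P (evalProg.exec U σ) := by
  have hc := h.exec_coeffProg U
  have hctx : Ctx n m A Y (coeffProg.exec U σ) := h.exec U _ (by
    simp [Prog.WritesNat, Prog.WritesReal, coeffProg, entryProg, splitProg, macProg, sc])
  have h3 : (coeffProg.exec U σ).nats 3 = σ.nats 3 := Prog.exec_nats_of_not_writes U _ _ (by
    simp [Prog.WritesNat, coeffProg, entryProg, splitProg, macProg])
  have h4 : (coeffProg.exec U σ).nats 4 = σ.nats 4 := Prog.exec_nats_of_not_writes U _ _ (by
    simp [Prog.WritesNat, coeffProg, entryProg, splitProg, macProg])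
  have s2 : (coeffProg.exec U σ).sv 2 = σ.sv 2 := State.sv_exec_of_not_writes U (by
    simp [Prog.WritesReal, coeffProg, entryProg, splitProg, macProg, sc])
  have s5 : (coeffProg.exec U σ).sv 5 = σ.sv 5 := State.sv_exec_of_not_writes U (by
    simp [Prog.WritesReal, coeffProg, entryProg, splitProg, macProg, sc])
  have s16 : (coeffProg.exec U σ).sv 16 = σ.sv 16 := State.sv_exec_of_not_writes U (by
    simp [Prog.WritesReal, coeffProg, entryProg, splitProg, macProg, sc])
  rw [evalProg, Prog.exec]
  generalize coeffProg.exec U σ = ρ at *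
  refine hctx.arith_then U .div (by decide) _ _ fun τ₁ c₁ n₁ v₁ => ?_
  refine c₁.arith_then U .add (by decide) _ _ fun τ₂ c₂ n₂ v₂ => ?_
  refine c₂.arith_then U .div (by decide) _ _ fun τ₃ c₃ n₃ v₃ => ?_
  refine c₃.arith_last U .add (by decide) _ _ fun τ₄ c₄ n₄ v₄ => ?_
  have hn : τ₄.nats = ρ.nats := n₄.trans (n₃.trans (n₂.trans n₁))
  refine k τ₄ c₄ (by rw [hn, h3]) (by rw [hn, h4]) ?_ ?_ ?_ ?_ ?_
  · rw [valueAt, ← hc]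
    simp [v₄, c₃.get_sc, v₃, c₂.get_sc, v₂, c₁.get_sc, v₁, hctx.get_sc, Op.eval, State.coeffs, s5]
  · rw [← hc]
    simp [State.coeffs, v₄, v₃, v₂, v₁]
  · simp [v₄, v₃, v₂, v₁, s2]
  · simp [v₄, v₃, v₂, v₁, s5]
  · simp [v₄, v₃, v₂, v₁, s16]

end Subroutines

/-! ### The search for the best parameter -/

/-- One step of the search: the breakpoint `t` replaces `b` unless it is worse, and then the vertex
`V t` replaces the result if it is strictly better. -/
def nextBest (W V : ℝ → ℝ) (t b : ℝ) : ℝ :=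
  let b' := if W t < W b then b else t
  if 0 < V t then (if W b' < W (V t) then V t else b') else b'

/-- The invariant of the search with breakpoints `T`, of which those in `P` have been examined. -/
structure IsBest (W V : ℝ → ℝ) (T P : Set ℝ) (b : ℝ) : Prop where
  pos : 0 < b
  mem_or_lt : b ∈ T ∨ ∀ t ∈ P, W t < W b
  le : ∀ t ∈ P, W t ≤ W b
  vertex_le : ∀ t ∈ P, 0 < V t → W (V t) ≤ W b

lemma IsBest.mono {W V : ℝ → ℝ} {T P P' : Set ℝ} {b : ℝ} (h : IsBest W V T P b) (hP : P' ⊆ P) :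
    IsBest W V T P' b :=
  ⟨h.pos, h.mem_or_lt.imp_right fun h t ht => h t (hP ht), fun t ht => h.le t (hP ht),
    fun t ht => h.vertex_le t (hP ht)⟩

lemma IsBest.next {W V : ℝ → ℝ} {T P : Set ℝ} {b t : ℝ} (h : IsBest W V T P b) (ht : t ∈ T)
    (ht0 : 0 < t) : IsBest W V T (insert t P) (nextBest W V t b) := by
  -- after the comparison with `t`
  have h1 : 0 < (if W t < W b then b else t) ∧
      ((if W t < W b then b else t) ∈ T ∨
        ∀ r ∈ insert t P, W r < W (if W t < W b then b else t)) ∧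
      (∀ r ∈ insert t P, W r ≤ W (if W t < W b then b else t)) ∧
      ∀ r ∈ P, 0 < V r → W (V r) ≤ W (if W t < W b then b else t) := by
    split_ifs with hlt
    · refine ⟨h.pos, h.mem_or_lt.imp_right fun h' r hr => ?_, fun r hr => ?_, h.vertex_le⟩
      · rcases hr with rfl | hr
        exacts [hlt, h' r hr]
      · rcases hr with rfl | hr
        exacts [hlt.le, h.le r hr]
    · rw [not_lt] at hlt
      refine ⟨ht0, Or.inl ht, fun r hr => ?_, fun r hr hV => (h.vertex_le r hr hV).trans hlt⟩
      rcases hr with rfl | hr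
      exacts [le_rfl, (h.le r hr).trans hlt]
  rw [nextBest]
  generalize (if W t < W b then b else t) = b' at h1
  obtain ⟨g1, g2, g3, g4⟩ := h1
  split_ifs with hV hlt
  · refine ⟨hV, Or.inr fun r hr => (g3 r hr).trans_lt hlt, fun r hr => (g3 r hr).trans hlt.le, ?_⟩
    rintro r (rfl | hr) hr0
    exacts [le_rfl, (g4 r hr hr0).trans hlt.le]
  · refine ⟨g1, g2, g3, ?_⟩
    rintro r (rfl | hr) hr0
    exacts [not_lt.1 hlt, g4 r hr hr0]
  · refine ⟨g1, g2, g3, ?_⟩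
    rintro r (rfl | hr) hr0
    exacts [(hV hr0).elim, g4 r hr hr0]

section Search

variable (U : (d : ℕ) → Mat d → Fin d → Vec d) {n m : ℕ} {A Y : ℕ → ℕ → ℕ → ℝ} {σ : State}

lemma Ctx.exec_keep (h : Ctx n m A Y σ) {P : State → Prop}
    (k : ∀ τ, Ctx n m A Y τ → τ.nats = σ.nats → τ.sv 2 = σ.sv 5 → τ.sv 16 = σ.sv 17 →
      (∀ b, b ≠ 2 → b ≠ 16 → τ.sv b = σ.sv b) → P τ) : P (keepProg.exec U σ) := by
  refine h.arith_then U .add (by decide) _ _ fun τ₁ c₁ n₁ v₁ => ?_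
  refine c₁.arith_last U .add (by decide) _ _ fun τ₂ c₂ n₂ v₂ => ?_
  refine k τ₂ c₂ (n₂.trans n₁) ?_ ?_ fun b h2 h16 => ?_
  · simp [v₂, v₁, h.get_sc, h.real20, Op.eval]
  · simp [v₂, v₁, c₁.get_sc, h.real20, Op.eval]
  · simp [v₂, v₁, h2, h16]

lemma Ctx.exec_vertex (h : Ctx n m A Y σ) {P : State → Prop}
    (k : ∀ τ, Ctx n m A Y τ → τ.nats = σ.nats →
      τ.sv 5 = (0 - (σ.sv 6 + σ.sv 6)) / σ.sv 7 →
      (∀ b, b ≠ 5 → b ≠ 14 → τ.sv b = σ.sv b) → P τ) : P (vertexProg.exec U σ) := by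
  refine h.arith_then U .add (by decide) _ _ fun τ₁ c₁ n₁ v₁ => ?_
  refine c₁.arith_then U .sub (by decide) _ _ fun τ₂ c₂ n₂ v₂ => ?_
  refine c₂.arith_last U .div (by decide) _ _ fun τ₃ c₃ n₃ v₃ => ?_
  refine k τ₃ c₃ (n₃.trans (n₂.trans n₁)) ?_ fun b h5 h14 => ?_
  · simp [v₃, v₂, v₁, h.get_sc, c₁.get_sc, c₂.get_sc, h.real20, Op.eval]
  · simp [v₃, v₂, v₁, h5, h14]

lemma Ctx.exec_examine (h : Ctx n m A Y σ) (hb : σ.sv 16 = valueAt m n A Y (σ.sv 2))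
    {P : State → Prop}
    (k : ∀ τ, Ctx n m A Y τ → τ.nats 3 = σ.nats 3 → τ.nats 4 = σ.nats 4 →
      τ.sv 16 = valueAt m n A Y (τ.sv 2) →
      τ.sv 2 = nextBest (valueAt m n A Y) (vertexAt m n A Y) (σ.sv 5) (σ.sv 2) → P τ) :
    P (examineProg.exec U σ) := by
  set W := valueAt m n A Y with hW
  set V := vertexAt m n A Y with hV
  set t := σ.sv 5 with ht
  obtain ⟨R, hR⟩ : ∃ R, R = Prog.seq vertexProg (.ifReal (sc 20) (sc 5)
      (.seq evalProg (.ifReal (sc 16) (sc 17) keepProg .skip)) .skip) := ⟨_, rfl⟩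
  rw [examineProg, ← hR, Prog.exec]
  refine h.exec_eval U (P := fun τ => P (Prog.exec U _ τ)) fun τ₁ c₁ i₁ j₁ h17 hco h2 h5 h16 => ?_
  rw [Prog.exec]
  -- the state after the comparison with the breakpoint
  have key : ∀ ρ : State, Ctx n m A Y ρ → ρ.nats 3 = σ.nats 3 → ρ.nats 4 = σ.nats 4 →
      ρ.coeffs = τ₁.coeffs → ρ.sv 2 = (if W t < W (σ.sv 2) then σ.sv 2 else t) →
      ρ.sv 16 = W (ρ.sv 2) → P (Prog.exec U R ρ) := by
    intro ρ c i j hρ hρ2 hρ16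
    rw [hR, Prog.exec]
    refine c.exec_vertex U (P := fun τ => P (Prog.exec U _ τ)) fun τ₂ c₂ n₂ p₂ v₂ => ?_
    have hv : τ₂.sv 5 = V t := by
      rw [hco] at hρ
      rw [p₂, hV, vertexAt, ← hρ, State.coeffs]
    have h22 : τ₂.sv 2 = ρ.sv 2 := v₂ 2 (by decide) (by decide)
    have h216 : τ₂.sv 16 = ρ.sv 16 := v₂ 16 (by decide) (by decide)
    rw [Prog.exec, c₂.get_sc, c₂.get_sc, c₂.real20, hv]
    split_ifs with hpos
    · rw [Prog.exec]
      refine c₂.tick.exec_eval U (P := fun τ => P (Prog.exec U _ τ))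
        fun τ₃ c₃ i₃ j₃ q17 _ q2 q5 q16 => ?_
      rw [State.sv_tick, hv, ← hW] at q17
      have i3 : τ₃.nats 3 = σ.nats 3 := by rw [i₃, State.tick_nats, n₂, i]
      have j3 : τ₃.nats 4 = σ.nats 4 := by rw [j₃, State.tick_nats, n₂, j]
      have q2' : τ₃.sv 2 = ρ.sv 2 := by rw [q2, State.sv_tick, h22]
      have q16' : τ₃.sv 16 = W (ρ.sv 2) := by rw [q16, State.sv_tick, h216, hρ16]
      rw [Prog.exec, c₃.get_sc, c₃.get_sc, q17, q16']
      split_ifs with hlt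
      · refine c₃.tick.exec_keep U fun τ₄ c₄ n₄ r2 r16 _ => ?_
        have r2' : τ₄.sv 2 = V t := by rw [r2, State.sv_tick, q5, State.sv_tick, hv]
        refine k τ₄ c₄ (by rw [n₄, State.tick_nats, i3]) (by rw [n₄, State.tick_nats, j3]) ?_ ?_
        · rw [r16, r2', State.sv_tick, q17]
        · rw [r2', nextBest, ← hρ2, if_pos hpos, if_pos hlt]
      · refine k _ c₃.tick.tick i3 j3 ?_ ?_
        · change τ₃.sv 16 = W (τ₃.sv 2)
          rw [q16', q2']
        · change τ₃.sv 2 = _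
          rw [q2', nextBest, ← hρ2, if_pos hpos, if_neg hlt]
    · refine k _ c₂.tick.tick ((congrFun n₂ 3).trans i) ((congrFun n₂ 4).trans j) ?_ ?_
      · change τ₂.sv 16 = W (τ₂.sv 2)
        rw [h216, h22, hρ16]
      · change τ₂.sv 2 = _
        rw [h22, nextBest, ← hρ2, if_neg hpos]
  rw [Prog.exec, c₁.get_sc, c₁.get_sc, h17, h16, hb]
  split_ifs with hlt
  · refine key _ c₁.tick.tick i₁ j₁ rfl ?_ ?_
    · change τ₁.sv 2 = _
      rw [h2, if_pos hlt]
    · change τ₁.sv 16 = W (τ₁.sv 2)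
      rw [h16, h2, hb]
  · refine c₁.tick.exec_keep U (P := fun τ => P (Prog.exec U _ τ)) fun τ₂ c₂ n₂ r2 r16 v => ?_
    have r2' : τ₂.sv 2 = t := by rw [r2, State.sv_tick, h5]
    refine key τ₂ c₂ (by rw [n₂, State.tick_nats, i₁]) (by rw [n₂, State.tick_nats, j₁]) ?_ ?_ ?_
    · simp [State.coeffs, v]
    · rw [r2', if_neg hlt]
    · rw [r16, State.sv_tick, h17, r2']

lemma Ctx.exec_abs (h : Ctx n m A Y σ) {P : State → Prop}
    (k : ∀ τ, Ctx n m A Y τ → τ.nats = σ.nats → τ.sv 5 = |Y (σ.nats 3) (σ.nats 4) 0| →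
      (∀ b, b ≠ 5 → τ.sv b = σ.sv b) → P τ) : P (absProg.exec U σ) := by
  rw [absProg, Prog.exec, h.get_real4, h.get_sc, h.real20]
  split_ifs with hlt
  · refine h.tick.arith_last U .sub (by decide) _ _ fun τ₁ c₁ n₁ v₁ => ?_
    refine k τ₁ c₁ n₁ ?_ fun b hb => by simp [v₁, hb]
    rw [v₁, if_pos rfl, h.tick.get_sc, h.tick.real20, h.tick.get_real4, abs_of_neg hlt]
    simp [Op.eval]
  · refine h.tick.arith_last U .add (by decide) _ _ fun τ₁ c₁ n₁ v₁ => ?_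
    refine k τ₁ c₁ n₁ ?_ fun b hb => by simp [v₁, hb]
    rw [v₁, if_pos rfl, h.tick.get_sc, h.tick.real20, h.tick.get_real4, abs_of_nonneg (not_lt.1 hlt)]
    simp [Op.eval]

/-- The breakpoints that come from the indices in `I`. -/
def breakpoints (Y : ℕ → ℕ → ℕ → ℝ) (I : ℕ → ℕ → Prop) : Set ℝ :=
  {t | 0 < t ∧ ∃ i j, I i j ∧ t = |Y i j 0|}

lemma breakpoints_mono {I J : ℕ → ℕ → Prop} (h : ∀ i j, I i j → J i j) :
    breakpoints Y I ⊆ breakpoints Y J := fun _ ⟨h0, i, j, hI, ht⟩ => ⟨h0, i, j, h i j hI, ht⟩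

/-- The search preserves the invariant, and at its end all breakpoints have been examined. -/
lemma Ctx.exec_search (h : Ctx n m A Y σ) (hb : σ.sv 16 = valueAt m n A Y (σ.sv 2))
    (h0 : 0 < σ.sv 2) :
    IsBest (valueAt m n A Y) (vertexAt m n A Y) (breakpoints Y fun i j => i < m ∧ j < n)
      (breakpoints Y fun i j => i < m ∧ j < n) ((searchProg.exec U σ).sv 2) := by
  set W := valueAt m n A Y with hW
  set V := vertexAt m n A Y with hV
  set T := breakpoints Y fun i j => i < m ∧ j < n with hT
  have inner : ∀ i < m, ∀ ρ, Ctx n m A Y ρ → ρ.nats 3 = i → ρ.sv 16 = W (ρ.sv 2) →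
      IsBest W V T (breakpoints Y fun i' j' => i' < i ∧ j' < n) (ρ.sv 2) →
      (fun τ : State => Ctx n m A Y τ ∧ τ.sv 16 = W (τ.sv 2) ∧
        IsBest W V T (breakpoints Y fun i' j' => i' < i + 1 ∧ j' < n) (τ.sv 2))
      (Prog.exec U (.loop 4 0 (.seq absProg (.ifReal (sc 20) (sc 5) examineProg .skip))) ρ) := by
    intro i hi ρ c hρi hρ hρB
    have key := Prog.exec_loop_induct U (x := 4) (y := 0) (σ := ρ)
      (p := .seq absProg (.ifReal (sc 20) (sc 5) examineProg .skip))
      (fun j τ => Ctx n m A Y τ ∧ τ.nats 3 = i ∧ τ.sv 16 = W (τ.sv 2) ∧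
        IsBest W V T (breakpoints Y fun i' j' => (i' < i ∧ j' < n) ∨ (i' = i ∧ j' < j)) (τ.sv 2))
      ⟨c.tick, hρi, hρ, hρB.mono (breakpoints_mono fun _ _ h => by
        rcases h with h | ⟨-, h⟩
        · exact h
        · exact absurd h (Nat.not_lt_zero _))⟩ (by
        rintro j hj τ ⟨ct, hti, h16, hB⟩
        rw [c.nat0] at hj
        rw [Prog.exec]
        refine ((ct.setNat (x := 4) (v := j) (by decide)).tick).exec_abs U
          (P := fun τ' => (fun τ : State => Ctx n m A Y τ ∧ τ.nats 3 = i ∧ τ.sv 16 = W (τ.sv 2) ∧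
            IsBest W V T (breakpoints Y fun i' j' => (i' < i ∧ j' < n) ∨ (i' = i ∧ j' < j + 1))
              (τ.sv 2)) (Prog.exec U _ τ')) fun τ₁ c₁ n₁ p₁ v₁ => ?_
        have e3 : τ₁.nats 3 = i := by rw [n₁]; simpa using hti
        have e2 : τ₁.sv 2 = τ.sv 2 := by rw [v₁ 2 (by decide)]; simp
        have e16 : τ₁.sv 16 = W (τ₁.sv 2) := by
          rw [e2, ← h16, v₁ 16 (by decide)]; simp
        have e5 : τ₁.sv 5 = |Y i j 0| := by rw [p₁]; simp [hti]
        have hnew : ∀ s ∈ breakpoints Y fun i' j' => (i' < i ∧ j' < n) ∨ (i' = i ∧ j' < j + 1),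
            s = |Y i j 0| ∨
            s ∈ breakpoints Y fun i' j' => (i' < i ∧ j' < n) ∨ (i' = i ∧ j' < j) := by
          rintro s ⟨s0, i', j', hij, rfl⟩
          rcases hij with hij | ⟨rfl, hj'⟩
          · exact Or.inr ⟨s0, i', j', Or.inl hij, rfl⟩
          · rcases (Nat.lt_succ_iff.1 hj').lt_or_eq with hlt | rfl
            · exact Or.inr ⟨s0, i', j', Or.inr ⟨rfl, hlt⟩, rfl⟩
            · exact Or.inl rfl
        rw [Prog.exec, c₁.get_sc, c₁.get_sc, c₁.real20, e5]
        split_ifs with hpos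
        · refine c₁.tick.exec_examine U e16 (P := fun τ : State => Ctx n m A Y τ ∧ τ.nats 3 = i ∧
            τ.sv 16 = W (τ.sv 2) ∧ IsBest W V T
              (breakpoints Y fun i' j' => (i' < i ∧ j' < n) ∨ (i' = i ∧ j' < j + 1)) (τ.sv 2))
            fun τ₂ c₂ i₂ _ q16 q2 => ⟨c₂, i₂.trans e3, q16, ?_⟩
          rw [q2, State.sv_tick, State.sv_tick, e5, e2]
          exact (hB.next ⟨hpos, i, j, ⟨hi, hj⟩, rfl⟩ hpos).mono hnew
        · refine ⟨c₁.tick.tick, e3, e16, ?_⟩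
          change IsBest W V T _ (τ₁.sv 2)
          rw [e2]
          refine hB.mono fun s hs => ?_
          rcases hnew s hs with rfl | hs'
          · exact (hpos hs.1).elim
          · exact hs')
    rw [c.nat0] at key
    refine ⟨key.1, key.2.2.1, key.2.2.2.mono (breakpoints_mono fun i' j' h => ?_)⟩
    rcases (Nat.lt_succ_iff.1 h.1).lt_or_eq with h1 | h1
    · exact Or.inl ⟨h1, h.2⟩
    · exact Or.inr ⟨h1, h.2⟩
  have key := Prog.exec_loop_induct U (x := 3) (y := 1) (σ := σ)
    (p := .loop 4 0 (.seq absProg (.ifReal (sc 20) (sc 5) examineProg .skip)))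
    (fun i τ => Ctx n m A Y τ ∧ τ.sv 16 = W (τ.sv 2) ∧
      IsBest W V T (breakpoints Y fun i' j' => i' < i ∧ j' < n) (τ.sv 2))
    ⟨h.tick, hb, h0, Or.inr fun t ⟨_, i, j, hij, _⟩ => absurd hij.1 (Nat.not_lt_zero _),
      fun t ⟨_, i, j, hij, _⟩ => absurd hij.1 (Nat.not_lt_zero _),
      fun t ⟨_, i, j, hij, _⟩ => absurd hij.1 (Nat.not_lt_zero _)⟩ (by
      rintro i hi τ ⟨ct, h16, hB⟩
      rw [h.nat1] at hi
      exact inner i hi _ ((ct.setNat (x := 3) (v := i) (by decide)).tick) (by simp)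
        (by simpa using h16) (by simpa using hB))
  rw [h.nat1] at key
  exact key.2.2

end Search

/-! ### Correctness and cost of the program -/

section Run

variable (U : (d : ℕ) → Mat d → Fin d → Vec d)

/-- The part of `projProg` that computes the inner product of one vector of the embedding with
`Z`. -/
def dotProg : Prog :=
  .seq (.realConst ⟨4, 3, 4, 2⟩ 0)
    (.loop 5 0 (.seq (.arith .mul (sc 14) ⟨3, 3, 4, 5⟩ ⟨1, 3, 5, 2⟩)
      (.arith .add ⟨4, 3, 4, 2⟩ ⟨4, 3, 4, 2⟩ (sc 14))))

lemma exec_dotProg {σ : State} {n i j : ℕ} (h0 : σ.nats 0 = n) (h2 : σ.nats 2 = 0)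
    (h3 : σ.nats 3 = i) (h4 : σ.nats 4 = j) :
    (dotProg.exec U σ).reals 4 i j 0 =
      ∑ k ∈ Finset.range n, σ.reals 3 i j k * σ.reals 1 i k 0 ∧
    ∀ i' j' k', ¬ (i' = i ∧ j' = j) → (dotProg.exec U σ).reals 4 i' j' k' = σ.reals 4 i' j' k' := by
  rw [dotProg, Prog.exec]
  obtain ⟨ρ, hρ⟩ : ∃ ρ, ρ = (Prog.realConst ⟨4, 3, 4, 2⟩ 0).exec U σ := ⟨_, rfl⟩
  have hn : ρ.nats = σ.nats := by rw [hρ]; rfl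
  have hr1 : ρ.reals 1 = σ.reals 1 := by
    rw [hρ, Prog.exec_reals_of_not_writes _ _ _ (by simp [Prog.WritesReal])]
  have hr3 : ρ.reals 3 = σ.reals 3 := by
    rw [hρ, Prog.exec_reals_of_not_writes _ _ _ (by simp [Prog.WritesReal])]
  have hr4 : ∀ i' j' k', ρ.reals 4 i' j' k' =
      if i' = i ∧ j' = j ∧ k' = 0 then 0 else σ.reals 4 i' j' k' := by
    intro i' j' k'
    rw [hρ]
    simp [Prog.exec, State.set_reals, h2, h3, h4]
  rw [← hρ]
  have key := Prog.exec_loop_sum U (x := 5) (y := 0) (σ := ρ)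
    (p := .seq (.arith .mul (sc 14) ⟨3, 3, 4, 5⟩ ⟨1, 3, 5, 2⟩)
      (.arith .add ⟨4, 3, 4, 2⟩ ⟨4, 3, 4, 2⟩ (sc 14)))
    (fun τ => τ.reals 4 i j 0)
    (fun τ => τ.nats 2 = 0 ∧ τ.nats 3 = i ∧ τ.nats 4 = j ∧ τ.reals 1 = σ.reals 1 ∧
      τ.reals 3 = σ.reals 3 ∧ ∀ i' j' k', ¬ (i' = i ∧ j' = j) →
        τ.reals 4 i' j' k' = σ.reals 4 i' j' k')
    (fun k => σ.reals 3 i j k * σ.reals 1 i k 0) rfl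
    ⟨by simp [hn, h2], by simp [hn, h3], by simp [hn, h4], hr1, hr3, fun i' j' k' h => by
      rw [State.tick_reals, hr4, if_neg fun h' => h ⟨h'.1, h'.2.1⟩]⟩ (by
      rintro k _ τ ⟨a2, a3, a4, b1, b3, b4⟩
      refine ⟨?_, ?_, ?_, ?_, ?_, fun i' j' k' h => ?_⟩
      · simpa [Prog.exec] using a2
      · simpa [Prog.exec] using a3
      · simpa [Prog.exec] using a4
      · rw [Prog.exec_reals_of_not_writes _ _ _ (by simp [Prog.WritesReal, sc])]
        simpa using b1
      · rw [Prog.exec_reals_of_not_writes _ _ _ (by simp [Prog.WritesReal, sc])]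
        simpa using b3
      · rw [← b4 i' j' k' h]
        have : ¬ (i' = i ∧ j' = j ∧ k' = 0) := fun h' => h ⟨h'.1, h'.2.1⟩
        simp [Prog.exec, State.set_reals, sc, a2, a3, a4, this]) (by
      rintro k _ τ ⟨a2, a3, a4, b1, b3, b4⟩
      simp [Prog.exec, State.set_reals, State.get, sc, a2, a3, a4, b1, b3, Op.eval])
  rw [hn, h0] at key
  refine ⟨?_, key.1.2.2.2.2.2⟩
  rw [key.2]
  simp [hr4]

lemma callSDP_reals_eq {σ : State} {d n i s t j k : ℕ} (hd : d = n) (hj : j < n) (hk : k < n) :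
    (σ.callSDP U d i s t).reals t i j k =
      U n (fun p q => σ.reals s i p q) ⟨j, hj⟩ ⟨k, hk⟩ := by
  subst hd
  simp [State.callSDP, hj, hk]

/-- The projections of the instance number `i`, computed from the entries of the matrices and of the
Gaussian vectors. -/
def projAt (n : ℕ) (R0 R1 : ℕ → ℕ → ℕ → ℝ) (i : ℕ) (j : Fin n) : ℝ :=
  ∑ k : Fin n, U n (fun p q => R0 i p q) j k * R1 i k 0

lemma exec_projProg {σ : State} {n i : ℕ} (h0 : σ.nats 0 = n) (h2 : σ.nats 2 = 0)
    (h3 : σ.nats 3 = i) :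
    (∀ j : Fin n, (projProg.exec U σ).reals 4 i j 0 = projAt U n (σ.reals 0) (σ.reals 1) i j) ∧
    ∀ i' j' k', i' ≠ i → (projProg.exec U σ).reals 4 i' j' k' = σ.reals 4 i' j' k' := by
  have hprog : projProg = .seq (.sdp 0 3 0 3) (.loop 4 0 dotProg) := rfl
  rw [hprog, Prog.exec]
  obtain ⟨ρ, hρ⟩ : ∃ ρ, ρ = (Prog.sdp 0 3 0 3).exec U σ := ⟨_, rfl⟩
  have hn : ρ.nats = σ.nats := by rw [hρ]; rfl
  have hr1 : ρ.reals 1 = σ.reals 1 := by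
    rw [hρ, Prog.exec_reals_of_not_writes _ _ _ (by simp [Prog.WritesReal])]
  have hr4 : ρ.reals 4 = σ.reals 4 := by
    rw [hρ, Prog.exec_reals_of_not_writes _ _ _ (by simp [Prog.WritesReal])]
  have hr3 : ∀ j k : Fin n, ρ.reals 3 i j k = U n (fun p q => σ.reals 0 i p q) j k := by
    intro j k
    rw [hρ, ← h3]
    exact callSDP_reals_eq U h0 j.2 k.2
  rw [← hρ]
  have key := Prog.exec_loop_induct U (x := 4) (y := 0) (σ := ρ) (p := dotProg)
    (fun t τ => τ.nats 0 = n ∧ τ.nats 2 = 0 ∧ τ.nats 3 = i ∧ τ.reals 1 = ρ.reals 1 ∧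
      τ.reals 3 = ρ.reals 3 ∧
      (∀ j < t, τ.reals 4 i j 0 = ∑ k ∈ Finset.range n, ρ.reals 3 i j k * ρ.reals 1 i k 0) ∧
      ∀ i' j' k', i' ≠ i → τ.reals 4 i' j' k' = ρ.reals 4 i' j' k')
    ⟨by simp [hn, h0], by simp [hn, h2], by simp [hn, h3], rfl, rfl,
      fun j hj => absurd hj (Nat.not_lt_zero _), fun _ _ _ _ => rfl⟩ (by
      rintro t _ τ ⟨a0, a2, a3, b1, b3, b4, b5⟩
      have hd := exec_dotProg U (σ := (τ.setNat 4 t).tick) (n := n) (i := i) (j := t)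
        (by simpa using a0) (by simpa using a2) (by simpa using a3) (by simp)
      have w : ∀ z, z ≤ 3 → (dotProg.exec U (τ.setNat 4 t).tick).nats z = τ.nats z := by
        intro z hz
        rw [Prog.exec_nats_of_not_writes]
        · simp [show z ≠ 4 by omega]
        · simp [dotProg, Prog.WritesNat]; omega
      refine ⟨by rw [w _ (by decide), a0], by rw [w _ (by decide), a2], by rw [w _ le_rfl, a3],
        ?_, ?_, fun j hj => ?_, fun i' j' k' hi' => ?_⟩
      · rw [Prog.exec_reals_of_not_writes _ _ _ (by simp [dotProg, Prog.WritesReal, sc])]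
        simpa using b1
      · rw [Prog.exec_reals_of_not_writes _ _ _ (by simp [dotProg, Prog.WritesReal, sc])]
        simpa using b3
      · rcases (Nat.lt_succ_iff.1 hj).lt_or_eq with hlt | rfl
        · rw [hd.2 i j 0 (fun h => hlt.ne h.2)]
          simpa using b4 j hlt
        · rw [hd.1]
          simp [b1, b3]
      · rw [hd.2 i' j' k' (fun h => hi' h.1)]
        simpa using b5 i' j' k' hi')
  rw [hn, h0] at key
  obtain ⟨-, -, -, -, -, k1, k2⟩ := key
  refine ⟨fun j => ?_, fun i' j' k' h => by rw [k2 i' j' k' h, hr4]⟩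
  rw [k1 j j.2, Finset.sum_range, projAt]
  simp only [hr3, hr1]

/-- After the first phase, array `4` holds the projections. -/
lemma exec_projLoop {σ : State} {n m : ℕ} (h0 : σ.nats 0 = n) (h1 : σ.nats 1 = m)
    (h2 : σ.nats 2 = 0) :
    ∀ i < m, ∀ j : Fin n, ((Prog.loop 3 1 projProg).exec U σ).reals 4 i j 0 =
      projAt U n (σ.reals 0) (σ.reals 1) i j := by
  have key := Prog.exec_loop_induct U (x := 3) (y := 1) (σ := σ) (p := projProg)
    (fun t τ => τ.nats 0 = n ∧ τ.nats 2 = 0 ∧ τ.reals 0 = σ.reals 0 ∧ τ.reals 1 = σ.reals 1 ∧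
      ∀ i < t, ∀ j : Fin n, τ.reals 4 i j 0 = projAt U n (σ.reals 0) (σ.reals 1) i j)
    ⟨h0, h2, rfl, rfl, fun i hi => absurd hi (Nat.not_lt_zero _)⟩ (by
      rintro t _ τ ⟨a0, a2, b0, b1, b4⟩
      have hd := exec_projProg U (σ := (τ.setNat 3 t).tick) (n := n) (i := t)
        (by simpa using a0) (by simpa using a2) (by simp)
      have w : ∀ z, z ≤ 2 → (projProg.exec U (τ.setNat 3 t).tick).nats z = τ.nats z := by
        intro z hz
        rw [Prog.exec_nats_of_not_writes]
        · simp [show z ≠ 3 by omega]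
        · simp [projProg, Prog.WritesNat]; omega
      refine ⟨by rw [w _ (by decide), a0], by rw [w _ le_rfl, a2], ?_, ?_, fun i hi j => ?_⟩
      · rw [Prog.exec_reals_of_not_writes _ _ _ (by simp [projProg, Prog.WritesReal, sc])]
        simpa using b0
      · rw [Prog.exec_reals_of_not_writes _ _ _ (by simp [projProg, Prog.WritesReal, sc])]
        simpa using b1
      · rcases (Nat.lt_succ_iff.1 hi).lt_or_eq with hlt | rfl
        · rw [hd.2 i j 0 hlt.ne]
          simpa using b4 i hlt j
        · rw [hd.1 j]
          simp [b0, b1])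
  rw [h1] at key
  exact key.2.2.2.2

section Sample

variable {m n : ℕ} (S : Sample m n)

lemma initState_reals_zero (i : Fin m) (j k : Fin n) :
    (initState S).reals 0 i j k = (S i).1 j k := by
  simp [initState]

lemma initState_reals_one (i : Fin m) (k : Fin n) :
    (initState S).reals 1 i k 0 = (S i).2 k := by
  have : 0 < n := k.pos
  simp [initState, this]

lemma projAt_initState (i : Fin m) (j : Fin n) :
    projAt U n ((initState S).reals 0) ((initState S).reals 1) i j = proj (U n) S i j := by
  have h : (fun p q : Fin n => (initState S).reals 0 i p q) = (S i).1 := by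
    funext p q
    exact initState_reals_zero S i p q
  rw [projAt, h, proj, PiLp.inner_apply]
  refine Finset.sum_congr rfl fun k _ => ?_
  rw [initState_reals_one]
  simp [mul_comm]

lemma breakpoints_eq_thresholds {Y : ℕ → ℕ → ℕ → ℝ} {u : Mat n → Fin n → Vec n}
    (hY : ∀ (i : Fin m) (j : Fin n), Y i j 0 = proj u S i j) :
    breakpoints Y (fun i j => i < m ∧ j < n) = thresholds u S := by
  ext t
  constructor
  · rintro ⟨h0, i, j, ⟨hi, hj⟩, rfl⟩
    have := hY ⟨i, hi⟩ ⟨j, hj⟩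
    simp only at this
    exact ⟨h0, ⟨i, hi⟩, ⟨j, hj⟩, by rw [this]; rfl⟩
  · rintro ⟨h0, i, j, rfl⟩
    exact ⟨h0, i, j, ⟨i.2, j.2⟩, by rw [hY]; rfl⟩

variable {S} {A Y : ℕ → ℕ → ℕ → ℝ} {u : Mat n → Fin n → Vec n}
  (hA : ∀ (i : Fin m) (j k : Fin n), A i j k = (S i).1 j k)
  (hY : ∀ (i : Fin m) (j : Fin n), Y i j 0 = proj u S i j)

include hA hY

lemma sum_contrib_eq (c : ℝ) :
    ∑ i ∈ Finset.range m, ∑ j ∈ Finset.range n, ∑ k ∈ Finset.range n, contrib A Y c i j k =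
      (quadCoeff (fun e : Fin m × Fin n × Fin n => (S e.1).1 e.2.1 e.2.2)
        (fun e => proj u S e.1 e.2.1) (fun e => proj u S e.1 e.2.2) c,
      linCoeff (fun e : Fin m × Fin n × Fin n => (S e.1).1 e.2.1 e.2.2)
        (fun e => proj u S e.1 e.2.1) (fun e => proj u S e.1 e.2.2) c,
      constCoeff (fun e : Fin m × Fin n × Fin n => (S e.1).1 e.2.1 e.2.2)
        (fun e => proj u S e.1 e.2.1) (fun e => proj u S e.1 e.2.2) c) := by
  simp only [Finset.sum_range, contrib, hA, hY, quadCoeff, linCoeff, constCoeff,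
    Fintype.sum_prod_type, Prod.ext_iff, Prod.fst_sum, Prod.snd_sum, and_self]

lemma valueAt_eq_total {c : ℝ} (hc : 0 < c) : valueAt m n A Y c = total u S c := by
  rw [valueAt, sum_contrib_eq hA hY, total, roundSum_self _ _ _ hc]
  field_simp

/-- The breakpoints and the vertices decide about the maximum: between two consecutive breakpoints
the empirical sum is a quadratic polynomial in `1 / s`, whose coefficients are those computed at the
left endpoint. -/
lemma total_le_of_forall_breakpoint (hu : ∀ i, IsSDPEmbedding (S i).1 (u (S i).1))
    (hS : ∀ i, IsInstance (S i).1) (hne : (thresholds u S).Nonempty) {M : ℝ}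
    (h1 : ∀ t ∈ thresholds u S, total u S t ≤ M)
    (h2 : ∀ t ∈ thresholds u S, 0 < vertexAt m n A Y t → total u S (vertexAt m n A Y t) ≤ M)
    {s : ℝ} (hs : 0 < s) : total u S s ≤ M := by
  have H := hasBreakpoints_total u S hu hS
  refine H.forall_le hne (fun a ha b hb s hs => ?_) hs
  rcases (hs.1.trans hs.2).eq_or_lt with rfl | hab
  · rw [le_antisymm hs.2 hs.1]; exact h1 a ha
  obtain ⟨c, d, hcd, hsc, hsd⟩ := exists_consecutive H.finite ha hb hab hs.1 hs.2
  have hc : 0 < c := H.pos c hcd.1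
  have hd : 0 < d := H.pos d hcd.2.1
  have hquad : ∀ r, c ≤ r → r ≤ d → total u S r = _ := fun r hcr hrd => by
    have key : ∀ i j, |proj u S i j| ≤ c ∨ r ≤ |proj u S i j| := by
      intro i j
      rcases proj_eq_zero_or_mem u S i j with h | h
      · left; rw [h, abs_zero]; exact hc.le
      · by_contra! hcon
        exact hcd.2.2.2 _ h ⟨hcon.1, hcon.2.trans_le hrd⟩
    exact roundSum_eq_quadratic _ _ _ hc hcr (fun e => key e.1 e.2.1) (fun e => key e.1 e.2.2)
  have hs0 : 0 < s := hc.trans_le hsc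
  have hcM := h1 c hcd.1
  have hdM := h1 d hcd.2.1
  rw [hquad c le_rfl hcd.2.2.1.le] at hcM
  rw [hquad d hcd.2.2.1.le le_rfl] at hdM
  rw [hquad s hsc hsd]
  refine quadratic_le_of_endpoints_of_vertex (w₁ := 1 / d) (w₂ := 1 / c)
    (one_div_le_one_div_of_le hs0 hsd) (one_div_le_one_div_of_le hc hsc) hdM hcM ?_
  intro v hv1 hv2 hα hv
  have hv0 : 0 < v := lt_trans (by positivity) hv1
  have hvert : vertexAt m n A Y c = 1 / v := by
    rw [vertexAt, sum_contrib_eq hA hY]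
    simp only
    rw [eq_neg_of_add_eq_zero_right hv]
    field_simp
    ring
  have hM := h2 c hcd.1 (by rw [hvert]; positivity)
  rw [hvert, hquad (1 / v) ((le_one_div hc hv0).2 hv2.le) ((one_div_le hv0 hd).2 hv1.le),
    one_div_one_div] at hM
  exact hM

end Sample

/-- The best of the examined parameters is a global maximizer of the empirical average, and it is a
breakpoint or strictly better than all of them; hence it is an output of the algorithm. -/
theorem isERMOutput_run_ermProg (hU : ∀ d, IsSDPSolver (U d)) {m n : ℕ} (S : Sample m n)
    (hS : ∀ i, IsInstance (S i).1) : IsERMOutput (U n) S (ermProg.run U S).output := by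
  have hu : ∀ i, IsSDPEmbedding (S i).1 (U n (S i).1) := fun i => hU n _ (hS i)
  set σ := initState S with hσ
  obtain ⟨ρ, hρ⟩ : ∃ ρ, ρ = (Prog.loop 3 1 projProg).exec U σ := ⟨_, rfl⟩
  have c : Ctx n m (σ.reals 0) (ρ.reals 4) ρ := by
    have w : ∀ z, z ≤ 2 → ρ.nats z = σ.nats z := fun z hz => by
      rw [hρ, Prog.exec_nats_of_not_writes]
      simp [projProg, Prog.WritesNat]
      omega
    refine ⟨w 0 (by decide), w 1 (by decide), w 2 le_rfl, ?_, rfl, ?_⟩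
    · rw [hρ, Prog.exec_reals_of_not_writes _ _ _ (by simp [projProg, Prog.WritesReal, sc])]
    · rw [State.sv, hρ,
        Prog.exec_reals_of_not_writes _ _ _ (by simp [projProg, Prog.WritesReal, sc])]
      simp [hσ, initState]
  have hA : ∀ (i : Fin m) (j k : Fin n), σ.reals 0 i j k = (S i).1 j k := initState_reals_zero S
  have hY : ∀ (i : Fin m) (j : Fin n), ρ.reals 4 i j 0 = proj (U n) S i j := fun i j => by
    rw [hρ, exec_projLoop U (σ := σ) (n := n) (m := m) rfl rfl rfl i i.2 j]
    exact projAt_initState U S i j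
  have hout : IsBest (valueAt m n (σ.reals 0) (ρ.reals 4)) (vertexAt m n (σ.reals 0) (ρ.reals 4))
      (thresholds (U n) S) (thresholds (U n) S) (ermProg.run U S).output := by
    rw [← breakpoints_eq_thresholds S hY]
    rw [Prog.run, ermProg, Prog.exec, ← hσ, ← hρ]
    -- the first parameter examined is `1`, which is returned if there are no breakpoints
    refine c.realConst_then U (by decide) 1 (P := fun τ => IsBest _ _ _ _ τ.output)
      fun τ₁ c₁ n₁ v₁ => ?_
    rw [Prog.exec]
    refine c₁.exec_eval U (P := fun τ => IsBest _ _ _ _ (Prog.exec U _ τ).output)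
      fun τ₂ c₂ _ _ h17 _ _ h5 _ => ?_
    rw [Prog.exec]
    refine c₂.exec_keep U (P := fun τ => IsBest _ _ _ _ (Prog.exec U _ τ).output)
      fun τ₃ c₃ _ h2 h16 _ => ?_
    have e5 : τ₁.sv 5 = 1 := by simp [v₁]
    have e2 : τ₃.sv 2 = 1 := by rw [h2, h5, e5]
    exact c₃.exec_search U (by rw [h16, h17, e2, e5]) (by rw [e2]; exact one_pos)
  generalize (ermProg.run U S).output = b at hout
  have hW : ∀ {s}, 0 < s → valueAt m n (σ.reals 0) (ρ.reals 4) s = total (U n) S s := fun hs =>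
    valueAt_eq_total hA hY hs
  have hb := hout.pos
  have H := hasBreakpoints_total (U n) S hu hS
  have hmax : ∀ s, 0 < s → total (U n) S s ≤ total (U n) S b := by
    intro s hs
    rcases (thresholds (U n) S).eq_empty_or_nonempty with hE | hne
    · exact (H.eq_of_empty hE s b hs hb).le
    · refine total_le_of_forall_breakpoint hA hY hu hS hne (fun t ht => ?_) (fun t ht h => ?_) hs
      · rw [← hW (H.pos t ht), ← hW hb]; exact hout.le t ht
      · rw [← hW h, ← hW hb]; exact hout.vertex_le t ht h
  refine isERMOutput_of_forall_le hu hS hb (hout.mem_or_lt.imp_right fun h t ht => ?_) fun s hs => ?_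
  · have hm : 0 < (m : ℝ) := by
      obtain ⟨_, i, _⟩ := ht
      exact_mod_cast i.pos
    rw [empirical_eq_total, empirical_eq_total, ← hW (H.pos t ht), ← hW hb]
    exact mul_lt_mul_of_pos_left (h t ht) (by positivity)
  · rw [empirical_eq_total, empirical_eq_total]
    exact mul_le_mul_of_nonneg_left (hmax s hs) (by positivity)

lemma inputLoops_ermProg : ermProg.InputLoops := by
  simp [ermProg, searchProg, projProg, absProg, examineProg, vertexProg, keepProg, evalProg,
    coeffProg, entryProg, macProg, splitProg, Prog.InputLoops]

lemma not_writesNat_ermProg {z : ℕ} (hz : z ≤ 1) : ¬ ermProg.WritesNat z := by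
  simp [ermProg, searchProg, projProg, absProg, examineProg, vertexProg, keepProg, evalProg,
    coeffProg, entryProg, macProg, splitProg, Prog.WritesNat]
  omega

theorem steps_run_ermProg_le {m n : ℕ} (S : Sample m n) :
    (ermProg.run U S).steps ≤ ermProg.size * (m + n + 1) ^ ermProg.depth := by
  have := Prog.exec_steps_le U (N := m + n) ermProg (initState S) inputLoops_ermProg
    (not_writesNat_ermProg zero_le_one) (not_writesNat_ermProg le_rfl)
    (Nat.le_add_left n m) (Nat.le_add_right m n)
  simpa [Prog.run, initState] using this

theorem calls_run_ermProg_le {m n : ℕ} (S : Sample m n) : (ermProg.run U S).calls ≤ m := by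
  have := Prog.exec_calls_le U ermProg (initState S) inputLoops_ermProg
    (not_writesNat_ermProg zero_le_one) (not_writesNat_ermProg le_rfl)
  refine this.trans (le_of_eq ?_)
  simp [ermProg, searchProg, projProg, absProg, examineProg, vertexProg, keepProg, evalProg,
    coeffProg, entryProg, macProg, splitProg, Prog.callBound, initState]

/-- The sample size is polynomial in `n`, `H / ε` and `1 / δ`. -/
lemma ceil_sampleSize_add_le {c H ε δ : ℝ} (hc : 0 ≤ c) (n : ℕ) (hH : 0 ≤ H) (hε : 0 < ε)
    (hδ0 : 0 < δ) (hδ1 : δ ≤ 1) :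
    ((⌈sampleSize c H ε δ n⌉₊ + n + 1 : ℕ) : ℝ) ≤
      (4 * c + 3) * (n + H / ε + 1 / δ) ^ 3 := by
  set x := H / ε with hx
  have hx0 : 0 ≤ x := by positivity
  have hd1 : 1 ≤ 1 / δ := by rw [le_div_iff₀ hδ0]; linarith
  have hn0 : (0 : ℝ) ≤ n := by positivity
  set B := n + x + 1 / δ with hB
  have hB1 : 1 ≤ B := by linarith
  have hlog1 : Real.log (max n 2 : ℕ) ≤ 3 * B := by
    refine (Real.log_le_self (by positivity)).trans ?_
    have : ((max n 2 : ℕ) : ℝ) ≤ n + 2 := by exact_mod_cast max_le (by omega) (by omega)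
    linarith
  have hlog2 : Real.log (1 / δ) ≤ B := by
    refine (Real.log_le_self (by positivity)).trans ?_
    linarith
  have hsize : sampleSize c H ε δ n ≤ 4 * c * B ^ 3 := by
    have : x ^ 2 ≤ B ^ 2 := by
      have : x ≤ B := by linarith
      gcongr
    calc sampleSize c H ε δ n
        = c * x ^ 2 * (Real.log (max n 2 : ℕ) + Real.log (1 / δ)) := rfl
      _ ≤ c * B ^ 2 * (4 * B) := by
          have h0 : 0 ≤ Real.log (max n 2 : ℕ) + Real.log (1 / δ) :=
            add_nonneg (Real.log_natCast_nonneg _) (Real.log_nonneg hd1)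
          gcongr
          linarith
      _ = 4 * c * B ^ 3 := by ring
  have hceil : (⌈sampleSize c H ε δ n⌉₊ : ℝ) ≤ 4 * c * B ^ 3 + 1 :=
    (Nat.cast_le.2 (Nat.ceil_mono hsize)).trans (Nat.ceil_lt_add_one (by positivity)).le
  have hB3 : B ≤ B ^ 3 := le_self_pow₀ hB1 (by norm_num)
  push_cast
  nlinarith

end Run

end

end MaxQP

theorem mainTheorem1 :
    ∃ c : ℝ, 0 < c ∧
      (∀ (n : ℕ) (U : MaxQP.Mat n → Fin n → MaxQP.Vec n),
        MaxQP.IsSDPSolver U → Measurable U →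
        ∀ (D : Measure (MaxQP.Mat n)) [IsProbabilityMeasure D] (H ε δ : ℝ) (m : ℕ),
          (∀ᵐ A ∂D, MaxQP.IsInstance A) →
          (∀ᵐ A ∂D, ∀ (Z : MaxQP.Vec n) (s : ℝ), 0 < s → |MaxQP.slin U s A Z| ≤ H) →
          0 < ε → 0 < δ → δ ≤ 1 →
          MaxQP.sampleSize c H ε δ n ≤ m →
          (Measure.pi fun _ : Fin m => D.prod (stdGaussian (MaxQP.Vec n)))
            {S : MaxQP.Sample m n | ¬ ∀ sHat : ℝ, MaxQP.IsERMOutput U S sHat →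
              MaxQP.expCost U D sHat - (⨅ s : {s : ℝ // 0 < s}, MaxQP.expCost U D s) < ε}
            ≤ ENNReal.ofReal δ) ∧
      ∃ p : MaxQP.Prog,
        (∃ C k : ℕ, ∀ (U : (d : ℕ) → MaxQP.Mat d → Fin d → MaxQP.Vec d),
          (∀ d, MaxQP.IsSDPSolver (U d)) →
          ∀ (m n : ℕ) (S : MaxQP.Sample m n), (∀ i, MaxQP.IsInstance (S i).1) →
            MaxQP.IsERMOutput (U n) S (p.run U S).output ∧
            (p.run U S).steps ≤ C * (m + n + 1) ^ k ∧
            (p.run U S).calls ≤ m) ∧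
        (∃ C k : ℕ, ∀ (U : (d : ℕ) → MaxQP.Mat d → Fin d → MaxQP.Vec d),
          (∀ d, MaxQP.IsSDPSolver (U d)) →
          ∀ (n m : ℕ) (H ε δ : ℝ), 0 ≤ H → 0 < ε → 0 < δ → δ ≤ 1 →
            m = ⌈MaxQP.sampleSize c H ε δ n⌉₊ →
            ∀ S : MaxQP.Sample m n, (∀ i, MaxQP.IsInstance (S i).1) →
              ((p.run U S).steps : ℝ) ≤ C * (n + H / ε + 1 / δ) ^ k) := by
  refine ⟨221184, by norm_num, fun n U hU hUm D _ H ε δ m hD hH hε hδ0 hδ1 hm =>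
    MaxQP.measure_not_learned_le hU hUm hD hH hε hδ0 hδ1 hm, MaxQP.ermProg,
    ⟨MaxQP.ermProg.size, MaxQP.ermProg.depth, fun U hU m n S hS =>
      ⟨MaxQP.isERMOutput_run_ermProg U hU S hS, MaxQP.steps_run_ermProg_le U S,
        MaxQP.calls_run_ermProg_le U S⟩⟩,
    -- `884739 = 4 * 221184 + 3` comes from the bound on the sample size
    ⟨MaxQP.ermProg.size * 884739 ^ MaxQP.ermProg.depth, 3 * MaxQP.ermProg.depth, ?_⟩⟩
  intro U _ n m H ε δ hH hε hδ0 hδ1 hm S _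
  have hsize : ((m + n + 1 : ℕ) : ℝ) ≤ 884739 * (n + H / ε + 1 / δ) ^ 3 := by
    have := MaxQP.ceil_sampleSize_add_le (c := 221184) (by norm_num) n hH hε hδ0 hδ1
    rw [← hm] at this
    norm_num at this ⊢
    exact this
  calc ((MaxQP.ermProg.run U S).steps : ℝ)
      ≤ (MaxQP.ermProg.size * (m + n + 1) ^ MaxQP.ermProg.depth : ℕ) :=
        Nat.cast_le.2 (MaxQP.steps_run_ermProg_le U S)
    _ = MaxQP.ermProg.size * ((m + n + 1 : ℕ) : ℝ) ^ MaxQP.ermProg.depth := by push_cast; rfl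
    _ ≤ MaxQP.ermProg.size * (884739 * (n + H / ε + 1 / δ) ^ 3) ^ MaxQP.ermProg.depth := by gcongr
    _ = (MaxQP.ermProg.size * 884739 ^ MaxQP.ermProg.depth : ℕ) *
          (n + H / ε + 1 / δ) ^ (3 * MaxQP.ermProg.depth) := by
        push_cast; rw [mul_pow, pow_mul]; ring
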